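/- **Setting.** Let $\mathbb K$ be $\mathbb R$ or $\mathbb C$, and let $G$ be a connected (real or complex) finite-dimensional Lie group whose Lie algebra $\mathcal G$ is self-dual, i.e. carries an invariant nondegenerate symmetric bilinear form $\langle\ ,\ \rangle$. Let $\{T_a\}$, $\{T^a\}$ be dual bases of $\mathcal G$, $\langle T_a,T^b\rangle=\delta_a^b$, let $[T_a,T_b]=f_{ab}^cT_c$, and put $f=f_{ab}^c\,T^a\otimes T^b\otimes T_c$ and $C=T_a\otimes T^a$ (summation over repeated indices). Let $r\in\mathcal G\wedge\mathcal G$ be a constant solution of the modified classical Yang–Baxter equation $[r_{12},r_{13}]+\text{cycl. perm.}=-\tfrac14 f$, and let $r^\pm=r\pm\tfrac12 C$. Let $\check G\subset G$ be an open subset that is stable under conjugation by every $q\in G$, and let $R:\check G\to\mathcal G\wedge\mathcal G$ be a smooth (if $\mathbb K=\mathbb R$) or holomorphic (if $\mathbb K=\mathbb C$) map that is $G$-equivariant: $R(q\Omega q^{-1})=(q\otimes q)R(\Omega)(q^{-1}\otimes q^{-1})$ for all $q\in G$, $\Omega\in\check G$, where the right side denotes $(\mathrm{Ad}_q\otimes\mathrm{Ad}_q)R(\Omega)$.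 On $\check P=\check G\times G\times\check G=\{(\Omega^L,g,\Omega^R)\}$ consider the bracket of functions that is given, in the usual tensor notation, by $$\{g_1,g_2\}=(r+R(\Omega^L))g_1g_2-g_1g_2(r+R(\Omega^R)),$$ $$\{\Omega^L_1,\Omega^L_2\}=r\Omega^L_1\Omega^L_2+\Omega^L_1\Omega^L_2r-\Omega^L_1r^-\Omega^L_2-\Omega^L_2r^+\Omega^L_1,$$ $$\{\Omega^L_1,g_2\}=(r^+\Omega^L_1-\Omega^L_1r^-)g_2,$$ $$\{\Omega^R_1,\Omega^R_2\}=-\left(r\Omega^R_1\Omega^R_2+\Omega^R_1\Omega^R_2r-\Omega^R_1r^-\Omega^R_2-\Omega^R_2r^+\Omega^R_1\right),$$ $$\{\Omega^R_1,g_2\}=g_2(r^+\Omega^R_1-\Omega^R_1r^-),\qquad \{\Omega^R_1,\Omega^L_2\}=0 .$$ Here a factor $X\in\mathcal G$ standing to the left (right) of a group variable denotes the derivative along left (right) multiplication of that variable by $X$; thus the bracket is a bidifferential operator of order $(1,1)$ that is defined without a matrix representation of $G$. For $X\in\mathcal G$ let $\mathcal D^+_X=\rho_X+\lambda_X$, where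 $\lambda_X$ and $\rho_X$ are the vector fields on $G$ that operate by left and by right multiplication by $X$, and $\mathcal D_a^+=\mathcal D^+_{T_a}$. **Proposition 1.** The bracket is a Poisson bracket (bilinear, antisymmetric, a derivation in each argument, satisfying the Jacobi identity) on the smooth functions on $\check P$ if $\mathbb K=\mathbb R$, respectively on the holomorphic functions on every open subset of $\check P$ if $\mathbb K=\mathbb C$, if and only if there is a $G$-invariant constant element $\mathcal I\in\mathcal G\wedge\mathcal G\wedge\mathcal G$ such that $$[R_{12},R_{13}]+\tfrac12\,T^a_3\,\mathcal D^+_aR_{12}+\text{cycl. perm.}=\mathcal I\qquad\text{on }\check G .$$ -/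

import Mathlib

open scoped Manifold ContDiff TensorProduct

noncomputable section

/-! ### Tensors over a Lie algebra `L`; `L ⊗ L ⊗ L` is `L ⊗ (L ⊗ L)` -/

namespace PLCDYBE

section Algebra

variable {𝕜 : Type*} [Field 𝕜] {L : Type*} [LieRing L] [LieAlgebra 𝕜 L]

/-- `t ∈ L ∧ L`, seen as an antisymmetric element of `L ⊗ L`. -/
def IsAntisymm₂ (t : L ⊗[𝕜] L) : Prop :=
  TensorProduct.comm 𝕜 L L t = -t

/-- `t ∈ L ∧ L ∧ L`, seen as a totally antisymmetric element of `L ⊗ L ⊗ L`. -/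
def IsAntisymm₃ (t : L ⊗[𝕜] (L ⊗[𝕜] L)) : Prop :=
  TensorProduct.leftComm 𝕜 L L L t = -t ∧
    LinearMap.lTensor L (TensorProduct.comm 𝕜 L L).toLinearMap t = -t

/-- The operation `(s, t) ↦ [s₁₂, t₁₃]`; on pure tensors
`(a ⊗ b, c ⊗ d) ↦ [a, c] ⊗ b ⊗ d`. -/
def bracket1213 : (L ⊗[𝕜] L) →ₗ[𝕜] (L ⊗[𝕜] L) →ₗ[𝕜] (L ⊗[𝕜] (L ⊗[𝕜] L)) :=
  TensorProduct.map₂ (LieModule.toEnd 𝕜 L L : L →ₗ[𝕜] Module.End 𝕜 L) (TensorProduct.mk 𝕜 L L)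

theorem bracket1213_tmul (a b c d : L) :
    bracket1213 (𝕜 := 𝕜) (a ⊗ₜ b) (c ⊗ₜ d) = ⁅a, c⁆ ⊗ₜ (b ⊗ₜ d) := rfl

/-- The cyclic permutation of the three tensor factors, `x ⊗ y ⊗ z ↦ z ⊗ x ⊗ y`. -/
def rotate : (L ⊗[𝕜] (L ⊗[𝕜] L)) →ₗ[𝕜] (L ⊗[𝕜] (L ⊗[𝕜] L)) :=
  (TensorProduct.comm 𝕜 (L ⊗[𝕜] L) L).toLinearMap ∘ₗ
    (TensorProduct.assoc 𝕜 L L L).symm.toLinearMap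

theorem rotate_tmul (x y z : L) :
    rotate (𝕜 := 𝕜) (x ⊗ₜ (y ⊗ₜ z)) = z ⊗ₜ (x ⊗ₜ y) := rfl

/-- `t + cycl. perm.` -/
def cyclicSum (t : L ⊗[𝕜] (L ⊗[𝕜] L)) : L ⊗[𝕜] (L ⊗[𝕜] L) :=
  t + rotate t + rotate (rotate t)

variable {ι : Type*} [Fintype ι]

/-- The tensor `C = ∑ₐ Tₐ ⊗ Tᵃ`. -/
def casimir (T T' : ι → L) : L ⊗[𝕜] L := ∑ a, T a ⊗ₜ[𝕜] T' a

/-- The tensor `f = f_{ab}^c Tᵃ ⊗ Tᵇ ⊗ T_c`, where `[Tₐ, T_b] = f_{ab}^c T_c`. -/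
def structureTensor (T T' : ι → L) : L ⊗[𝕜] (L ⊗[𝕜] L) :=
  ∑ a, ∑ b, T' a ⊗ₜ[𝕜] (T' b ⊗ₜ[𝕜] ⁅T a, T b⁆)

/-- The modified classical Yang-Baxter equation
`[r₁₂, r₁₃] + cycl. perm. = -(1/4) f`. -/
def ModifiedCYBE (T T' : ι → L) (r : L ⊗[𝕜] L) : Prop :=
  cyclicSum (bracket1213 r r) = (-(1 / 4) : 𝕜) • structureTensor T T'

/-- The contraction of `t ∈ L ⊗ L` with two linear forms: `(a ⊗ b, α, β) ↦ α a * β b`. -/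
def contract (t : L ⊗[𝕜] L) (α β : L →ₗ[𝕜] 𝕜) : 𝕜 :=
  TensorProduct.lift ((LinearMap.mul 𝕜 𝕜).compl₁₂ α β) t

theorem contract_tmul (a b : L) (α β : L →ₗ[𝕜] 𝕜) :
    contract (a ⊗ₜ[𝕜] b) α β = α a * β b := rfl

end Algebra

/-! ### The Lie group -/

section Group

variable {𝕜 : Type*} [RCLike 𝕜] {E : Type*} [NormedAddCommGroup E] [NormedSpace 𝕜 E]
  {G : Type*} [TopologicalSpace G] [ChartedSpace E G] [Group G]

/-- The adjoint action of `q`: the derivative at `1` of `h ↦ q h q⁻¹`. (The tangent spaces at `1`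
and at `q * 1 * q⁻¹` are the same.) -/
def Ad (𝕜 : Type*) [RCLike 𝕜] [NormedSpace 𝕜 E] (q : G) :
    GroupLieAlgebra 𝓘(𝕜, E) G →ₗ[𝕜] GroupLieAlgebra 𝓘(𝕜, E) G :=
  (mfderiv 𝓘(𝕜, E) 𝓘(𝕜, E) (fun h : G => q * h * q⁻¹) 1).toLinearMap

/-- The vector fields that operate by left multiplication (they are right-invariant):
`leftDeriv F x X` is the derivative of `F` at `x` in the direction `X x`. -/
def leftDeriv (F : G → 𝕜) (x : G) : GroupLieAlgebra 𝓘(𝕜, E) G →ₗ[𝕜] 𝕜 :=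
  (mfderiv 𝓘(𝕜, E) 𝓘(𝕜, 𝕜) (fun h : G => F (h * x)) 1).toLinearMap

/-- The vector fields that operate by right multiplication (they are left-invariant):
`rightDeriv F x X` is the derivative of `F` at `x` in the direction `x X`. -/
def rightDeriv (F : G → 𝕜) (x : G) : GroupLieAlgebra 𝓘(𝕜, E) G →ₗ[𝕜] 𝕜 :=
  (mfderiv 𝓘(𝕜, E) 𝓘(𝕜, 𝕜) (fun h : G => F (x * h)) 1).toLinearMap

instance [LieGroup 𝓘(𝕜, E) ∞ G] : LieGroup 𝓘(𝕜, E) (minSmoothness 𝕜 3) G := by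
  rw [minSmoothness_of_isRCLikeNormedField]; infer_instance

variable [CompleteSpace E] [LieGroup 𝓘(𝕜, E) ∞ G] {ι : Type*} [Fintype ι]

/-- The derivative of an `L ⊗ L`-valued function, componentwise in the basis `T_i ⊗ T_j`; here `D`
is a derivation at a point of the scalar functions. -/
def derivTensor {L : Type*} [AddCommGroup L] [Module 𝕜 L] (T : Module.Basis ι 𝕜 L)
    (D : (G → 𝕜) → 𝕜) (R : G → L ⊗[𝕜] L) : L ⊗[𝕜] L :=
  ∑ i, ∑ j, D (fun y => (T.tensorProduct T).repr (R y) (i, j)) • (T i ⊗ₜ[𝕜] T j)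

/-- The map `R` is smooth on `s` (holomorphic if `𝕜 = ℂ`): its components are. -/
def IsSmoothTensorOn (T : Module.Basis ι 𝕜 (GroupLieAlgebra 𝓘(𝕜, E) G))
    (R : G → GroupLieAlgebra 𝓘(𝕜, E) G ⊗[𝕜] GroupLieAlgebra 𝓘(𝕜, E) G) (s : Set G) : Prop :=
  ∀ i j, ContMDiffOn 𝓘(𝕜, E) 𝓘(𝕜, 𝕜) ∞ (fun y => (T.tensorProduct T).repr (R y) (i, j)) s

/-- `G`-equivariance on `s`: `R (q Ω q⁻¹) = (q ⊗ q) R(Ω) (q⁻¹ ⊗ q⁻¹)`. -/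
def IsEquivariantOn
    (R : G → GroupLieAlgebra 𝓘(𝕜, E) G ⊗[𝕜] GroupLieAlgebra 𝓘(𝕜, E) G) (s : Set G) : Prop :=
  ∀ q : G, ∀ Ω ∈ s, R (q * Ω * q⁻¹) = TensorProduct.map (Ad 𝕜 q) (Ad 𝕜 q) (R Ω)

/-- `G`-invariance of an element of the triple tensor product. -/
def IsInvariant₃ (t : GroupLieAlgebra 𝓘(𝕜, E) G ⊗[𝕜]
    (GroupLieAlgebra 𝓘(𝕜, E) G ⊗[𝕜] GroupLieAlgebra 𝓘(𝕜, E) G)) : Prop :=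
  ∀ q : G, TensorProduct.map (Ad 𝕜 q) (TensorProduct.map (Ad 𝕜 q) (Ad 𝕜 q)) t = t

/-- `D⁺_X R (Ω)`, where `D⁺_X` is the sum of the derivations by the vector fields operating by
right and by left multiplication by `X`. -/
def derivPlus (T : Module.Basis ι 𝕜 (GroupLieAlgebra 𝓘(𝕜, E) G))
    (R : G → GroupLieAlgebra 𝓘(𝕜, E) G ⊗[𝕜] GroupLieAlgebra 𝓘(𝕜, E) G)
    (X : GroupLieAlgebra 𝓘(𝕜, E) G) (Ω : G) :
    GroupLieAlgebra 𝓘(𝕜, E) G ⊗[𝕜] GroupLieAlgebra 𝓘(𝕜, E) G :=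
  derivTensor T (fun F => rightDeriv F Ω X + leftDeriv F Ω X) R

/-- The left-hand side `[R₁₂, R₁₃] + (1/2) Tᵃ₃ D⁺ₐ R₁₂ + cycl. perm.`, at `Ω`. -/
def plcdybeLHS (T T' : Module.Basis ι 𝕜 (GroupLieAlgebra 𝓘(𝕜, E) G))
    (R : G → GroupLieAlgebra 𝓘(𝕜, E) G ⊗[𝕜] GroupLieAlgebra 𝓘(𝕜, E) G) (Ω : G) :
    GroupLieAlgebra 𝓘(𝕜, E) G ⊗[𝕜]
      (GroupLieAlgebra 𝓘(𝕜, E) G ⊗[𝕜] GroupLieAlgebra 𝓘(𝕜, E) G) :=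
  cyclicSum (bracket1213 (R Ω) (R Ω) +
    (1 / 2 : 𝕜) • ∑ a, TensorProduct.assoc 𝕜 _ _ _ (derivPlus T R (T a) Ω ⊗ₜ[𝕜] T' a))

/-- The Poisson-Lie classical dynamical Yang-Baxter equation on `s`. -/
def SatisfiesPLCDYBE (T T' : Module.Basis ι 𝕜 (GroupLieAlgebra 𝓘(𝕜, E) G))
    (R : G → GroupLieAlgebra 𝓘(𝕜, E) G ⊗[𝕜] GroupLieAlgebra 𝓘(𝕜, E) G) (s : Set G) : Prop :=
  ∃ c : GroupLieAlgebra 𝓘(𝕜, E) G ⊗[𝕜]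
      (GroupLieAlgebra 𝓘(𝕜, E) G ⊗[𝕜] GroupLieAlgebra 𝓘(𝕜, E) G),
    IsAntisymm₃ c ∧ IsInvariant₃ c ∧ ∀ Ω ∈ s, plcdybeLHS T T' R Ω = c

/-! ### The bracket on functions of `(Ω^L, g, Ω^R)` -/

/-- The domain `Ǧ × G × Ǧ`. -/
def domain (s : Set G) : Set (G × G × G) := s ×ˢ (Set.univ ×ˢ s)

/-- Left multiplication derivative in the variable `Ω^L`. -/
def leftL (F : G × G × G → 𝕜) (p : G × G × G) : GroupLieAlgebra 𝓘(𝕜, E) G →ₗ[𝕜] 𝕜 :=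
  leftDeriv (fun y => F (y, p.2.1, p.2.2)) p.1

/-- Right multiplication derivative in the variable `Ω^L`. -/
def rightL (F : G × G × G → 𝕜) (p : G × G × G) : GroupLieAlgebra 𝓘(𝕜, E) G →ₗ[𝕜] 𝕜 :=
  rightDeriv (fun y => F (y, p.2.1, p.2.2)) p.1

/-- Left multiplication derivative in the variable `g`. -/
def leftM (F : G × G × G → 𝕜) (p : G × G × G) : GroupLieAlgebra 𝓘(𝕜, E) G →ₗ[𝕜] 𝕜 :=
  leftDeriv (fun y => F (p.1, y, p.2.2)) p.2.1

/-- Right multiplication derivative in the variable `g`. -/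
def rightM (F : G × G × G → 𝕜) (p : G × G × G) : GroupLieAlgebra 𝓘(𝕜, E) G →ₗ[𝕜] 𝕜 :=
  rightDeriv (fun y => F (p.1, y, p.2.2)) p.2.1

/-- Left multiplication derivative in the variable `Ω^R`. -/
def leftR (F : G × G × G → 𝕜) (p : G × G × G) : GroupLieAlgebra 𝓘(𝕜, E) G →ₗ[𝕜] 𝕜 :=
  leftDeriv (fun y => F (p.1, p.2.1, y)) p.2.2

/-- Right multiplication derivative in the variable `Ω^R`. -/
def rightR (F : G × G × G → 𝕜) (p : G × G × G) : GroupLieAlgebra 𝓘(𝕜, E) G →ₗ[𝕜] 𝕜 :=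
  rightDeriv (fun y => F (p.1, p.2.1, y)) p.2.2

/-- The expression `r Ω₁ Ω₂ + Ω₁ Ω₂ r - Ω₁ r⁻ Ω₂ - Ω₂ r⁺ Ω₁`, contracted with the differentials of
two functions: `lF, lH` (`ρF, ρH`) are their derivatives with respect to left (right)
multiplication of `Ω`. A Lie algebra factor written to the left of a group variable stands for a
left multiplication derivative, one to the right of it for a right multiplication derivative; the
first tensor factor acts on the first function and the second one on the second. -/
def stsTerm {L : Type*} [LieRing L] [LieAlgebra 𝕜 L] (r rp rm : L ⊗[𝕜] L)
    (lF ρF lH ρH : L →ₗ[𝕜] 𝕜) : 𝕜 :=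
  contract r lF lH + contract r ρF ρH - contract rm ρF lH - contract rp lF ρH

/-- The bracket with (for `(Ω^L, g, Ω^R) = p`, `r± = r ± C/2`)
* `{g₁, g₂} = (r + R(Ω^L)) g₁ g₂ - g₁ g₂ (r + R(Ω^R))`,
* `{Ω^L₁, Ω^L₂} = r Ω^L₁ Ω^L₂ + Ω^L₁ Ω^L₂ r - Ω^L₁ r⁻ Ω^L₂ - Ω^L₂ r⁺ Ω^L₁`,
* `{Ω^R₁, Ω^R₂} = -(r Ω^R₁ Ω^R₂ + Ω^R₁ Ω^R₂ r - Ω^R₁ r⁻ Ω^R₂ - Ω^R₂ r⁺ Ω^R₁)`,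
* `{Ω^L₁, g₂} = (r⁺ Ω^L₁ - Ω^L₁ r⁻) g₂`,
* `{Ω^R₁, g₂} = g₂ (r⁺ Ω^R₁ - Ω^R₁ r⁻)`,
* `{Ω^R₁, Ω^L₂} = 0`,
written as a bidifferential operator, so that no matrix representation of `G` is needed. The value
at `p` depends only on the functions near `p`. -/
def poissonBracket (T T' : Module.Basis ι 𝕜 (GroupLieAlgebra 𝓘(𝕜, E) G))
    (r : GroupLieAlgebra 𝓘(𝕜, E) G ⊗[𝕜] GroupLieAlgebra 𝓘(𝕜, E) G)
    (R : G → GroupLieAlgebra 𝓘(𝕜, E) G ⊗[𝕜] GroupLieAlgebra 𝓘(𝕜, E) G)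
    (F H : G × G × G → 𝕜) (p : G × G × G) : 𝕜 :=
  let rp := r + (1 / 2 : 𝕜) • casimir (𝕜 := 𝕜) T T'
  let rm := r - (1 / 2 : 𝕜) • casimir (𝕜 := 𝕜) T T'
  -- `{g₁, g₂}`
  contract (r + R p.1) (leftM F p) (leftM H p)
    - contract (r + R p.2.2) (rightM F p) (rightM H p)
  -- `{Ω^L₁, Ω^L₂}` and `{Ω^R₁, Ω^R₂}`
  + stsTerm r rp rm (leftL F p) (rightL F p) (leftL H p) (rightL H p)
  - stsTerm r rp rm (leftR F p) (rightR F p) (leftR H p) (rightR H p)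
  -- `{Ω^L₁, g₂}` and `{g₁, Ω^L₂}`
  + (contract rp (leftL F p) (leftM H p) - contract rm (rightL F p) (leftM H p))
  - (contract rp (leftL H p) (leftM F p) - contract rm (rightL H p) (leftM F p))
  -- `{Ω^R₁, g₂}` and `{g₁, Ω^R₂}`
  + (contract rp (leftR F p) (rightM H p) - contract rm (rightR F p) (rightM H p))
  - (contract rp (leftR H p) (rightM F p) - contract rm (rightR H p) (rightM F p))

end Group

/-- `br` is a Poisson bracket on the functions on the open set `U` of a manifold that are smooth
(holomorphic if `𝕜 = ℂ`). Functions on `U` are represented by functions on `M`, of which only the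
restriction to `U` matters. -/
structure IsPoissonBracketOn {𝕜 : Type*} [RCLike 𝕜] {V : Type*} [NormedAddCommGroup V]
    [NormedSpace 𝕜 V] {H : Type*} [TopologicalSpace H] (J : ModelWithCorners 𝕜 V H)
    {M : Type*} [TopologicalSpace M] [ChartedSpace H M] (U : Set M)
    (br : (M → 𝕜) → (M → 𝕜) → M → 𝕜) : Prop where
  congr : ∀ f f' h h', ContMDiffOn J 𝓘(𝕜, 𝕜) ∞ f U → ContMDiffOn J 𝓘(𝕜, 𝕜) ∞ h U →
    Set.EqOn f f' U → Set.EqOn h h' U → Set.EqOn (br f h) (br f' h') U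
  smooth : ∀ f h, ContMDiffOn J 𝓘(𝕜, 𝕜) ∞ f U → ContMDiffOn J 𝓘(𝕜, 𝕜) ∞ h U →
    ContMDiffOn J 𝓘(𝕜, 𝕜) ∞ (br f h) U
  add_left : ∀ f f' h, ContMDiffOn J 𝓘(𝕜, 𝕜) ∞ f U → ContMDiffOn J 𝓘(𝕜, 𝕜) ∞ f' U →
    ContMDiffOn J 𝓘(𝕜, 𝕜) ∞ h U → Set.EqOn (br (f + f') h) (br f h + br f' h) U
  smul_left : ∀ (c : 𝕜) f h, ContMDiffOn J 𝓘(𝕜, 𝕜) ∞ f U → ContMDiffOn J 𝓘(𝕜, 𝕜) ∞ h U →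
    Set.EqOn (br (c • f) h) (c • br f h) U
  skew : ∀ f h, ContMDiffOn J 𝓘(𝕜, 𝕜) ∞ f U → ContMDiffOn J 𝓘(𝕜, 𝕜) ∞ h U →
    Set.EqOn (br f h) (-br h f) U
  leibniz : ∀ f f' h, ContMDiffOn J 𝓘(𝕜, 𝕜) ∞ f U → ContMDiffOn J 𝓘(𝕜, 𝕜) ∞ f' U →
    ContMDiffOn J 𝓘(𝕜, 𝕜) ∞ h U → Set.EqOn (br (f * f') h) (f * br f' h + f' * br f h) U
  jacobi : ∀ f h k, ContMDiffOn J 𝓘(𝕜, 𝕜) ∞ f U → ContMDiffOn J 𝓘(𝕜, 𝕜) ∞ h U →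
    ContMDiffOn J 𝓘(𝕜, 𝕜) ∞ k U →
    ∀ p ∈ U, br (br f h) k p + br (br h k) f p + br (br k f) h p = 0

end PLCDYBE

end

noncomputable section

namespace PLCDYBE

/-! ### Second derivatives in charts -/

section Charts

open Set Filter Topology VectorField

variable {𝕜 : Type*} [RCLike 𝕜] {E : Type*} [NormedAddCommGroup E] [NormedSpace 𝕜 E]
  {M : Type*} [TopologicalSpace M] [ChartedSpace E M]

/-! The bracket is a difference of two halves with the same algebraic form. The left half is built
from the derivations `l`, `ρ` (left and right multiplication of `Ω^L`), from `m` (left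
multiplication of `g`) and from the functions `R(Ω^L)`. The right half uses the same data for `Ω^R`,
with `m` replaced by minus the right multiplications of `g`; the sign turns their commutation
relations into those of left multiplications. The derivations of one half commute with those of the
other and kill its coefficients, so the Schouten square, which is twice the Jacobiator, is the sum
of the squares of the halves (`schouten_bracketMap`).

Within one half put `u = l - ρ + m`, the generator of conjugation of `Ω` together with left
multiplication of `g`. The half is `(1/2)(r(u, u) + K + R(m, m))`, where `K` collects the Casimir
terms. The bivectors `K` and `R(m, m)` are `u`-invariant, so their cross terms with `r` vanish. The
modified Yang-Baxter equation makes the square of the `r` term a multiple of the Cartan trivector of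
`u`. The square of `K` is the opposite multiple plus a Cartan trivector of `m`, by
`schouten_casimir_casimir`; this needs that the Casimir and structure tensors are Ad-invariant,
hence the same in left and right derivations. The cross term of `K` and `R` contributes the
derivative `D⁺R`, all other contributions cancelling by equivariance (`schouten_casimir_tensor`).
What remains, `schouten_halfBracket`, is the left-hand side of the dynamical equation plus a
constant multiple of the structure tensor, all in the directions `m`.

At a point, a right multiplication of `g` is a left multiplication by an element conjugated by `g`.
Since trivectors are odd under `m ↦ -m`, the two halves combine to the left-hand side at `Ω^L` minus
its image under `Ad g` at `Ω^R`, the structure tensors cancelling (`evalAt_jacobiator`).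
Differentials of functions of `g` are arbitrary and the left-hand side is totally antisymmetric, so
the Jacobi identity says exactly that these two tensors agree for all `(Ω^L, g, Ω^R)`. Equal
arguments give invariance, `g = 1` gives constancy, and the converse is clear.

The analytic part supplies the commutators of derivations generated by group actions, the derivative
of `Ad`, and the invariance of the scalar product under a connected group. The real case uses bump
functions to extend functions from a chart; the complex case restricts to an open subset instead. -/

/-- The derivative of a vector-valued function along a tangent vector. -/
def dirDeriv {F : Type*} [NormedAddCommGroup F] [NormedSpace 𝕜 F] (f : M → F) (x : M)
    (v : TangentSpace 𝓘(𝕜, E) x) : F :=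
  mfderiv 𝓘(𝕜, E) 𝓘(𝕜, F) f x v

variable {F : Type*} [NormedAddCommGroup F] [NormedSpace 𝕜 F]

theorem two_le_infty : (2 : WithTop ℕ∞) ≤ ∞ := 
  WithTop.coe_le_coe.2 le_top

theorem dirDeriv_congr {f g : M → F} {x : M} (h : f =ᶠ[𝓝 x] g) (v : TangentSpace 𝓘(𝕜, E) x) :
    dirDeriv f x v = dirDeriv g x v := by
  simp only [dirDeriv]
  rw [h.mfderiv_eq]
  rfl

theorem dirDeriv_comp_extChartAt [IsManifold 𝓘(𝕜, E) 1 M]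
    {g : E → F} {x₀ x : M} (hx : x ∈ (extChartAt 𝓘(𝕜, E) x₀).source)
    (hg : DifferentiableAt 𝕜 g (extChartAt 𝓘(𝕜, E) x₀ x)) (v : TangentSpace 𝓘(𝕜, E) x) :
    dirDeriv (fun y => g (extChartAt 𝓘(𝕜, E) x₀ y)) x v =
      fderiv 𝕜 g (extChartAt 𝓘(𝕜, E) x₀ x) (dirDeriv (extChartAt 𝓘(𝕜, E) x₀) x v) := by
  have h1 : MDifferentiableAt 𝓘(𝕜, E) 𝓘(𝕜, E) (extChartAt 𝓘(𝕜, E) x₀) x :=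
    mdifferentiableAt_extChartAt (by simpa using hx)
  have := mfderiv_comp_apply (I := 𝓘(𝕜, E)) (I' := 𝓘(𝕜, E)) (I'' := 𝓘(𝕜, F)) x
    hg.mdifferentiableAt h1 v
  rw [mfderiv_eq_fderiv] at this
  exact this

theorem extChartAt_symm_comp_eventuallyEq {α : Type*} (F : M → α) (x₀ : M) :
    F =ᶠ[𝓝 x₀] fun y => (F ∘ (extChartAt 𝓘(𝕜, E) x₀).symm) (extChartAt 𝓘(𝕜, E) x₀ y) := by
  filter_upwards [extChartAt_source_mem_nhds (I := 𝓘(𝕜, E)) x₀] with y hy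
  simp only [Function.comp]
  rw [(extChartAt 𝓘(𝕜, E) x₀).left_inv hy]

theorem fderiv_extChartAt_comp_symm (x₀ : M) :
    fderiv 𝕜 ((extChartAt 𝓘(𝕜, E) x₀) ∘ (extChartAt 𝓘(𝕜, E) x₀).symm)
      (extChartAt 𝓘(𝕜, E) x₀ x₀) = ContinuousLinearMap.id 𝕜 E := by
  rw [← fderiv_id (x := extChartAt 𝓘(𝕜, E) x₀ x₀)]
  apply Filter.EventuallyEq.fderiv_eq
  filter_upwards [extChartAt_target_mem_nhds (I := 𝓘(𝕜, E)) x₀] with y hy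
  simp only [Function.comp, (extChartAt 𝓘(𝕜, E) x₀).right_inv hy, id]

/-- The tangent space at `x₀` is identified with `E` by the chart at `x₀` itself, so no coordinate
change appears. -/
theorem dirDeriv_eq_fderiv_writtenInExtChartAt {f : M → F} {x₀ : M}
    (h : MDifferentiableAt 𝓘(𝕜, E) 𝓘(𝕜, F) f x₀) (v : TangentSpace 𝓘(𝕜, E) x₀) :
    dirDeriv f x₀ v =
      fderiv 𝕜 (f ∘ (extChartAt 𝓘(𝕜, E) x₀).symm) (extChartAt 𝓘(𝕜, E) x₀ x₀) v := by
  have h1 : mfderiv 𝓘(𝕜, E) 𝓘(𝕜, F) f x₀ =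
      fderivWithin 𝕜 (writtenInExtChartAt 𝓘(𝕜, E) 𝓘(𝕜, F) x₀ f) (range 𝓘(𝕜, E))
        (extChartAt 𝓘(𝕜, E) x₀ x₀) := by
    simp only [mfderiv]
    exact if_pos h
  have h2 : range 𝓘(𝕜, E) = univ := by simp
  rw [h2, fderivWithin_univ] at h1
  exact congrArg (fun L : E →L[𝕜] F => L v) h1

theorem dirDeriv_extChartAt_self [IsManifold 𝓘(𝕜, E) 1 M] (x₀ : M)
    (v : TangentSpace 𝓘(𝕜, E) x₀) :
    dirDeriv (extChartAt 𝓘(𝕜, E) x₀) x₀ v = v := by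
  have h1 : MDifferentiableAt 𝓘(𝕜, E) 𝓘(𝕜, E) (extChartAt 𝓘(𝕜, E) x₀) x₀ :=
    mdifferentiableAt_extChartAt (by simp)
  rw [dirDeriv_eq_fderiv_writtenInExtChartAt h1, fderiv_extChartAt_comp_symm]
  rfl

theorem contDiffAt_comp_extChartAt_symm [IsManifold 𝓘(𝕜, E) ∞ M]
    {f : M → F} {x₀ : M}
    (hf : ContMDiffAt 𝓘(𝕜, E) 𝓘(𝕜, F) ∞ f x₀) :
    ContDiffAt 𝕜 ∞ (f ∘ (extChartAt 𝓘(𝕜, E) x₀).symm) (extChartAt 𝓘(𝕜, E) x₀ x₀) := by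
  rw [← contMDiffAt_iff_contDiffAt]
  apply ContMDiffAt.comp (I' := 𝓘(𝕜, E))
  · rwa [(extChartAt 𝓘(𝕜, E) x₀).left_inv (mem_extChartAt_source x₀)]
  · exact (contMDiffOn_extChartAt_symm x₀).contMDiffAt (extChartAt_target_mem_nhds x₀)

/-- The derivative of a function along the Lie bracket of vector fields is the commutator of the
derivatives. -/
theorem dirDeriv_mlieBracket [CompleteSpace E] [IsManifold 𝓘(𝕜, E) ∞ M] {f : M → 𝕜} {x₀ : M}
    (hf : ContMDiffAt 𝓘(𝕜, E) 𝓘(𝕜, 𝕜) ∞ f x₀) (V W : Π x : M, TangentSpace 𝓘(𝕜, E) x)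
    (hV : MDifferentiableAt 𝓘(𝕜, E) 𝓘(𝕜, E).tangent
      (fun x ↦ (V x : TangentBundle 𝓘(𝕜, E) M)) x₀)
    (hW : MDifferentiableAt 𝓘(𝕜, E) 𝓘(𝕜, E).tangent
      (fun x ↦ (W x : TangentBundle 𝓘(𝕜, E) M)) x₀) :
    dirDeriv (fun x => dirDeriv f x (W x)) x₀ (V x₀)
      - dirDeriv (fun x => dirDeriv f x (V x)) x₀ (W x₀)
      = dirDeriv f x₀ (mlieBracket 𝓘(𝕜, E) V W x₀) := by
  have : IsManifold 𝓘(𝕜, E) 1 M := IsManifold.of_le (n := ∞) (by exact_mod_cast le_top)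
  have : IsManifold 𝓘(𝕜, E) 2 M := IsManifold.of_le (n := ∞) two_le_infty
  set φ := extChartAt 𝓘(𝕜, E) x₀ with hφ
  set fh : E → 𝕜 := f ∘ φ.symm with hfh
  have hfs : ContDiffAt 𝕜 ∞ fh (φ x₀) := contDiffAt_comp_extChartAt_symm hf
  -- In the chart a field `V` becomes the field `hat V` on `E`, and derivatives of `f` become
  -- Fréchet derivatives of `fh`.
  let hat (V : Π x : M, TangentSpace 𝓘(𝕜, E) x) : E → E :=
    mpullbackWithin 𝓘(𝕜, E) 𝓘(𝕜, E) φ.symm V (range 𝓘(𝕜, E))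
  have hat_eq (V : Π x : M, TangentSpace 𝓘(𝕜, E) x) {x : M} (hx : x ∈ φ.source) :
      hat V (φ x) = dirDeriv φ x (V x) := by
    have h1 := isInvertible_mfderivWithin_extChartAt_symm (I := 𝓘(𝕜, E)) (φ.map_source hx)
    have h2 : ∀ v : TangentSpace 𝓘(𝕜, E) (φ.symm (φ x)),
      mfderivWithin 𝓘(𝕜, E) 𝓘(𝕜, E) φ.symm (range 𝓘(𝕜, E)) (φ x)
       (mfderiv 𝓘(𝕜, E) 𝓘(𝕜, E) φ (φ.symm (φ x)) v) = v := fun v =>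
      congrArg (fun L : E →L[𝕜] E => L v)
      (mfderivWithin_extChartAt_symm_comp_mfderiv_extChartAt (I := 𝓘(𝕜, E)) (φ.map_source hx))
    have h3 : hat V (φ x) = dirDeriv φ (φ.symm (φ x)) (V (φ.symm (φ x))) := by
      simp only [hat, mpullbackWithin_apply]
      exact h1.inverse_apply_eq.2 (h2 _).symm
    rw [h3, φ.left_inv hx]
  have hat_diff (V : Π x : M, TangentSpace 𝓘(𝕜, E) x)
      (hV : MDifferentiableAt 𝓘(𝕜, E) 𝓘(𝕜, E).tangent
        (fun x ↦ (V x : TangentBundle 𝓘(𝕜, E) M)) x₀) :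
      DifferentiableAt 𝕜 (hat V) (φ x₀) := by
    have : DifferentiableWithinAt 𝕜 (hat V)
      ((extChartAt 𝓘(𝕜, E) x₀).symm ⁻¹' univ ∩ range 𝓘(𝕜, E)) (φ x₀) :=
      MDifferentiableWithinAt.differentiableWithinAt_mpullbackWithin_vectorField
      (I := 𝓘(𝕜, E)) (s := univ) hV.mdifferentiableWithinAt
    have h2 : (extChartAt 𝓘(𝕜, E) x₀).symm ⁻¹' univ ∩ range 𝓘(𝕜, E) = univ := by simp
    rwa [h2, differentiableWithinAt_univ] at this
  have key (W : Π x : M, TangentSpace 𝓘(𝕜, E) x) :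
      (fun x => dirDeriv f x (W x)) =ᶠ[𝓝 x₀] fun x => fderiv 𝕜 fh (φ x) (hat W (φ x)) := by
    have e1 : ∀ᶠ x in 𝓝 x₀, ContDiffAt 𝕜 2 fh (φ x) :=
      (continuousAt_extChartAt x₀).eventually ((hfs.of_le two_le_infty).eventually (by simp))
    have e2 := (extChartAt_symm_comp_eventuallyEq (𝕜 := 𝕜) (E := E) f x₀).eventually_nhds
    filter_upwards [extChartAt_source_mem_nhds (I := 𝓘(𝕜, E)) x₀, e1, e2] with x hx hd he
    rw [hat_eq W hx, ← dirDeriv_comp_extChartAt hx (hd.differentiableAt two_ne_zero)]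
    exact dirDeriv_congr he _
  have key2 (V W : Π x : M, TangentSpace 𝓘(𝕜, E) x)
      (hW : MDifferentiableAt 𝓘(𝕜, E) 𝓘(𝕜, E).tangent
        (fun x ↦ (W x : TangentBundle 𝓘(𝕜, E) M)) x₀) :
      dirDeriv (fun x => dirDeriv f x (W x)) x₀ (V x₀)
      = fderiv 𝕜 (fderiv 𝕜 fh) (φ x₀) (hat V (φ x₀)) (hat W (φ x₀)) +
        fderiv 𝕜 fh (φ x₀) (fderiv 𝕜 (hat W) (φ x₀) (hat V (φ x₀))) := by
    have hd : DifferentiableAt 𝕜 (fderiv 𝕜 fh) (φ x₀) :=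
      (hfs.fderiv_right (m := 1) two_le_infty).differentiableAt one_ne_zero
    rw [dirDeriv_congr (key W), hat_eq V (mem_extChartAt_source x₀),
      dirDeriv_comp_extChartAt (x₀ := x₀) (g := fun y => fderiv 𝕜 fh y (hat W y))
      (mem_extChartAt_source x₀) (hd.clm_apply (hat_diff W hW)) (V x₀),
      fderiv_clm_apply hd (hat_diff W hW)]
    exact add_comm _ _
  rw [key2 V W hW, key2 W V hV]
  -- The second-order terms cancel by symmetry; what is left is the derivative of `fh` along the
  -- coordinate bracket.
  have hsymm : fderiv 𝕜 (fderiv 𝕜 fh) (φ x₀) (hat V (φ x₀)) (hat W (φ x₀)) =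
      fderiv 𝕜 (fderiv 𝕜 fh) (φ x₀) (hat W (φ x₀)) (hat V (φ x₀)) := by
    have : IsSymmSndFDerivAt 𝕜 fh (φ x₀) := hfs.isSymmSndFDerivAt (by
      rw [minSmoothness_of_isRCLikeNormedField]; exact two_le_infty)
    exact this _ _
  rw [hsymm, dirDeriv_congr (extChartAt_symm_comp_eventuallyEq (𝕜 := 𝕜) (E := E) f x₀),
    dirDeriv_comp_extChartAt (mem_extChartAt_source x₀) (hfs.differentiableAt (by simp))]
  have hb : dirDeriv φ x₀ (mlieBracket 𝓘(𝕜, E) V W x₀) =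
      lieBracket 𝕜 (hat V) (hat W) (φ x₀) := by
    have h1 := isInvertible_mfderiv_extChartAt (I := 𝓘(𝕜, E))
      (mem_extChartAt_source (I := 𝓘(𝕜, E)) x₀)
    have h2 : (extChartAt 𝓘(𝕜, E) x₀).symm ⁻¹' univ ∩ range 𝓘(𝕜, E) = univ := by simp
    have h3 : lieBracket 𝕜 (hat V) (hat W) (φ x₀) = lieBracketWithin 𝕜 (hat V) (hat W)
        ((extChartAt 𝓘(𝕜, E) x₀).symm ⁻¹' univ ∩ range 𝓘(𝕜, E)) (φ x₀) := by
      rw [h2, lieBracketWithin_univ]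
    rw [h3, mlieBracket, mlieBracketWithin_apply]
    exact (h1.inverse_apply_eq.1 rfl).symm
  rw [hb]
  simp only [lieBracket, map_sub]
  ring

/-- Mixed derivatives commute. -/
theorem dirDeriv_comm {E' : Type*} [NormedAddCommGroup E'] [NormedSpace 𝕜 E']
    {N : Type*} [TopologicalSpace N] [ChartedSpace E' N]
    [IsManifold 𝓘(𝕜, E) ∞ M] [IsManifold 𝓘(𝕜, E') ∞ N] {θ : M → N → 𝕜} {x : M} {y : N}
    (h : ContMDiffAt (𝓘(𝕜, E).prod 𝓘(𝕜, E')) 𝓘(𝕜, 𝕜) ∞ (Function.uncurry θ) (x, y))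
    (v : TangentSpace 𝓘(𝕜, E) x) (w : TangentSpace 𝓘(𝕜, E') y) :
    dirDeriv (fun k => dirDeriv (fun l => θ k l) y w) x v =
      dirDeriv (fun l => dirDeriv (fun k => θ k l) x v) y w := by
  have : IsManifold 𝓘(𝕜, E) 1 M := IsManifold.of_le (n := ∞) (by exact_mod_cast le_top)
  have : IsManifold 𝓘(𝕜, E') 1 N := IsManifold.of_le (n := ∞) (by exact_mod_cast le_top)
  set φ := extChartAt 𝓘(𝕜, E) x with hφ
  set ψ := extChartAt 𝓘(𝕜, E') y with hψ
  set θh : E × E' → 𝕜 := fun z => θ (φ.symm z.1) (ψ.symm z.2) with hθh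
  have hs : ContDiffAt 𝕜 ∞ θh (φ x, ψ y) := by
    rw [← contMDiffAt_iff_contDiffAt]
    have h1 : ContMDiffAt 𝓘(𝕜, E × E') (𝓘(𝕜, E).prod 𝓘(𝕜, E')) ∞
        (fun z : E × E' => (φ.symm z.1, ψ.symm z.2)) (φ x, ψ y) := by
      apply ContMDiffAt.prodMk
      · exact ContMDiffAt.comp (I' := 𝓘(𝕜, E)) (g := φ.symm) (f := Prod.fst) (φ x, ψ y)
          ((contMDiffOn_extChartAt_symm x).contMDiffAt
            (extChartAt_target_mem_nhds (I := 𝓘(𝕜, E)) x))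
          (contMDiffAt_iff_contDiffAt.2 contDiffAt_fst)
      · exact ContMDiffAt.comp (I' := 𝓘(𝕜, E')) (g := ψ.symm) (f := Prod.snd) (φ x, ψ y)
          ((contMDiffOn_extChartAt_symm y).contMDiffAt
            (extChartAt_target_mem_nhds (I := 𝓘(𝕜, E')) y))
          (contMDiffAt_iff_contDiffAt.2 contDiffAt_snd)
    have h2 : (φ.symm (φ x), ψ.symm (ψ y)) = (x, y) := by
      rw [φ.left_inv (mem_extChartAt_source x), ψ.left_inv (mem_extChartAt_source y)]
    exact ContMDiffAt.comp (I' := 𝓘(𝕜, E).prod 𝓘(𝕜, E')) (g := Function.uncurry θ) _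
      (by simpa only [h2] using h) h1
  -- Inner derivatives are taken at neighbouring points, so regularity is needed near `(x, y)`.
  -- Order `∞` at a point does not pass to a neighbourhood, but order 2 does, and it suffices.
  have he : ∀ᶠ p in 𝓝 (x, y), ContMDiffAt (𝓘(𝕜, E).prod 𝓘(𝕜, E')) 𝓘(𝕜, 𝕜) 2
      (Function.uncurry θ) p := by
    have : IsManifold 𝓘(𝕜, E) 2 M := IsManifold.of_le (n := ∞) two_le_infty
    have : IsManifold 𝓘(𝕜, E') 2 N := IsManifold.of_le (n := ∞) two_le_infty
    exact (contMDiffAt_iff_contMDiffAt_nhds (by simp)).1 (h.of_le two_le_infty)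
  have hse : ∀ᶠ z in 𝓝 (φ x, ψ y), ContDiffAt 𝕜 2 θh z :=
    (hs.of_le two_le_infty).eventually (by simp)
  have hd : DifferentiableAt 𝕜 (fderiv 𝕜 θh) (φ x, ψ y) :=
    (hs.fderiv_right (m := 1) two_le_infty).differentiableAt one_ne_zero
  -- Both iterated derivatives are values of the second derivative of `θh` at `(v, 0)` and `(0, w)`,
  -- in opposite orders.
  have hleft : dirDeriv (fun k => dirDeriv (fun l => θ k l) y w) x v =
      fderiv 𝕜 (fderiv 𝕜 θh) (φ x, ψ y) (ContinuousLinearMap.inl 𝕜 E E' v) (ContinuousLinearMap.inr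
        𝕜 E E' w) := by
    have e : (fun k => dirDeriv (fun l => θ k l) y w) =ᶠ[𝓝 x]
        fun k => fderiv 𝕜 θh (φ k, ψ y) (ContinuousLinearMap.inr 𝕜 E E' w) := by
      have c1 : ContinuousAt (fun k : M => (k, y)) x := by fun_prop
      have c2 : ContinuousAt (fun k : M => (φ k, ψ y)) x :=
        (continuousAt_extChartAt x).prodMk continuousAt_const
      filter_upwards [c1.eventually he, c2.eventually hse,
        extChartAt_source_mem_nhds (I := 𝓘(𝕜, E)) x] with k h1 h2 hk
      have h3 : MDifferentiableAt 𝓘(𝕜, E') 𝓘(𝕜, 𝕜) (fun l => θ k l) y :=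
        (ContMDiffAt.comp (I' := 𝓘(𝕜, E).prod 𝓘(𝕜, E')) (g := Function.uncurry θ) y h1
          (contMDiffAt_const.prodMk contMDiffAt_id)).mdifferentiableAt two_ne_zero
      rw [dirDeriv_eq_fderiv_writtenInExtChartAt h3]
      have h4 : (fun l => θ k l) ∘ ψ.symm = θh ∘ fun b => (φ k, b) := by
        ext b
        simp only [Function.comp, hθh, φ.left_inv hk]
      rw [h4, fderiv_comp _ (h2.differentiableAt two_ne_zero)
        ((differentiableAt_const _).prodMk differentiableAt_id)]
      have h5 : HasFDerivAt (fun b : E' => (φ k, b)) (ContinuousLinearMap.inr 𝕜 E E') (ψ y) :=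
        (hasFDerivAt_const _ _).prodMk (hasFDerivAt_id _)
      rw [h5.fderiv]
      rfl
    rw [dirDeriv_congr e]
    have h5 : HasFDerivAt (fun a : E => (a, ψ y)) (ContinuousLinearMap.inl 𝕜 E E') (φ x) :=
      (hasFDerivAt_id _).prodMk (hasFDerivAt_const _ _)
    have h6 : HasFDerivAt (fun a : E => fderiv 𝕜 θh (a, ψ y) (ContinuousLinearMap.inr 𝕜 E E' w))
        ((ContinuousLinearMap.apply 𝕜 𝕜 (ContinuousLinearMap.inr 𝕜 E E' w)).comp
          ((fderiv 𝕜 (fderiv 𝕜 θh) (φ x, ψ y)).comp (ContinuousLinearMap.inl 𝕜 E E'))) (φ x) :=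
      (ContinuousLinearMap.apply 𝕜 𝕜 (ContinuousLinearMap.inr 𝕜 E E' w)).hasFDerivAt.comp _
        (HasFDerivAt.comp (g := fderiv 𝕜 θh) (f := fun a : E => (a, ψ y)) (φ x) hd.hasFDerivAt h5)
    have h7 := dirDeriv_comp_extChartAt (g := fun a => fderiv 𝕜 θh (a, ψ y)
      (ContinuousLinearMap.inr 𝕜 E E' w))
      (mem_extChartAt_source x) h6.differentiableAt v
    rw [h7, h6.fderiv, dirDeriv_extChartAt_self]
    rfl
  have hright : dirDeriv (fun l => dirDeriv (fun k => θ k l) x v) y w =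
      fderiv 𝕜 (fderiv 𝕜 θh) (φ x, ψ y) (ContinuousLinearMap.inr 𝕜 E E' w) (ContinuousLinearMap.inl
        𝕜 E E' v) := by
    have e : (fun l => dirDeriv (fun k => θ k l) x v) =ᶠ[𝓝 y]
        fun l => fderiv 𝕜 θh (φ x, ψ l) (ContinuousLinearMap.inl 𝕜 E E' v) := by
      have c1 : ContinuousAt (fun l : N => (x, l)) y := by fun_prop
      have c2 : ContinuousAt (fun l : N => (φ x, ψ l)) y :=
        continuousAt_const.prodMk (continuousAt_extChartAt y)
      filter_upwards [c1.eventually he, c2.eventually hse,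
        extChartAt_source_mem_nhds (I := 𝓘(𝕜, E')) y] with l h1 h2 hl
      have h3 : MDifferentiableAt 𝓘(𝕜, E) 𝓘(𝕜, 𝕜) (fun k => θ k l) x :=
        (ContMDiffAt.comp (I' := 𝓘(𝕜, E).prod 𝓘(𝕜, E')) (g := Function.uncurry θ) x h1
          (contMDiffAt_id.prodMk contMDiffAt_const)).mdifferentiableAt two_ne_zero
      rw [dirDeriv_eq_fderiv_writtenInExtChartAt h3]
      have h4 : (fun k => θ k l) ∘ φ.symm = θh ∘ fun a => (a, ψ l) := by
        ext b
        simp only [Function.comp, hθh, ψ.left_inv hl]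
      have h5 : HasFDerivAt (fun a : E => (a, ψ l)) (ContinuousLinearMap.inl 𝕜 E E') (φ x) :=
        (hasFDerivAt_id _).prodMk (hasFDerivAt_const _ _)
      rw [h4, fderiv_comp (φ x) (h2.differentiableAt two_ne_zero) h5.differentiableAt, h5.fderiv]
      rfl
    rw [dirDeriv_congr e]
    have h5 : HasFDerivAt (fun b : E' => (φ x, b)) (ContinuousLinearMap.inr 𝕜 E E') (ψ y) :=
      (hasFDerivAt_const _ _).prodMk (hasFDerivAt_id _)
    have h6 : HasFDerivAt (fun b : E' => fderiv 𝕜 θh (φ x, b) (ContinuousLinearMap.inl 𝕜 E E' v))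
        ((ContinuousLinearMap.apply 𝕜 𝕜 (ContinuousLinearMap.inl 𝕜 E E' v)).comp
          ((fderiv 𝕜 (fderiv 𝕜 θh) (φ x, ψ y)).comp (ContinuousLinearMap.inr 𝕜 E E'))) (ψ y) :=
      (ContinuousLinearMap.apply 𝕜 𝕜 (ContinuousLinearMap.inl 𝕜 E E' v)).hasFDerivAt.comp _
        (hd.hasFDerivAt.comp _ h5)
    have h7 := dirDeriv_comp_extChartAt (g := fun b => fderiv 𝕜 θh (φ x, b)
      (ContinuousLinearMap.inl 𝕜 E E' v))
      (mem_extChartAt_source y) h6.differentiableAt w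
    rw [h7, h6.fderiv, dirDeriv_extChartAt_self]
    rfl
  have hsymm : IsSymmSndFDerivAt 𝕜 θh (φ x, ψ y) := hs.isSymmSndFDerivAt (by
      rw [minSmoothness_of_isRCLikeNormedField]; exact two_le_infty)
  rw [hleft, hright]
  exact hsymm _ _

/-- Derivatives depend smoothly on parameters. -/
theorem contMDiffAt_dirDeriv {V : Type*} [NormedAddCommGroup V] [NormedSpace 𝕜 V] {H : Type*}
    [TopologicalSpace H] {J : ModelWithCorners 𝕜 V H} {N : Type*} [TopologicalSpace N]
    [ChartedSpace H N] [IsManifold J ∞ N] [IsManifold 𝓘(𝕜, E) ∞ M] {θ : N → M → F} {n : N} {x : M}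
    (h : ContMDiffAt (J.prod 𝓘(𝕜, E)) 𝓘(𝕜, F) ∞ (Function.uncurry θ) (n, x))
    (v : TangentSpace 𝓘(𝕜, E) x) :
    ContMDiffAt J 𝓘(𝕜, F) ∞ (fun k => dirDeriv (θ k) x v) n := by
  have : IsManifold 𝓘(𝕜, E) 1 M := IsManifold.of_le (n := ∞) (by exact_mod_cast le_top)
  have : IsManifold J 1 N := IsManifold.of_le (n := ∞) (by exact_mod_cast le_top)
  have h1 := ContMDiffAt.mfderiv_apply (m := ∞) (n := ∞) (J := J) (I := 𝓘(𝕜, E)) θ (fun _ => x)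
    id (fun _ => (v : E)) h contMDiffAt_const contMDiffAt_id contMDiffAt_const le_rfl
  refine h1.congr_of_eventuallyEq (Eventually.of_forall fun k => ?_)
  -- `h1` is stated in tangent bundle coordinates. The base point is fixed and the target is a
  -- vector space, so both coordinate changes are the identity (`h3`, `h4`).
  have h2 := inTangentCoordinates_eq (I := 𝓘(𝕜, E)) (I' := 𝓘(𝕜, F)) (fun _ : N => x)
    (fun k : N => θ k x) (fun k => mfderiv 𝓘(𝕜, E) 𝓘(𝕜, F) (θ k) x) (x₀ := n) (x := k)
    (mem_chart_source E x) (mem_chart_source F (θ k x))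
  have h3 : ((tangentBundleCore 𝓘(𝕜, E) M).coordChange (achart E x) (achart E x) x v : E) = v :=
    (tangentBundleCore 𝓘(𝕜, E) M).coordChange_self (achart E x) x (mem_chart_source E x) v
  have h4 (z : F) : (tangentBundleCore 𝓘(𝕜, F) F).coordChange (achart F (θ k x))
      (achart F (θ n x)) (θ k x) z = z :=
    (tangentBundleCore 𝓘(𝕜, F) F).coordChange_self (achart F (θ k x)) (θ k x)
      (mem_chart_source F (θ k x)) z
  have h5 := congrArg (fun L : E →L[𝕜] F => L v) h2
  refine Eq.symm (h5.trans ?_)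
  refine (h4 _).trans ?_
  exact congrArg (fun w : E => (mfderiv 𝓘(𝕜, E) 𝓘(𝕜, F) (θ k) x : E →L[𝕜] F) w) h3

theorem dirDeriv_congr_point (f : M → F) {x y : M} (h : x = y) (v : E) :
    dirDeriv (𝕜 := 𝕜) (E := E) f x v = dirDeriv (𝕜 := 𝕜) (E := E) f y v := by
  subst h
  rfl

theorem dirDeriv_comp {E' : Type*} [NormedAddCommGroup E'] [NormedSpace 𝕜 E']
    {N : Type*} [TopologicalSpace N] [ChartedSpace E' N] {f : N → F} {g : M → N} {x : M}
    (hf : MDifferentiableAt 𝓘(𝕜, E') 𝓘(𝕜, F) f (g x))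
    (hg : MDifferentiableAt 𝓘(𝕜, E) 𝓘(𝕜, E') g x) (v : TangentSpace 𝓘(𝕜, E) x) :
    dirDeriv (fun y => f (g y)) x v = dirDeriv f (g x) (mfderiv 𝓘(𝕜, E) 𝓘(𝕜, E') g x v) :=
  mfderiv_comp_apply (I := 𝓘(𝕜, E)) (I' := 𝓘(𝕜, E')) (I'' := 𝓘(𝕜, F)) x hf hg v

/-- Chain rule along the diagonal. It differentiates expressions such as `h * x * h⁻¹`, in which the
variable occurs twice. -/
theorem dirDeriv_diag {θ : M → M → F} {x : M}
    (h : MDifferentiableAt (𝓘(𝕜, E).prod 𝓘(𝕜, E)) 𝓘(𝕜, F) (Function.uncurry θ) (x, x))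
    (v : TangentSpace 𝓘(𝕜, E) x) :
    dirDeriv (fun y => θ y y) x v =
      dirDeriv (fun y => θ y x) x v + dirDeriv (fun y => θ x y) x v := by
  -- Read as a vector of `E`, the tangent vector can be used for `M` and for `M × M` alike.
  revert v
  intro (v : E)
  have h1 : MDifferentiableAt 𝓘(𝕜, E) (𝓘(𝕜, E).prod 𝓘(𝕜, E)) (fun y : M => (y, y)) x :=
    mdifferentiableAt_id.prodMk mdifferentiableAt_id
  have h2 := mfderiv_comp_apply (I := 𝓘(𝕜, E)) (I' := 𝓘(𝕜, E).prod 𝓘(𝕜, E))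
    (I'' := 𝓘(𝕜, F)) (f := fun y : M => (y, y)) x h h1 v
  have h3 : mfderiv 𝓘(𝕜, E) (𝓘(𝕜, E).prod 𝓘(𝕜, E)) (fun y : M => (y, y)) x v = (v, v) := by
    have h4 := MDifferentiableAt.mfderiv_prod (I := 𝓘(𝕜, E)) (I' := 𝓘(𝕜, E)) (I'' := 𝓘(𝕜, E))
      (mdifferentiableAt_id (x := x)) (mdifferentiableAt_id (x := x))
    have h5 : mfderiv 𝓘(𝕜, E) 𝓘(𝕜, E) (id : M → M) x = ContinuousLinearMap.id _ _ := mfderiv_id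
    rw [h5] at h4
    exact congrArg (fun L : E →L[𝕜] E × E => L v) h4
  have h6 := mfderiv_prod_eq_add_apply (I := 𝓘(𝕜, E)) (I' := 𝓘(𝕜, E)) (I'' := 𝓘(𝕜, F))
    (p := (x, x)) (v := ((v, v) : E × E)) h
  exact h2.trans ((congrArg (fun w : E × E =>
    (mfderiv (𝓘(𝕜, E).prod 𝓘(𝕜, E)) 𝓘(𝕜, F) (Function.uncurry θ) (x, x) : E × E →L[𝕜] F) w)
    h3).trans h6)

end Charts

/-! ### The adjoint action -/

section Adjoint

open Set Filter Topology VectorField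

variable {𝕜 : Type*} [RCLike 𝕜] {E : Type*} [NormedAddCommGroup E] [NormedSpace 𝕜 E]
  {G : Type*} [TopologicalSpace G] [ChartedSpace E G] [Group G]

theorem mulInvariantVectorField_one (X : GroupLieAlgebra 𝓘(𝕜, E) G) :
    mulInvariantVectorField X (1 : G) = X := by
  have h1 : (fun h : G => 1 * h) = id := by ext; simp
  have h2 : mfderiv 𝓘(𝕜, E) 𝓘(𝕜, E) (id : G → G) 1 = ContinuousLinearMap.id _ _ := mfderiv_id
  have h3 : (mfderiv 𝓘(𝕜, E) 𝓘(𝕜, E) (fun h : G => 1 * h) 1 : E →L[𝕜] E) =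
      ContinuousLinearMap.id 𝕜 E := by
    rw [h1]; exact h2
  exact congrArg (fun L : E →L[𝕜] E => L X) h3

variable [LieGroup 𝓘(𝕜, E) ∞ G]

theorem contMDiff_conj (q : G) : ContMDiff 𝓘(𝕜, E) 𝓘(𝕜, E) ∞ (fun h : G => q * h * q⁻¹) :=
  (contMDiff_const.mul contMDiff_id).mul contMDiff_const

theorem dirDeriv_conj {F : Type*} [NormedAddCommGroup F] [NormedSpace 𝕜 F] {f : G → F}
    (hf : MDifferentiableAt 𝓘(𝕜, E) 𝓘(𝕜, F) f 1) (q : G) (X : GroupLieAlgebra 𝓘(𝕜, E) G) :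
    dirDeriv (fun h : G => f (q * h * q⁻¹)) 1 X = dirDeriv f 1 (Ad 𝕜 q X) := by
  have h1 : q * 1 * q⁻¹ = 1 := by group
  rw [dirDeriv_comp (g := fun h : G => q * h * q⁻¹) (by simpa only [h1] using hf)
    ((contMDiff_conj q).mdifferentiableAt (by simp))]
  exact dirDeriv_congr_point f h1 _

variable [CompleteSpace E]

/-- The Lie algebra bracket is that of left-invariant fields, and differentiating `h ↦ f (k * h)` at
`1` is differentiating `f` along such a field at `k`. This lemma is the bridge from the abstract
bracket to second derivatives. -/
theorem dirDeriv_mul_sub {f : G → 𝕜} (hf : ContMDiffAt 𝓘(𝕜, E) 𝓘(𝕜, 𝕜) ∞ f 1)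
    (X Y : GroupLieAlgebra 𝓘(𝕜, E) G) :
    dirDeriv (fun k => dirDeriv (fun h => f (k * h)) 1 Y) 1 X -
      dirDeriv (fun k => dirDeriv (fun h => f (k * h)) 1 X) 1 Y = dirDeriv f 1 ⁅X, Y⁆ := by
  have key (Y : GroupLieAlgebra 𝓘(𝕜, E) G) : (fun k => dirDeriv (fun h => f (k * h)) 1 Y)
      =ᶠ[𝓝 1] fun k => dirDeriv f k (mulInvariantVectorField Y k) := by
    have : IsManifold 𝓘(𝕜, E) 2 G := IsManifold.of_le (n := ∞) two_le_infty
    filter_upwards [(contMDiffAt_iff_contMDiffAt_nhds (by simp)).1 (hf.of_le two_le_infty)]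
      with k hk
    rw [dirDeriv_comp (g := fun h : G => k * h)
      (by simpa only [mul_one] using hk.mdifferentiableAt two_ne_zero)
      ((contMDiff_mul_left (n := ∞)).mdifferentiableAt (by simp))]
    exact dirDeriv_congr_point f (mul_one k) _
  have h1 := dirDeriv_mlieBracket hf (mulInvariantVectorField X) (mulInvariantVectorField Y)
    (mdifferentiableAt_mulInvariantVectorField X) (mdifferentiableAt_mulInvariantVectorField Y)
  rw [← GroupLieAlgebra.bracket_def, mulInvariantVectorField_one, mulInvariantVectorField_one]
    at h1
  rw [dirDeriv_congr (key X), dirDeriv_congr (key Y), h1]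

end Adjoint

/-! ### Invariance of the scalar product -/

section Constant

open Set Filter Topology

variable {𝕜 : Type*} [RCLike 𝕜] {E : Type*} [NormedAddCommGroup E] [NormedSpace 𝕜 E]
  {M : Type*} [TopologicalSpace M] [ChartedSpace E M] [IsManifold 𝓘(𝕜, E) ∞ M]

/-- In a chart the coordinate expression has zero derivative on an open set, so its level sets there
are open. -/
theorem isLocallyConstant_of_dirDeriv_eq_zero {f : M → 𝕜}
    (hf : ContMDiff 𝓘(𝕜, E) 𝓘(𝕜, 𝕜) ∞ f)
    (h : ∀ (x : M) (v : TangentSpace 𝓘(𝕜, E) x), dirDeriv f x v = 0) : IsLocallyConstant f := by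
  have : IsManifold 𝓘(𝕜, E) 1 M := IsManifold.of_le (n := ∞) (by exact_mod_cast le_top)
  rw [IsLocallyConstant.iff_eventually_eq]
  intro x
  let : NormedSpace ℝ E := .restrictScalars ℝ 𝕜 E
  set φ := extChartAt 𝓘(𝕜, E) x with hφ
  have hsymm : ContMDiffOn 𝓘(𝕜, E) 𝓘(𝕜, E) ∞ φ.symm φ.target := contMDiffOn_extChartAt_symm x
  have hopen : IsOpen φ.target := isOpen_extChartAt_target x
  have hat (y : E) (hy : y ∈ φ.target) : HasFDerivAt (f ∘ φ.symm) (0 : E →L[𝕜] 𝕜) y := by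
    have h1 : MDifferentiableAt 𝓘(𝕜, E) 𝓘(𝕜, E) φ.symm y :=
      (hsymm.contMDiffAt (hopen.mem_nhds hy)).mdifferentiableAt (by simp)
    have h2 : MDifferentiableAt 𝓘(𝕜, E) 𝓘(𝕜, 𝕜) f (φ.symm y) :=
      hf.mdifferentiableAt (by simp)
    have h3 := (mdifferentiableAt_iff_differentiableAt.1 (h2.comp y h1)).hasFDerivAt
    have h4 : fderiv 𝕜 (f ∘ φ.symm) y = 0 := by
      ext v
      have h5 : dirDeriv (f ∘ φ.symm) y v = 0 := (dirDeriv_comp h2 h1 v).trans (h _ _)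
      have h6 : mfderiv 𝓘(𝕜, E) 𝓘(𝕜, 𝕜) (f ∘ φ.symm) y = fderiv 𝕜 (f ∘ φ.symm) y :=
        mfderiv_eq_fderiv
      exact (congrArg (fun L : E →L[𝕜] 𝕜 => L v) h6).symm.trans h5
    rwa [h4] at h3
  have h6 : IsOpen (φ.target ∩ (f ∘ φ.symm) ⁻¹' {f x}) :=
    hopen.isOpen_inter_preimage_of_fderiv_eq_zero
      (fun y hy => (hat y hy).differentiableAt.differentiableWithinAt)
      (fun y hy => (hat y hy).fderiv) {f x}
  have h7 : φ.target ∩ (f ∘ φ.symm) ⁻¹' {f x} ∈ 𝓝 (φ x) :=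
    h6.mem_nhds ⟨mem_extChartAt_target x, by
      simp only [Function.comp, mem_preimage, φ.left_inv (mem_extChartAt_source x),
        mem_singleton_iff]⟩
  filter_upwards [(continuousAt_extChartAt (I := 𝓘(𝕜, E)) x).preimage_mem_nhds h7,
    extChartAt_source_mem_nhds (I := 𝓘(𝕜, E)) x] with y hy hys
  have h8 : f (φ.symm (φ y)) = f x := hy.2
  rwa [φ.left_inv hys] at h8

end Constant

/-! ### The adjoint representation and its derivative -/

section Adjoint

open Set Filter Topology VectorField

variable {𝕜 : Type*} [RCLike 𝕜] {E : Type*} [NormedAddCommGroup E] [NormedSpace 𝕜 E]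
  {G : Type*} [TopologicalSpace G] [ChartedSpace E G] [Group G] [LieGroup 𝓘(𝕜, E) ∞ G]

/-- The form composed with the chart at `1`, whose differential there is the identity. The domain is
kept explicit: in the complex case it cannot be enlarged by a cutoff. -/
theorem exists_dirDeriv_one_eq [FiniteDimensional 𝕜 E]
    (ℓ : GroupLieAlgebra 𝓘(𝕜, E) G →ₗ[𝕜] 𝕜) :
    ∃ f : G → 𝕜, ContMDiffOn 𝓘(𝕜, E) 𝓘(𝕜, 𝕜) ∞ f (chartAt E (1 : G)).source ∧
      ∀ X : GroupLieAlgebra 𝓘(𝕜, E) G, dirDeriv f 1 X = ℓ X := by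
  have : IsManifold 𝓘(𝕜, E) 1 G := IsManifold.of_le (n := ∞) (by exact_mod_cast le_top)
  let ℓ' : E →L[𝕜] 𝕜 := LinearMap.toContinuousLinearMap (show E →ₗ[𝕜] 𝕜 from ℓ)
  refine ⟨fun y => ℓ' (extChartAt 𝓘(𝕜, E) 1 y), ?_, fun X => ?_⟩
  · exact ℓ'.contMDiff.comp_contMDiffOn (contMDiffOn_extChartAt (x := (1 : G)))
  · rw [dirDeriv_comp_extChartAt (g := ℓ') (mem_extChartAt_source 1) ℓ'.differentiableAt,
      dirDeriv_extChartAt_self, ℓ'.fderiv]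
    rfl

theorem exists_contMDiffAt_dirDeriv_one_eq [FiniteDimensional 𝕜 E]
    (ℓ : GroupLieAlgebra 𝓘(𝕜, E) G →ₗ[𝕜] 𝕜) :
    ∃ f : G → 𝕜, ContMDiffAt 𝓘(𝕜, E) 𝓘(𝕜, 𝕜) ∞ f 1 ∧
      ∀ X : GroupLieAlgebra 𝓘(𝕜, E) G, dirDeriv f 1 X = ℓ X := by
  obtain ⟨f, hf, h⟩ := exists_dirDeriv_one_eq ℓ
  exact ⟨f, hf.contMDiffAt (chart_source_mem_nhds E 1), h⟩

/-- The derivative of `h ↦ F (x h⁻¹)`. -/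
theorem dirDeriv_mul_inv {f : G → 𝕜} {x : G} (hf : ContMDiffAt 𝓘(𝕜, E) 𝓘(𝕜, 𝕜) 2 f x)
    (X : GroupLieAlgebra 𝓘(𝕜, E) G) :
    dirDeriv (fun h : G => f (x * h⁻¹)) 1 X = -dirDeriv (fun h : G => f (x * h)) 1 X := by
  have h1 : ContMDiffAt (𝓘(𝕜, E).prod 𝓘(𝕜, E)) 𝓘(𝕜, E) ∞
      (fun p : G × G => x * p.1 * p.2⁻¹) (1, 1) :=
    (contMDiffAt_const.mul contMDiffAt_fst).mul contMDiffAt_snd.inv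
  have h2 : ContMDiffAt (𝓘(𝕜, E).prod 𝓘(𝕜, E)) 𝓘(𝕜, 𝕜) 2
      (Function.uncurry fun h k : G => f (x * h * k⁻¹)) (1, 1) :=
    ContMDiffAt.comp (I' := 𝓘(𝕜, E)) (g := f) (1, 1)
      (by simpa only [mul_one, inv_one] using hf) (h1.of_le two_le_infty)
  -- On the diagonal `f (x * h * h⁻¹)` is constant, so the two partial derivatives add up to zero.
  have h3 := dirDeriv_diag (h2.mdifferentiableAt (by simp)) X
  simp only [mul_inv_cancel_right, mul_one, inv_one] at h3
  have h4 : dirDeriv (fun _ : G => f x) 1 X = 0 := by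
    simp only [dirDeriv]
    rw [mfderiv_const]
    rfl
  rw [h4] at h3
  linear_combination -h3

/-- The derivative of `h ↦ F (h x h⁻¹)`. -/
theorem dirDeriv_conj_left {f : G → 𝕜} {x : G} (hf : ContMDiffAt 𝓘(𝕜, E) 𝓘(𝕜, 𝕜) 2 f x)
    (X : GroupLieAlgebra 𝓘(𝕜, E) G) :
    dirDeriv (fun h : G => f (h * x * h⁻¹)) 1 X =
      dirDeriv (fun h : G => f (h * x)) 1 X - dirDeriv (fun h : G => f (x * h)) 1 X := by
  have h1 : ContMDiffAt (𝓘(𝕜, E).prod 𝓘(𝕜, E)) 𝓘(𝕜, E) ∞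
      (fun p : G × G => p.1 * x * p.2⁻¹) (1, 1) :=
    (contMDiffAt_fst.mul contMDiffAt_const).mul contMDiffAt_snd.inv
  have h2 : ContMDiffAt (𝓘(𝕜, E).prod 𝓘(𝕜, E)) 𝓘(𝕜, 𝕜) 2
      (Function.uncurry fun h k : G => f (h * x * k⁻¹)) (1, 1) :=
    ContMDiffAt.comp (I' := 𝓘(𝕜, E)) (g := f) (1, 1)
      (by simpa only [one_mul, mul_one, inv_one] using hf) (h1.of_le two_le_infty)
  have h3 := dirDeriv_diag (h2.mdifferentiableAt (by simp)) X
  simp only [one_mul, mul_one, inv_one] at h3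
  rw [h3, dirDeriv_mul_inv hf, sub_eq_add_neg]

theorem contMDiffAt_comp_conj {f : G → 𝕜} (hf : ContMDiffAt 𝓘(𝕜, E) 𝓘(𝕜, 𝕜) ∞ f 1) (q : G) :
    ContMDiffAt 𝓘(𝕜, E) 𝓘(𝕜, 𝕜) ∞ (fun h : G => f (q * h * q⁻¹)) 1 :=
  ContMDiffAt.comp (I' := 𝓘(𝕜, E)) (g := f) 1 (by
    rwa [mul_one, mul_inv_cancel]) (contMDiff_conj q).contMDiffAt

variable [FiniteDimensional 𝕜 E]

/-- Linear forms separate vectors, and every form is a differential. Identities for `Ad` can thus be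
checked on test functions, without differentiating maps into the Lie algebra. -/
theorem eq_of_forall_dirDeriv_one {X Y : GroupLieAlgebra 𝓘(𝕜, E) G}
    (h : ∀ f : G → 𝕜, ContMDiffAt 𝓘(𝕜, E) 𝓘(𝕜, 𝕜) ∞ f 1 → dirDeriv f 1 X = dirDeriv f 1 Y) :
    X = Y := by
  rw [← sub_eq_zero, ← Module.forall_dual_apply_eq_zero_iff 𝕜]
  intro ℓ
  obtain ⟨f, hf, hℓ⟩ := exists_contMDiffAt_dirDeriv_one_eq (𝕜 := 𝕜) (G := G) ℓ
  rw [map_sub, ← hℓ, ← hℓ, h f hf, sub_self]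

theorem Ad_one (X : GroupLieAlgebra 𝓘(𝕜, E) G) : Ad 𝕜 (1 : G) X = X :=
  eq_of_forall_dirDeriv_one fun f hf => by
    rw [← dirDeriv_conj (hf.mdifferentiableAt (by simp))]
    simp only [one_mul, inv_one, mul_one]

theorem Ad_mul (q q' : G) (X : GroupLieAlgebra 𝓘(𝕜, E) G) :
    Ad 𝕜 (q * q') X = Ad 𝕜 q (Ad 𝕜 q' X) :=
  eq_of_forall_dirDeriv_one fun f hf => by
    rw [← dirDeriv_conj (hf.mdifferentiableAt (by simp)),
      ← dirDeriv_conj (hf.mdifferentiableAt (by simp)),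
      ← dirDeriv_conj (f := fun h : G => f (q * h * q⁻¹))
        ((contMDiffAt_comp_conj hf q).mdifferentiableAt (by simp))]
    simp only [mul_inv_rev, mul_assoc]

theorem contMDiff_Ad (ℓ : GroupLieAlgebra 𝓘(𝕜, E) G →ₗ[𝕜] 𝕜) (Y : GroupLieAlgebra 𝓘(𝕜, E) G) :
    ContMDiff 𝓘(𝕜, E) 𝓘(𝕜, 𝕜) ∞ fun q : G => ℓ (Ad 𝕜 q Y) := by
  obtain ⟨f, hf, hℓ⟩ := exists_contMDiffAt_dirDeriv_one_eq ℓ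
  intro q
  simp only [← hℓ, ← dirDeriv_conj (hf.mdifferentiableAt (by simp))]
  refine contMDiffAt_dirDeriv (θ := fun q h : G => f (q * h * q⁻¹)) ?_ Y
  refine ContMDiffAt.comp (I' := 𝓘(𝕜, E)) (g := f) (q, 1) ?_
    ((contMDiffAt_fst.mul contMDiffAt_snd).mul contMDiffAt_fst.inv)
  simpa only [mul_one, mul_inv_cancel] using hf

variable [CompleteSpace E]

/-- Exchange the derivatives of `f (q * h * q⁻¹)` in `q` and `h`. The derivative in `q` is that of
left minus right multiplication, and the difference of the iterated derivatives is then the bracket.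
-/
theorem dirDeriv_Ad_one (ℓ : GroupLieAlgebra 𝓘(𝕜, E) G →ₗ[𝕜] 𝕜)
    (X Y : GroupLieAlgebra 𝓘(𝕜, E) G) :
    dirDeriv (fun q : G => ℓ (Ad 𝕜 q Y)) 1 X = ℓ ⁅X, Y⁆ := by
  obtain ⟨f, hf, hℓ⟩ := exists_contMDiffAt_dirDeriv_one_eq ℓ
  have h1 (q : G) : ℓ (Ad 𝕜 q Y) = dirDeriv (fun h : G => f (q * h * q⁻¹)) 1 Y := by
    rw [← hℓ, dirDeriv_conj (hf.mdifferentiableAt (by simp))]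
  have h2 : ContMDiffAt (𝓘(𝕜, E).prod 𝓘(𝕜, E)) 𝓘(𝕜, 𝕜) ∞
      (Function.uncurry fun q h : G => f (q * h * q⁻¹)) (1, 1) :=
    ContMDiffAt.comp (I' := 𝓘(𝕜, E)) (g := f) (1, 1)
      (by simpa only [mul_one, mul_inv_cancel] using hf)
      ((contMDiffAt_fst.mul contMDiffAt_snd).mul contMDiffAt_fst.inv)
  have hm : ContMDiffAt (𝓘(𝕜, E).prod 𝓘(𝕜, E)) 𝓘(𝕜, 𝕜) ∞
      (Function.uncurry fun k h : G => f (k * h)) (1, 1) :=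
    ContMDiffAt.comp (I' := 𝓘(𝕜, E)) (g := f) (1, 1)
      (by simpa only [mul_one] using hf) (contMDiffAt_fst.mul contMDiffAt_snd)
  have hm' : ContMDiffAt (𝓘(𝕜, E).prod 𝓘(𝕜, E)) 𝓘(𝕜, 𝕜) ∞
      (Function.uncurry fun k h : G => f (h * k)) (1, 1) :=
    ContMDiffAt.comp (I' := 𝓘(𝕜, E)) (g := f) (1, 1)
      (by simpa only [mul_one] using hf) (contMDiffAt_snd.mul contMDiffAt_fst)
  have h3 : (fun h : G => dirDeriv (fun q : G => f (q * h * q⁻¹)) 1 X) =ᶠ[𝓝 1]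
      fun h => dirDeriv (fun q : G => f (q * h)) 1 X - dirDeriv (fun q : G => f (h * q)) 1 X := by
    have : IsManifold 𝓘(𝕜, E) 2 G := IsManifold.of_le (n := ∞) two_le_infty
    filter_upwards [(contMDiffAt_iff_contMDiffAt_nhds (by simp)).1 (hf.of_le two_le_infty)]
      with h hh
    exact dirDeriv_conj_left hh X
  have hd : MDifferentiableAt 𝓘(𝕜, E) 𝓘(𝕜, 𝕜) (fun h => dirDeriv (fun q : G => f (q * h)) 1 X) 1 :=
    (contMDiffAt_dirDeriv hm' X).mdifferentiableAt (by simp)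
  have hd' : MDifferentiableAt 𝓘(𝕜, E) 𝓘(𝕜, 𝕜) (fun h => dirDeriv (fun q : G => f (h * q)) 1 X) 1 :=
    (contMDiffAt_dirDeriv hm X).mdifferentiableAt (by simp)
  simp only [h1]
  have h4 := dirDeriv_comm h2 X Y
  have h5 := dirDeriv_comm hm X Y
  rw [h4, dirDeriv_congr h3, ← hℓ, ← dirDeriv_mul_sub hf, h5]
  simp only [dirDeriv]
  have h6 := mfderiv_sub hd hd'
  exact congrArg (fun L : E →L[𝕜] 𝕜 => L Y) h6

/-- Conjugation is a group homomorphism, so the second derivatives of `f ∘ conj` that define the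
bracket are those of `f` in the conjugated directions. -/
theorem Ad_lie (q : G) (X Y : GroupLieAlgebra 𝓘(𝕜, E) G) :
    Ad 𝕜 q ⁅X, Y⁆ = ⁅Ad 𝕜 q X, Ad 𝕜 q Y⁆ :=
  eq_of_forall_dirDeriv_one fun f hf => by
    have hq := contMDiffAt_comp_conj hf q
    have key (X Y : GroupLieAlgebra 𝓘(𝕜, E) G) :
        dirDeriv (fun k : G => dirDeriv (fun h : G => f (q * (k * h) * q⁻¹)) 1 Y) 1 X =
          dirDeriv (fun k : G => dirDeriv (fun h : G => f (k * h)) 1 (Ad 𝕜 q Y)) 1 (Ad 𝕜 q X) := by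
      have : IsManifold 𝓘(𝕜, E) 2 G := IsManifold.of_le (n := ∞) two_le_infty
      have hm : ContMDiffAt (𝓘(𝕜, E).prod 𝓘(𝕜, E)) 𝓘(𝕜, 𝕜) ∞
          (Function.uncurry fun k h : G => f (k * h)) (1, 1) :=
        ContMDiffAt.comp (I' := 𝓘(𝕜, E)) (g := f) (1, 1)
          (by simpa only [mul_one] using hf) (contMDiffAt_fst.mul contMDiffAt_snd)
      rw [← dirDeriv_conj ((contMDiffAt_dirDeriv hm _).mdifferentiableAt (by simp))]
      refine dirDeriv_congr ?_ X
      have hc : ContinuousAt (fun k : G => q * k * q⁻¹) 1 :=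
        (contMDiff_conj (𝕜 := 𝕜) (E := E) q).continuous.continuousAt
      have h1 : q * 1 * q⁻¹ = 1 := by group
      have he : ∀ᶠ k in 𝓝 (1 : G), ContMDiffAt 𝓘(𝕜, E) 𝓘(𝕜, 𝕜) 2 f (q * k * q⁻¹) := by
        refine hc.eventually ?_
        change ∀ᶠ y in 𝓝 (q * 1 * q⁻¹), _
        rw [h1]
        exact (contMDiffAt_iff_contMDiffAt_nhds (by simp)).1 (hf.of_le two_le_infty)
      filter_upwards [he] with k hk
      rw [← dirDeriv_conj (f := fun h : G => f (q * k * q⁻¹ * h))]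
      · simp only [mul_assoc, inv_mul_cancel_left]
      · refine MDifferentiableAt.comp (I' := 𝓘(𝕜, E)) (g := f) 1 ?_ 
          ((contMDiff_mul_left (n := ∞)).mdifferentiableAt (by simp))
        rw [mul_one]
        exact hk.mdifferentiableAt two_ne_zero
    rw [← dirDeriv_mul_sub hf, ← dirDeriv_conj (hf.mdifferentiableAt (by simp)),
      ← dirDeriv_mul_sub hq, key, key]

/-- An invariant bilinear form on the Lie algebra of a connected group is invariant under the
adjoint action. -/
theorem bilin_Ad_Ad [ConnectedSpace G] (B : LinearMap.BilinForm 𝕜 (GroupLieAlgebra 𝓘(𝕜, E) G))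
    (hB : ∀ X Y Z, B ⁅X, Y⁆ Z = B X ⁅Y, Z⁆) (q : G) (Y Z : GroupLieAlgebra 𝓘(𝕜, E) G) :
    B (Ad 𝕜 q Y) (Ad 𝕜 q Z) = B Y Z := by
  have : Module.Finite 𝕜 (GroupLieAlgebra 𝓘(𝕜, E) G) :=
    inferInstanceAs (FiniteDimensional 𝕜 E)
  let b := Module.finBasis 𝕜 (GroupLieAlgebra 𝓘(𝕜, E) G)
  have hexp (U V : GroupLieAlgebra 𝓘(𝕜, E) G) :
      B U V = ∑ i, ∑ j, b.coord i U * b.coord j V * B (b i) (b j) := by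
    conv_lhs => rw [← b.sum_repr U, ← b.sum_repr V]
    simp only [map_sum, LinearMap.sum_apply, map_smul, LinearMap.smul_apply, smul_eq_mul,
      Module.Basis.coord_apply, Finset.mul_sum]
    rw [Finset.sum_comm]
    refine Finset.sum_congr rfl fun i _ => Finset.sum_congr rfl fun j _ => ?_
    ring
  have hsm (Y Z : GroupLieAlgebra 𝓘(𝕜, E) G) : ContMDiff (𝓘(𝕜, E).prod 𝓘(𝕜, E)) 𝓘(𝕜, 𝕜) ∞
      (Function.uncurry fun h k : G => B (Ad 𝕜 h Y) (Ad 𝕜 k Z)) := by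
    have h1 : (Function.uncurry fun h k : G => B (Ad 𝕜 h Y) (Ad 𝕜 k Z)) = fun p : G × G =>
        ∑ i, ∑ j, b.coord i (Ad 𝕜 p.1 Y) * b.coord j (Ad 𝕜 p.2 Z) * B (b i) (b j) := by
      ext p
      exact hexp _ _
    rw [h1]
    refine contMDiff_finsetSum fun i _ => contMDiff_finsetSum fun j _ => ?_
    exact (((contMDiff_Ad (b.coord i) Y).comp contMDiff_fst).mul
      ((contMDiff_Ad (b.coord j) Z).comp contMDiff_snd)).mul contMDiff_const
  -- At the identity the derivative is `B ⁅X, Y⁆ Z + B Y ⁅X, Z⁆`, which vanishes by infinitesimal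
  -- invariance.
  have hd (Y Z X : GroupLieAlgebra 𝓘(𝕜, E) G) :
      dirDeriv (fun h : G => B (Ad 𝕜 h Y) (Ad 𝕜 h Z)) 1 X = 0 := by
    rw [dirDeriv_diag (θ := fun h k => B (Ad 𝕜 h Y) (Ad 𝕜 k Z))
      ((hsm Y Z).mdifferentiableAt (by simp))]
    have h1 : dirDeriv (fun h : G => B (Ad 𝕜 h Y) Z) 1 X = B ⁅X, Y⁆ Z :=
      dirDeriv_Ad_one (LinearMap.flip B Z) X Y
    have h2 := dirDeriv_Ad_one (B Y) X Z
    simp only [Ad_one]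
    rw [h1, h2, ← hB Y X Z, ← lie_skew Y X, map_neg, LinearMap.neg_apply, add_neg_cancel]
  have hφ : ContMDiff 𝓘(𝕜, E) 𝓘(𝕜, 𝕜) ∞ (fun h : G => B (Ad 𝕜 h Y) (Ad 𝕜 h Z)) :=
    (hsm Y Z).comp (contMDiff_id.prodMk contMDiff_id)
  have hlc : IsLocallyConstant (fun h : G => B (Ad 𝕜 h Y) (Ad 𝕜 h Z)) := by
    refine isLocallyConstant_of_dirDeriv_eq_zero hφ fun x v => ?_
    -- Writing `h = (h * x⁻¹) * x` moves the derivative at `x` to the identity, with `Y`, `Z`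
    -- replaced by their images under `Ad x`.
    have h1 : (fun h : G => B (Ad 𝕜 h Y) (Ad 𝕜 h Z)) = fun h : G =>
        (fun k : G => B (Ad 𝕜 k (Ad 𝕜 x Y)) (Ad 𝕜 k (Ad 𝕜 x Z))) (h * x⁻¹) := by
      ext h
      simp only [← Ad_mul, inv_mul_cancel_right]
    rw [h1, dirDeriv_comp (E' := E) (f := fun k : G => B (Ad 𝕜 k (Ad 𝕜 x Y)) (Ad 𝕜 k (Ad 𝕜 x Z)))
      (g := fun h : G => h * x⁻¹)]
    · exact (dirDeriv_congr_point (𝕜 := 𝕜) (E := E) _ (mul_inv_cancel x) _).trans (hd _ _ _)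
    · exact ((hsm _ _).comp (contMDiff_id.prodMk contMDiff_id)).mdifferentiableAt (by simp)
    · exact (contMDiff_mul_right (n := ∞)).mdifferentiableAt (by simp)
  have h2 := hlc.apply_eq_of_preconnectedSpace q 1
  simpa only [Ad_one] using h2

end Adjoint

/-! ### Biderivations and the Schouten bracket -/

section Schouten

variable {𝕜 : Type*} [Field 𝕜] {A : Type*} [CommRing A] [Algebra 𝕜 A]

/-- The Schouten bracket of two brackets; its diagonal is twice the Jacobiator. -/
def schouten : (A →ₗ[𝕜] A →ₗ[𝕜] A) →ₗ[𝕜] (A →ₗ[𝕜] A →ₗ[𝕜] A) →ₗ[𝕜] (A → A → A → A) :=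
  LinearMap.mk₂ 𝕜 (fun P Q F H K =>
    P (Q F H) K + P (Q H K) F + P (Q K F) H + (Q (P F H) K + Q (P H K) F + Q (P K F) H))
    (by intros; funext F H K; simp; ring)
    (by intros; funext F H K; simp [smul_add])
    (by intros; funext F H K; simp; ring)
    (by intros; funext F H K; simp [smul_add])

theorem schouten_apply (P Q : A →ₗ[𝕜] A →ₗ[𝕜] A) (F H K : A) :
    schouten P Q F H K =
      P (Q F H) K + P (Q H K) F + P (Q K F) H + (Q (P F H) K + Q (P H K) F + Q (P K F) H) := rfl

theorem schouten_comm (P Q : A →ₗ[𝕜] A →ₗ[𝕜] A) : schouten P Q = schouten Q P := by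
  funext F H K
  simp only [schouten_apply]
  ring

theorem schouten_sub {P Q : A →ₗ[𝕜] A →ₗ[𝕜] A} (h : schouten P Q = 0) :
    schouten (P - Q) (P - Q) = schouten P P + schouten Q Q := by
  funext F H K
  have h1 : schouten P Q F H K = 0 := by rw [h]; rfl
  simp only [schouten_apply, LinearMap.sub_apply, map_sub, Pi.add_apply] at h1 ⊢
  linear_combination -2 * h1

/-- The bracket `X ∧ Y` of two derivations. -/
def wedge (X Y : Derivation 𝕜 A A) : A →ₗ[𝕜] A →ₗ[𝕜] A :=
  (LinearMap.mul 𝕜 A).compl₁₂ X.toLinearMap Y.toLinearMap -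
    (LinearMap.mul 𝕜 A).compl₁₂ Y.toLinearMap X.toLinearMap

theorem wedge_apply (X Y : Derivation 𝕜 A A) (F H : A) :
    wedge X Y F H = X F * Y H - Y F * X H := rfl

/-- The trivector `X ∧ Y ∧ Z`, evaluated on three functions. -/
def alt (X Y Z : Derivation 𝕜 A A) (F H K : A) : A :=
  X F * Y H * Z K + X H * Y K * Z F + X K * Y F * Z H -
    X F * Y K * Z H - X H * Y F * Z K - X K * Y H * Z F

/-- Second-order terms cancel in the cyclic sum and only commutators survive. This reduces the
Jacobi identity to commutation relations. -/
theorem schouten_wedge (X Y Z T : Derivation 𝕜 A A) :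
    schouten (wedge X Y) (wedge Z T) =
      alt ⁅X, T⁆ Y Z + alt ⁅Y, Z⁆ X T - alt ⁅X, Z⁆ Y T - alt ⁅Y, T⁆ X Z := by
  funext F H K
  simp only [schouten_apply, wedge_apply, alt, Derivation.commutator_apply, map_sub,
    LinearMap.sub_apply, Derivation.leibniz, smul_eq_mul, Pi.add_apply, Pi.sub_apply]
  ring

/-- The Lie derivative of a bracket along a derivation. -/
def lieDeriv (X : Derivation 𝕜 A A) : (A →ₗ[𝕜] A →ₗ[𝕜] A) →ₗ[𝕜] (A → A → A) where
  toFun P F H := X (P F H) - P (X F) H - P F (X H)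
  map_add' P Q := by funext F H; simp; ring
  map_smul' a P := by funext F H; simp [smul_sub]

theorem lieDeriv_apply (X : Derivation 𝕜 A A) (P : A →ₗ[𝕜] A →ₗ[𝕜] A) (F H : A) :
    lieDeriv X P F H = X (P F H) - P (X F) H - P F (X H) := rfl

theorem lieDeriv_wedge (X Y Z : Derivation 𝕜 A A) (F H : A) :
    lieDeriv X (wedge Y Z) F H = wedge ⁅X, Y⁆ Z F H + wedge Y ⁅X, Z⁆ F H := by
  simp only [lieDeriv_apply, wedge_apply, Derivation.commutator_apply, map_sub,
    Derivation.leibniz, smul_eq_mul]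
  ring

/-- Antisymmetric biderivations. -/
structure IsBiderivation (P : A →ₗ[𝕜] A →ₗ[𝕜] A) : Prop where
  skew : ∀ F H, P F H = -P H F
  leibniz : ∀ F F' H, P (F * F') H = F * P F' H + F' * P F H

theorem isBiderivation_wedge (X Y : Derivation 𝕜 A A) : IsBiderivation (wedge X Y) where
  skew F H := by simp only [wedge_apply]; ring
  leibniz F F' H := by simp only [wedge_apply, Derivation.leibniz, smul_eq_mul]; ring

theorem IsBiderivation.add {P Q : A →ₗ[𝕜] A →ₗ[𝕜] A} (hP : IsBiderivation P)
    (hQ : IsBiderivation Q) : IsBiderivation (P + Q) where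
  skew F H := by simp only [LinearMap.add_apply, hP.skew F H, hQ.skew F H]; ring
  leibniz F F' H := by simp only [LinearMap.add_apply, hP.leibniz, hQ.leibniz]; ring

theorem IsBiderivation.sub {P Q : A →ₗ[𝕜] A →ₗ[𝕜] A} (hP : IsBiderivation P)
    (hQ : IsBiderivation Q) : IsBiderivation (P - Q) where
  skew F H := by simp only [LinearMap.sub_apply, hP.skew F H, hQ.skew F H]; ring
  leibniz F F' H := by simp only [LinearMap.sub_apply, hP.leibniz, hQ.leibniz]; ring

theorem IsBiderivation.smul {P : A →ₗ[𝕜] A →ₗ[𝕜] A} (hP : IsBiderivation P) (a : 𝕜) :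
    IsBiderivation (a • P) where
  skew F H := by simp only [LinearMap.smul_apply, hP.skew F H, smul_neg]
  leibniz F F' H := by
    simp only [LinearMap.smul_apply, hP.leibniz, smul_add, mul_smul_comm]

theorem isBiderivation_zero : IsBiderivation (0 : A →ₗ[𝕜] A →ₗ[𝕜] A) where
  skew F H := by simp
  leibniz F F' H := by simp

theorem isBiderivation_sum {κ : Type*} (s : Finset κ) (P : κ → A →ₗ[𝕜] A →ₗ[𝕜] A)
    (h : ∀ i ∈ s, IsBiderivation (P i)) : IsBiderivation (∑ i ∈ s, P i) :=
  Finset.sum_induction P IsBiderivation (fun _ _ => IsBiderivation.add) isBiderivation_zero h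

/-- The Schouten bracket of `X ∧ Y` with `P` is a combination of `X ∧ L_Y P` and `Y ∧ L_X P`. -/
theorem schouten_wedge_eq_zero {P : A →ₗ[𝕜] A →ₗ[𝕜] A} (hP : IsBiderivation P)
    {X Y : Derivation 𝕜 A A} (hX : lieDeriv X P = 0) (hY : lieDeriv Y P = 0) :
    schouten (wedge X Y) P = 0 := by
  have hX' (F H : A) : X (P F H) = P (X F) H + P F (X H) := by
    have := congrFun (congrFun hX F) H
    simp only [lieDeriv_apply, Pi.zero_apply] at this
    linear_combination this
  have hY' (F H : A) : Y (P F H) = P (Y F) H + P F (Y H) := by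
    have := congrFun (congrFun hY F) H
    simp only [lieDeriv_apply, Pi.zero_apply] at this
    linear_combination this
  funext F H K
  simp only [schouten_apply, wedge_apply, map_sub, LinearMap.sub_apply, hP.leibniz, hX', hY',
    Pi.zero_apply]
  rw [hP.skew F (X H), hP.skew H (X K), hP.skew K (X F), hP.skew F (Y H), hP.skew H (Y K),
    hP.skew K (Y F)]
  ring

/-- The Lie derivative along `a • X` differs from `a` times the one along `X` only by terms
containing `P a`. This admits non-constant coefficients such as the components of `R`. -/
theorem lieDeriv_smul_eq_zero {P : A →ₗ[𝕜] A →ₗ[𝕜] A} (hP : IsBiderivation P)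
    {X : Derivation 𝕜 A A} (hX : lieDeriv X P = 0) {a : A} (ha : ∀ F, P a F = 0) :
    lieDeriv (a • X) P = 0 := by
  funext F H
  have h1 := congrFun (congrFun hX F) H
  simp only [lieDeriv_apply, Pi.zero_apply] at h1
  simp only [lieDeriv_apply, Pi.zero_apply, Derivation.smul_apply, smul_eq_mul, hP.leibniz, ha]
  rw [hP.skew F (a * X H), hP.leibniz, ha, hP.skew (X H) F]
  linear_combination a * h1

end Schouten

/-! ### Trivectors built from families of derivations -/

section Families

variable {𝕜 : Type*} [Field 𝕜] {A : Type*} [CommRing A] [Algebra 𝕜 A]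

theorem alt_add₁ (X X' Y Z : Derivation 𝕜 A A) : alt (X + X') Y Z = alt X Y Z + alt X' Y Z := by
  funext F H K
  simp only [alt, Pi.add_apply, Derivation.add_apply]
  ring

theorem alt_swap₁₂ (X Y Z : Derivation 𝕜 A A) : alt Y X Z = -alt X Y Z := by
  funext F H K
  simp only [alt, Pi.neg_apply]
  ring

theorem alt_swap₂₃ (X Y Z : Derivation 𝕜 A A) : alt X Z Y = -alt X Y Z := by
  funext F H K
  simp only [alt, Pi.neg_apply]
  ring

theorem alt_add₂ (X Y Y' Z : Derivation 𝕜 A A) : alt X (Y + Y') Z = alt X Y Z + alt X Y' Z := by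
  rw [alt_swap₁₂, alt_add₁, alt_swap₁₂ X Y, alt_swap₁₂ X Y', neg_add, neg_neg, neg_neg]

theorem alt_add₃ (X Y Z Z' : Derivation 𝕜 A A) : alt X Y (Z + Z') = alt X Y Z + alt X Y Z' := by
  rw [alt_swap₂₃, alt_add₂, alt_swap₂₃ X Z, alt_swap₂₃ X Z', neg_add]

theorem alt_smul₁ (a : A) (X Y Z : Derivation 𝕜 A A) : alt (a • X) Y Z = a • alt X Y Z := by
  funext F H K
  simp only [alt, Pi.smul_apply, Derivation.smul_apply, smul_eq_mul]
  ring

theorem alt_smul₂ (a : A) (X Y Z : Derivation 𝕜 A A) : alt X (a • Y) Z = a • alt X Y Z := by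
  rw [alt_swap₁₂, alt_smul₁, alt_swap₁₂ X Y, smul_neg, neg_neg]

theorem alt_smul₃ (a : A) (X Y Z : Derivation 𝕜 A A) : alt X Y (a • Z) = a • alt X Y Z := by
  rw [alt_swap₂₃, alt_smul₂, alt_swap₂₃ X Z, smul_neg]

theorem alt_const_smul₁ (a : 𝕜) (X Y Z : Derivation 𝕜 A A) :
    alt (a • X) Y Z = a • alt X Y Z := by
  rw [← algebraMap_smul A a X, alt_smul₁, algebraMap_smul]

theorem alt_const_smul₂ (a : 𝕜) (X Y Z : Derivation 𝕜 A A) :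
    alt X (a • Y) Z = a • alt X Y Z := by
  rw [← algebraMap_smul A a Y, alt_smul₂, algebraMap_smul]

theorem alt_const_smul₃ (a : 𝕜) (X Y Z : Derivation 𝕜 A A) :
    alt X Y (a • Z) = a • alt X Y Z := by
  rw [← algebraMap_smul A a Z, alt_smul₃, algebraMap_smul]

theorem alt_neg₁ (X Y Z : Derivation 𝕜 A A) : alt (-X) Y Z = -alt X Y Z := by
  rw [← neg_one_smul 𝕜 X, alt_const_smul₁, neg_one_smul]

theorem alt_neg₂ (X Y Z : Derivation 𝕜 A A) : alt X (-Y) Z = -alt X Y Z := by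
  rw [← neg_one_smul 𝕜 Y, alt_const_smul₂, neg_one_smul]

theorem alt_neg₃ (X Y Z : Derivation 𝕜 A A) : alt X Y (-Z) = -alt X Y Z := by
  rw [← neg_one_smul 𝕜 Z, alt_const_smul₃, neg_one_smul]

theorem alt_zero₁ (Y Z : Derivation 𝕜 A A) : alt 0 Y Z = 0 := by
  rw [← zero_smul 𝕜 (0 : Derivation 𝕜 A A), alt_const_smul₁, zero_smul]

/-- The properties of a pair of dual bases with respect to an invariant scalar product: the
Casimir tensor is symmetric and invariant. -/
structure IsCasimirPair (𝕜 : Type*) [Field 𝕜] {L : Type*} [LieRing L] [LieAlgebra 𝕜 L]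
    {ι : Type*} [Fintype ι] (T T' : ι → L) : Prop where
  symm : ∑ a, T a ⊗ₜ[𝕜] T' a = ∑ a, T' a ⊗ₜ[𝕜] T a
  inv : ∀ X : L, ∑ a, ⁅X, T a⁆ ⊗ₜ[𝕜] T' a + ∑ a, T a ⊗ₜ[𝕜] ⁅X, T' a⁆ = 0

variable {L : Type*} [LieRing L] [LieAlgebra 𝕜 L] {ι : Type*} [Fintype ι]
  {T T' : ι → L} {V : Type*} [AddCommGroup V] [Module 𝕜 V]

/-- A tensor identity is transported by lifting a bilinear map. Bilinearity enters as four
equations, so that unbundled expressions in derivations can be inserted for `φ`. -/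
theorem IsCasimirPair.sum_swap (h : IsCasimirPair 𝕜 T T') (φ : L → L → V)
    (h₁ : ∀ X X' Y, φ (X + X') Y = φ X Y + φ X' Y) (h₂ : ∀ (c : 𝕜) X Y, φ (c • X) Y = c • φ X Y)
    (h₃ : ∀ X Y Y', φ X (Y + Y') = φ X Y + φ X Y') (h₄ : ∀ (c : 𝕜) X Y, φ X (c • Y) = c • φ X Y) :
    ∑ a, φ (T' a) (T a) = ∑ a, φ (T a) (T' a) := by
  have := congrArg (TensorProduct.lift (LinearMap.mk₂ 𝕜 φ h₁ h₂ h₃ h₄)) h.symm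
  simpa only [map_sum, TensorProduct.lift.tmul, LinearMap.mk₂_apply] using this.symm

theorem IsCasimirPair.sum_lie (h : IsCasimirPair 𝕜 T T') (X : L) (φ : L → L → V)
    (h₁ : ∀ X X' Y, φ (X + X') Y = φ X Y + φ X' Y) (h₂ : ∀ (c : 𝕜) X Y, φ (c • X) Y = c • φ X Y)
    (h₃ : ∀ X Y Y', φ X (Y + Y') = φ X Y + φ X Y') (h₄ : ∀ (c : 𝕜) X Y, φ X (c • Y) = c • φ X Y) :
    ∑ a, φ ⁅X, T a⁆ (T' a) + ∑ a, φ (T a) ⁅X, T' a⁆ = 0 := by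
  have := congrArg (TensorProduct.lift (LinearMap.mk₂ 𝕜 φ h₁ h₂ h₃ h₄)) (h.inv X)
  simpa only [map_sum, map_add, map_zero, TensorProduct.lift.tmul, LinearMap.mk₂_apply] using this

variable (T T')

/-- The contraction of the structure constants with three families of derivations. -/
def cartan (x y z : L →ₗ[𝕜] Derivation 𝕜 A A) : A → A → A → A :=
  ∑ a, ∑ b, alt (x ⁅T a, T b⁆) (y (T' a)) (z (T' b))

variable {T T'}

theorem cartan_swap₂₃ (x y z : L →ₗ[𝕜] Derivation 𝕜 A A) :
    cartan T T' x z y = cartan T T' x y z := by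
  unfold cartan
  rw [Finset.sum_comm]
  refine Finset.sum_congr rfl fun a _ => Finset.sum_congr rfl fun b _ => ?_
  rw [← lie_skew, map_neg, alt_neg₁, alt_swap₂₃, neg_neg]

theorem IsCasimirPair.sum_alt₁ (h : IsCasimirPair 𝕜 T T') (x y z : L →ₗ[𝕜] Derivation 𝕜 A A) :
    ∑ a, ∑ b, alt (x ⁅T' a, T b⁆) (y (T a)) (z (T' b)) = cartan T T' x y z := by
  unfold cartan
  rw [Finset.sum_comm]
  refine Eq.trans (Finset.sum_congr rfl fun b _ => ?_) Finset.sum_comm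
  refine h.sum_swap (fun X Y => alt (x ⁅X, T b⁆) (y Y) (z (T' b))) ?_ ?_ ?_ ?_ <;> intros <;>
    simp only [add_lie, smul_lie, map_add, map_smul, alt_add₁, alt_add₂, alt_const_smul₁,
      alt_const_smul₂]

theorem IsCasimirPair.sum_alt₂ (h : IsCasimirPair 𝕜 T T') (x y z : L →ₗ[𝕜] Derivation 𝕜 A A) :
    ∑ a, ∑ b, alt (x ⁅T a, T' b⁆) (y (T' a)) (z (T b)) = cartan T T' x y z := by
  refine Finset.sum_congr rfl fun a _ => ?_
  refine h.sum_swap (fun X Y => alt (x ⁅T a, X⁆) (y (T' a)) (z Y)) ?_ ?_ ?_ ?_ <;> intros <;>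
    simp only [lie_add, lie_smul, map_add, map_smul, alt_add₁, alt_add₃, alt_const_smul₁,
      alt_const_smul₃]

theorem IsCasimirPair.sum_alt₁₂ (h : IsCasimirPair 𝕜 T T') (x y z : L →ₗ[𝕜] Derivation 𝕜 A A) :
    ∑ a, ∑ b, alt (x ⁅T' a, T' b⁆) (y (T a)) (z (T b)) = cartan T T' x y z := by
  rw [← h.sum_alt₁]
  refine Finset.sum_congr rfl fun a _ => ?_
  refine h.sum_swap (fun X Y => alt (x ⁅T' a, X⁆) (y (T a)) (z Y)) ?_ ?_ ?_ ?_ <;> intros <;>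
    simp only [lie_add, lie_smul, map_add, map_smul, alt_add₁, alt_add₃, alt_const_smul₁,
      alt_const_smul₃]

/-- Invariance of the Casimir tensor moves the bracket to another slot, and the antisymmetry of
`alt` absorbs the sign. With `cartan_swap₂₃` this makes `cartan` symmetric in its three families,
the counterpart of the total antisymmetry of `f`. -/
theorem IsCasimirPair.cartan_swap₁₂ (h : IsCasimirPair 𝕜 T T')
    (x y z : L →ₗ[𝕜] Derivation 𝕜 A A) : cartan T T' y x z = cartan T T' x y z := by
  rw [← h.sum_alt₁]
  unfold cartan
  refine Finset.sum_comm.trans (Eq.trans (Finset.sum_congr rfl fun b _ => ?_) Finset.sum_comm)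
  have h1 := h.sum_lie (T b) (fun X Y => alt (x X) (y Y) (z (T' b)))
    (by intros; simp only [map_add, alt_add₁]) (by intros; simp only [map_smul, alt_const_smul₁])
    (by intros; simp only [map_add, alt_add₂]) (by intros; simp only [map_smul, alt_const_smul₂])
  have h2 (a : ι) : alt (x ⁅T a, T b⁆) (y (T' a)) (z (T' b)) =
      -alt (x ⁅T b, T a⁆) (y (T' a)) (z (T' b)) := by
    rw [← lie_skew, map_neg, alt_neg₁]
  have h3 (a : ι) : alt (y ⁅T' a, T b⁆) (x (T a)) (z (T' b)) =
      alt (x (T a)) (y ⁅T b, T' a⁆) (z (T' b)) := by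
    rw [← lie_skew, map_neg, alt_neg₁, alt_swap₁₂, neg_neg]
  simp only [h2, h3, Finset.sum_neg_distrib]
  exact eq_neg_of_add_eq_zero_right h1

theorem cartan_add₁ (x x' y z : L →ₗ[𝕜] Derivation 𝕜 A A) :
    cartan T T' (x + x') y z = cartan T T' x y z + cartan T T' x' y z := by
  simp only [cartan, LinearMap.add_apply, alt_add₁, Finset.sum_add_distrib]

theorem cartan_neg₁ (x y z : L →ₗ[𝕜] Derivation 𝕜 A A) :
    cartan T T' (-x) y z = -cartan T T' x y z := by
  simp only [cartan, LinearMap.neg_apply, alt_neg₁, Finset.sum_neg_distrib]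

theorem cartan_zero₁ (y z : L →ₗ[𝕜] Derivation 𝕜 A A) : cartan T T' 0 y z = 0 := by
  simp only [cartan, LinearMap.zero_apply, alt_zero₁, Finset.sum_const_zero]

theorem cartan_add₂ (x y y' z : L →ₗ[𝕜] Derivation 𝕜 A A) :
    cartan T T' x (y + y') z = cartan T T' x y z + cartan T T' x y' z := by
  simp only [cartan, LinearMap.add_apply, alt_add₂, Finset.sum_add_distrib]

theorem cartan_neg₂ (x y z : L →ₗ[𝕜] Derivation 𝕜 A A) :
    cartan T T' x (-y) z = -cartan T T' x y z := by
  simp only [cartan, LinearMap.neg_apply, alt_neg₂, Finset.sum_neg_distrib]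

theorem cartan_add₃ (x y z z' : L →ₗ[𝕜] Derivation 𝕜 A A) :
    cartan T T' x y (z + z') = cartan T T' x y z + cartan T T' x y z' := by
  simp only [cartan, LinearMap.add_apply, alt_add₃, Finset.sum_add_distrib]

theorem cartan_neg₃ (x y z : L →ₗ[𝕜] Derivation 𝕜 A A) :
    cartan T T' x y (-z) = -cartan T T' x y z := by
  simp only [cartan, LinearMap.neg_apply, alt_neg₃, Finset.sum_neg_distrib]

variable (T T')

/-- The bracket `∑ₐ x(Tₐ) ∧ y(Tᵃ)`. -/
def casimirBracket (x y : L →ₗ[𝕜] Derivation 𝕜 A A) : A →ₗ[𝕜] A →ₗ[𝕜] A :=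
  ∑ a, wedge (x (T a)) (y (T' a))

/-- The bracket `∑ᵢⱼ cᵢⱼ x(Tᵢ) ∧ x(Tⱼ)`. -/
def tensorBracket (c : ι → ι → A) (x : L →ₗ[𝕜] Derivation 𝕜 A A) : A →ₗ[𝕜] A →ₗ[𝕜] A :=
  ∑ i, ∑ j, wedge (c i j • x (T i)) (x (T j))

/-- The trivector `∑ cᵢⱼ cₖₗ x[Tᵢ, Tₖ] ∧ x(Tⱼ) ∧ x(Tₗ)`. -/
def yangBaxter (c : ι → ι → A) (x : L →ₗ[𝕜] Derivation 𝕜 A A) : A → A → A → A :=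
  ∑ i, ∑ j, ∑ k, ∑ l, (c i j * c k l) • alt (x ⁅T i, T k⁆) (x (T j)) (x (T l))

variable {T T'}

theorem schouten_sum {κ κ' : Type*} (s : Finset κ) (t : Finset κ') (P : κ → A →ₗ[𝕜] A →ₗ[𝕜] A)
    (Q : κ' → A →ₗ[𝕜] A →ₗ[𝕜] A) :
    schouten (∑ a ∈ s, P a) (∑ b ∈ t, Q b) = ∑ a ∈ s, ∑ b ∈ t, schouten (P a) (Q b) := by
  simp only [map_sum, LinearMap.sum_apply]
  exact Finset.sum_comm

/-- When each of the four commutators depends only on the bracket of its arguments, `schouten_wedge`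
yields contracted structure constants. Swapping `T` with `T'` brings every term to the form of
`cartan`. -/
theorem schouten_casimirBracket (h : IsCasimirPair 𝕜 T T')
    {x y z t p q m n : L →ₗ[𝕜] Derivation 𝕜 A A}
    (hp : ∀ X Y, ⁅x X, z Y⁆ = p ⁅X, Y⁆) (hq : ∀ X Y, ⁅x X, t Y⁆ = q ⁅X, Y⁆)
    (hm : ∀ X Y, ⁅y X, z Y⁆ = m ⁅X, Y⁆) (hn : ∀ X Y, ⁅y X, t Y⁆ = n ⁅X, Y⁆) :
    schouten (casimirBracket T T' x y) (casimirBracket T T' z t) =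
      cartan T T' q y z + cartan T T' m x t - cartan T T' p y t - cartan T T' n x z := by
  simp only [casimirBracket, schouten_sum, schouten_wedge, hp, hq, hm, hn,
    Finset.sum_add_distrib, Finset.sum_sub_distrib]
  rw [h.sum_alt₂, h.sum_alt₁, h.sum_alt₁₂]
  rfl

theorem commutator_smul (X Y : Derivation 𝕜 A A) (a : A) : ⁅X, a • Y⁆ = X a • Y + a • ⁅X, Y⁆ := by
  ext F
  simp only [Derivation.commutator_apply, Derivation.add_apply, Derivation.smul_apply, smul_eq_mul,
    Derivation.leibniz]
  ring

theorem smul_commutator (X Y : Derivation 𝕜 A A) (a : A) :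
    ⁅a • X, Y⁆ = a • ⁅X, Y⁆ - Y a • X := by
  ext F
  simp only [Derivation.commutator_apply, Derivation.sub_apply, Derivation.smul_apply, smul_eq_mul,
    Derivation.leibniz]
  ring

/-- The coefficients are constant along the family, so only commutators contribute. Relabelling the
indices and the antisymmetry of `c` make the four resulting terms equal, which gives the factor 4.
-/
theorem schouten_tensorBracket {c : ι → ι → A} (hc : ∀ i j, c i j = -c j i)
    {x : L →ₗ[𝕜] Derivation 𝕜 A A} (hx : ∀ X Y, ⁅x X, x Y⁆ = -x ⁅X, Y⁆)
    (hxc : ∀ X i j, x X (c i j) = 0) :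
    schouten (tensorBracket T c x) (tensorBracket T c x) = (4 : 𝕜) • yangBaxter T c x := by
  have key (i j k l : ι) :
      schouten (wedge (c i j • x (T i)) (x (T j))) (wedge (c k l • x (T k)) (x (T l))) =
      (c i j * c k l) • alt (x ⁅T i, T k⁆) (x (T j)) (x (T l)) +
      (c i j * c k l) • alt (x ⁅T j, T l⁆) (x (T i)) (x (T k)) -
      (c i j * c k l) • alt (x ⁅T i, T l⁆) (x (T j)) (x (T k)) -
      (c i j * c k l) • alt (x ⁅T j, T k⁆) (x (T i)) (x (T l)) := by
    rw [schouten_wedge]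
    simp only [commutator_smul, smul_commutator, hx, hxc, zero_smul, zero_add, sub_zero, alt_smul₁,
      alt_smul₂, alt_smul₃, alt_neg₁, smul_neg, Derivation.smul_apply, smul_zero]
    simp only [smul_smul, mul_comm (c k l)]
    abel
  have e1 : ∑ i, ∑ j, ∑ k, ∑ l, (c i j * c k l) • alt (x ⁅T j, T l⁆) (x (T i)) (x (T k)) =
      yangBaxter T c x := by
    unfold yangBaxter
    rw [Finset.sum_comm]
    refine Finset.sum_congr rfl fun i _ => Finset.sum_congr rfl fun j _ => ?_
    rw [Finset.sum_comm]
    refine Finset.sum_congr rfl fun k _ => Finset.sum_congr rfl fun l _ => ?_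
    rw [hc i j, hc k l, neg_mul_neg]
  have e2 : ∑ i, ∑ j, ∑ k, ∑ l, (c i j * c k l) • alt (x ⁅T i, T l⁆) (x (T j)) (x (T k)) =
      -yangBaxter T c x := by
    unfold yangBaxter
    simp only [← Finset.sum_neg_distrib]
    refine Finset.sum_congr rfl fun i _ => Finset.sum_congr rfl fun j _ => ?_
    rw [Finset.sum_comm]
    refine Finset.sum_congr rfl fun k _ => Finset.sum_congr rfl fun l _ => ?_
    rw [hc k l, mul_neg, neg_smul, neg_neg]
  have e3 : ∑ i, ∑ j, ∑ k, ∑ l, (c i j * c k l) • alt (x ⁅T j, T k⁆) (x (T i)) (x (T l)) =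
      -yangBaxter T c x := by
    unfold yangBaxter
    simp only [← Finset.sum_neg_distrib]
    rw [Finset.sum_comm]
    refine Finset.sum_congr rfl fun i _ => Finset.sum_congr rfl fun j _ =>
      Finset.sum_congr rfl fun k _ => Finset.sum_congr rfl fun l _ => ?_
    rw [hc i j, neg_mul, neg_smul, neg_neg]
  have e0 : ∑ i, ∑ j, ∑ k, ∑ l, (c i j * c k l) • alt (x ⁅T i, T k⁆) (x (T j)) (x (T l)) =
      yangBaxter T c x := rfl
  simp only [tensorBracket, schouten_sum]
  have e5 : ∀ i : ι, ∑ k, ∑ j, ∑ l, schouten (wedge (c i j • x (T i)) (x (T j)))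
      (wedge (c k l • x (T k)) (x (T l))) = ∑ j, ∑ k, ∑ l, schouten
      (wedge (c i j • x (T i)) (x (T j))) (wedge (c k l • x (T k)) (x (T l))) :=
    fun _ => Finset.sum_comm
  refine (Finset.sum_congr rfl fun i _ => e5 i).trans ?_
  simp only [key, Finset.sum_add_distrib, Finset.sum_sub_distrib, e0, e1, e2, e3]
  module

end Families

/-! ### The Schouten square of the bracket, in terms of commuting families of derivations -/

section MainIdentity

variable {𝕜 : Type*} [Field 𝕜] {A : Type*} [CommRing A] [Algebra 𝕜 A]
  {L : Type*} [LieRing L] [LieAlgebra 𝕜 L] {ι : Type*} [Fintype ι] {T T' : ι → L}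

theorem alt_swap₁₃ (X Y Z : Derivation 𝕜 A A) : alt Z Y X = -alt X Y Z := by
  funext F H K
  simp only [alt, Pi.neg_apply]
  ring

theorem alt_sum₂ {κ : Type*} (s : Finset κ) (X Z : Derivation 𝕜 A A) (Y : κ → Derivation 𝕜 A A) :
    alt X (∑ a ∈ s, Y a) Z = ∑ a ∈ s, alt X (Y a) Z :=
  map_sum (AddMonoidHom.mk' (fun Y => alt X Y Z) fun Y Y' => alt_add₂ X Y Y' Z) Y s

theorem derivation_sum_apply {κ : Type*} (s : Finset κ) (D : κ → Derivation 𝕜 A A) (F : A) :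
    (∑ a ∈ s, D a) F = ∑ a ∈ s, D a F :=
  map_sum (AddMonoidHom.mk' (fun D : Derivation 𝕜 A A => D F) fun _ _ => rfl) D s

theorem wedge_add_left (X X' Y : Derivation 𝕜 A A) :
    wedge (X + X') Y = wedge X Y + wedge X' Y := by
  ext F H
  simp only [wedge_apply, LinearMap.add_apply, Derivation.add_apply]
  ring

theorem wedge_add_right (X Y Y' : Derivation 𝕜 A A) :
    wedge X (Y + Y') = wedge X Y + wedge X Y' := by
  ext F H
  simp only [wedge_apply, LinearMap.add_apply, Derivation.add_apply]
  ring

theorem wedge_smul_left (a : 𝕜) (X Y : Derivation 𝕜 A A) : wedge (a • X) Y = a • wedge X Y := by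
  ext F H
  simp only [wedge_apply, LinearMap.smul_apply, Derivation.smul_apply, smul_sub, smul_mul_assoc,
    mul_smul_comm]

theorem wedge_smul_right (a : 𝕜) (X Y : Derivation 𝕜 A A) : wedge X (a • Y) = a • wedge X Y := by
  ext F H
  simp only [wedge_apply, LinearMap.smul_apply, Derivation.smul_apply, smul_sub, smul_mul_assoc,
    mul_smul_comm]

theorem isBiderivation_casimirBracket (x y : L →ₗ[𝕜] Derivation 𝕜 A A) :
    IsBiderivation (casimirBracket T T' x y) :=
  isBiderivation_sum _ _ fun _ _ => isBiderivation_wedge _ _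

theorem isBiderivation_tensorBracket (c : ι → ι → A) (x : L →ₗ[𝕜] Derivation 𝕜 A A) :
    IsBiderivation (tensorBracket T c x) :=
  isBiderivation_sum _ _ fun _ _ => isBiderivation_sum _ _ fun _ _ => isBiderivation_wedge _ _

/-- `Z` acts on both families by the same adjoint transformation, under which the Casimir tensor is
invariant. -/
theorem IsCasimirPair.lieDeriv_casimirBracket (h : IsCasimirPair 𝕜 T T') {Z : Derivation 𝕜 A A}
    {X : L} {x y : L →ₗ[𝕜] Derivation 𝕜 A A} (hx : ∀ Y, ⁅Z, x Y⁆ = -x ⁅X, Y⁆)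
    (hy : ∀ Y, ⁅Z, y Y⁆ = -y ⁅X, Y⁆) : lieDeriv Z (casimirBracket T T' x y) = 0 := by
  have h1 := h.sum_lie X (fun X Y => wedge (x X) (y Y))
    (by intros; simp only [map_add, wedge_add_left])
    (by intros; simp only [map_smul, wedge_smul_left])
    (by intros; simp only [map_add, wedge_add_right])
    (by intros; simp only [map_smul, wedge_smul_right])
  funext F H
  have h2 := LinearMap.congr_fun (LinearMap.congr_fun h1 F) H
  simp only [LinearMap.add_apply, LinearMap.sum_apply, LinearMap.zero_apply, wedge_apply] at h2
  simp only [casimirBracket, map_sum, Finset.sum_apply, lieDeriv_wedge, hx, hy, wedge_apply,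
    Derivation.neg_apply, Pi.zero_apply, ← Finset.sum_add_distrib] at h2 ⊢
  rw [← neg_eq_zero, ← Finset.sum_neg_distrib, ← h2]
  refine Finset.sum_congr rfl fun a _ => ?_
  ring

theorem lieDeriv_casimirBracket_of_commute {Z : Derivation 𝕜 A A}
    {x y : L →ₗ[𝕜] Derivation 𝕜 A A} (hx : ∀ Y, ⁅Z, x Y⁆ = 0)
    (hy : ∀ Y, ⁅Z, y Y⁆ = 0) : lieDeriv Z (casimirBracket T T' x y) = 0 := by
  funext F H
  simp only [casimirBracket, map_sum, Finset.sum_apply, lieDeriv_wedge, hx, hy, wedge_apply,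
    Derivation.zero_apply, Pi.zero_apply, zero_mul, mul_zero, sub_zero, add_zero,
    Finset.sum_const_zero]

theorem lieDeriv_tensorBracket_of_commute {Z : Derivation 𝕜 A A} {c : ι → ι → A}
    {x : L →ₗ[𝕜] Derivation 𝕜 A A} (hx : ∀ Y, ⁅Z, x Y⁆ = 0) (hc : ∀ i j, Z (c i j) = 0) :
    lieDeriv Z (tensorBracket T c x) = 0 := by
  funext F H
  simp only [tensorBracket, map_sum, Finset.sum_apply, lieDeriv_wedge, commutator_smul, hx, hc,
    wedge_apply, Derivation.zero_apply, Pi.zero_apply, zero_mul, mul_zero, sub_zero, add_zero,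
    smul_zero, zero_smul, Finset.sum_const_zero]

theorem schouten_casimirBracket_eq_zero {P : A →ₗ[𝕜] A →ₗ[𝕜] A} (hP : IsBiderivation P)
    {x y : L →ₗ[𝕜] Derivation 𝕜 A A} (hx : ∀ X, lieDeriv (x X) P = 0)
    (hy : ∀ X, lieDeriv (y X) P = 0) : schouten (casimirBracket T T' x y) P = 0 := by
  simp only [casimirBracket, map_sum, LinearMap.sum_apply,
    schouten_wedge_eq_zero hP (hx _) (hy _), Finset.sum_const_zero]

theorem schouten_tensorBracket_eq_zero {P : A →ₗ[𝕜] A →ₗ[𝕜] A} (hP : IsBiderivation P)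
    {c : ι → ι → A} {x : L →ₗ[𝕜] Derivation 𝕜 A A} (hx : ∀ X, lieDeriv (x X) P = 0)
    (hc : ∀ i j F, P (c i j) F = 0) : schouten (tensorBracket T c x) P = 0 := by
  simp only [tensorBracket, map_sum, LinearMap.sum_apply,
    schouten_wedge_eq_zero hP (lieDeriv_smul_eq_zero hP (hx _) (hc _ _)) (hx _),
    Finset.sum_const_zero]

theorem casimirBracket_eq_zero {x y : L →ₗ[𝕜] Derivation 𝕜 A A} {a : A} (hx : ∀ X, x X a = 0)
    (hy : ∀ X, y X a = 0) (F : A) : casimirBracket T T' x y a F = 0 := by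
  simp only [casimirBracket, LinearMap.sum_apply, wedge_apply, hx, hy, zero_mul, sub_zero,
    Finset.sum_const_zero]

theorem tensorBracket_eq_zero {x : L →ₗ[𝕜] Derivation 𝕜 A A} {a : A} (hx : ∀ X, x X a = 0)
    (c : ι → ι → A) (F : A) : tensorBracket T c x a F = 0 := by
  simp only [tensorBracket, LinearMap.sum_apply, wedge_apply, Derivation.smul_apply, hx, zero_mul,
    smul_zero, sub_zero, Finset.sum_const_zero]

theorem IsBiderivation.apply_algebraMap {P : A →ₗ[𝕜] A →ₗ[𝕜] A} (hP : IsBiderivation P)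
    (c : 𝕜) (F : A) : P (algebraMap 𝕜 A c) F = 0 := by
  have h1 : P 1 F = 0 := by simpa using hP.leibniz 1 1 F
  rw [Algebra.algebraMap_eq_smul_one, map_smul, LinearMap.smul_apply, h1, smul_zero]

/-- Three families of derivations and a matrix of functions, with the commutation relations of the
left and right multiplication derivatives `l`, `ρ` in a group variable `Ω`, of the left
multiplication derivatives `m` in a second group variable, and of the components of an equivariant
map of `Ω`. -/
structure IsDynamicalFamily (T T' : ι → L) (l ρ m : L →ₗ[𝕜] Derivation 𝕜 A A)
    (R : ι → ι → A) : Prop where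
  ll : ∀ X Y, ⁅l X, l Y⁆ = -l ⁅X, Y⁆
  rr : ∀ X Y, ⁅ρ X, ρ Y⁆ = ρ ⁅X, Y⁆
  lr : ∀ X Y, ⁅l X, ρ Y⁆ = 0
  mm : ∀ X Y, ⁅m X, m Y⁆ = -m ⁅X, Y⁆
  lm : ∀ X Y, ⁅l X, m Y⁆ = 0
  rm : ∀ X Y, ⁅ρ X, m Y⁆ = 0
  casimir_eq : ∀ F, ∑ a, l (T a) F • l (T' a) = ∑ a, ρ (T a) F • ρ (T' a)
  cartan_eq : cartan T T' l l l = cartan T T' ρ ρ ρ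
  m_coeff : ∀ X i j, m X (R i j) = 0
  skew : ∀ i j, R i j = -R j i
  equivariant : ∀ (X : L) (Φ : L →ₗ[𝕜] L →ₗ[𝕜] A),
    ∑ i, ∑ j, (l X (R i j) - ρ X (R i j)) * Φ (T i) (T j) =
      ∑ i, ∑ j, R i j * (Φ ⁅X, T i⁆ (T j) + Φ (T i) ⁅X, T j⁆)

variable (T T') in
/-- The bracket on functions of one group variable `Ω` and the left half of the bracket on functions
of `g`. -/
def halfBracket (r : ι → ι → 𝕜) (l ρ m : L →ₗ[𝕜] Derivation 𝕜 A A) (R : ι → ι → A) :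
    A →ₗ[𝕜] A →ₗ[𝕜] A :=
  -- For antisymmetric coefficients `tensorBracket` is twice the contraction, and the Casimir tensor
  -- enters `r±` with factor one half, whence the common factor. All occurrences of `r` assemble
  -- into the single family `l - ρ + m`.
  (1 / 2 : 𝕜) • (tensorBracket T (fun i j => algebraMap 𝕜 A (r i j)) (l - ρ + m) +
    (casimirBracket T T' ρ l + casimirBracket T T' (l + ρ) m) + tensorBracket T R m)

theorem isBiderivation_halfBracket (r : ι → ι → 𝕜) (l ρ m : L →ₗ[𝕜] Derivation 𝕜 A A)
    (R : ι → ι → A) : IsBiderivation (halfBracket T T' r l ρ m R) :=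
  (((isBiderivation_tensorBracket _ _).add ((isBiderivation_casimirBracket _ _).add
    (isBiderivation_casimirBracket _ _))).add (isBiderivation_tensorBracket _ _)).smul _

variable {l ρ m : L →ₗ[𝕜] Derivation 𝕜 A A} {R : ι → ι → A}

theorem lieDeriv_halfBracket_of_commute (r : ι → ι → 𝕜) {Z : Derivation 𝕜 A A}
    (hl : ∀ Y, ⁅Z, l Y⁆ = 0) (hr : ∀ Y, ⁅Z, ρ Y⁆ = 0) (hm : ∀ Y, ⁅Z, m Y⁆ = 0)
    (hR : ∀ i j, Z (R i j) = 0) : lieDeriv Z (halfBracket T T' r l ρ m R) = 0 := by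
  have hD (Y : L) : ⁅Z, (l + ρ) Y⁆ = 0 := by rw [LinearMap.add_apply, lie_add, hl, hr, add_zero]
  have hu (Y : L) : ⁅Z, (l - ρ + m) Y⁆ = 0 := by
    rw [LinearMap.add_apply, LinearMap.sub_apply, lie_add, lie_sub, hl, hr, hm, sub_zero, add_zero]
  simp only [halfBracket, map_smul, map_add, lieDeriv_casimirBracket_of_commute hr hl,
    lieDeriv_casimirBracket_of_commute hD hm, lieDeriv_tensorBracket_of_commute hm hR,
    lieDeriv_tensorBracket_of_commute hu fun i j => Derivation.map_algebraMap Z (r i j),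
    add_zero, smul_zero]

/-- Every derivation in the half bracket preserves `P` and every coefficient has zero `P`-bracket
with all functions, so the bracket with `P` vanishes term by term. -/
theorem schouten_halfBracket_eq_zero {P : A →ₗ[𝕜] A →ₗ[𝕜] A} (hP : IsBiderivation P)
    (r : ι → ι → 𝕜) (hl : ∀ X, lieDeriv (l X) P = 0) (hr : ∀ X, lieDeriv (ρ X) P = 0)
    (hm : ∀ X, lieDeriv (m X) P = 0) (hR : ∀ i j F, P (R i j) F = 0) :
    schouten (halfBracket T T' r l ρ m R) P = 0 := by
  have hadd {X Y : Derivation 𝕜 A A} (hX : lieDeriv X P = 0) (hY : lieDeriv Y P = 0) (e : 𝕜) :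
      lieDeriv (X + e • Y) P = 0 := by
    funext F H
    have h1 := congrFun (congrFun hX F) H
    have h2 := congrFun (congrFun hY F) H
    simp only [lieDeriv_apply, Pi.zero_apply] at h1 h2
    have h3 := congrArg (e • ·) h2
    simp only [lieDeriv_apply, Pi.zero_apply, Derivation.add_apply, Derivation.smul_apply, map_add,
      map_smul, LinearMap.add_apply, LinearMap.smul_apply, smul_sub, smul_zero] at h3 ⊢
    linear_combination h1 + h3
  have hD (X : L) : lieDeriv ((l + ρ) X) P = 0 := by
    have := hadd (hl X) (hr X) 1
    rwa [one_smul] at this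
  have hu (X : L) : lieDeriv ((l - ρ + m) X) P = 0 := by
    have := hadd (hadd (hl X) (hr X) (-1)) (hm X) 1
    rwa [one_smul, neg_one_smul, ← sub_eq_add_neg] at this
  simp only [halfBracket, map_smul, map_add, LinearMap.smul_apply, LinearMap.add_apply,
    schouten_casimirBracket_eq_zero hP hr hl, schouten_casimirBracket_eq_zero hP hD hm,
    schouten_tensorBracket_eq_zero hP hm hR,
    schouten_tensorBracket_eq_zero hP hu fun i j => hP.apply_algebraMap (r i j),
    add_zero, smul_zero]

theorem halfBracket_eq_zero (r : ι → ι → 𝕜) {a : A} (hl : ∀ X, l X a = 0) (hr : ∀ X, ρ X a = 0)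
    (hm : ∀ X, m X a = 0) (F : A) : halfBracket T T' r l ρ m R a F = 0 := by
  have hD (X : L) : (l + ρ) X a = 0 := by
    rw [LinearMap.add_apply, Derivation.add_apply, hl, hr, add_zero]
  have hu (X : L) : (l - ρ + m) X a = 0 := by
    rw [LinearMap.add_apply, LinearMap.sub_apply, Derivation.add_apply, Derivation.sub_apply, hl,
      hr, hm, sub_zero, add_zero]
  simp only [halfBracket, LinearMap.smul_apply, LinearMap.add_apply, casimirBracket_eq_zero hr hl,
    casimirBracket_eq_zero hD hm, tensorBracket_eq_zero hm, tensorBracket_eq_zero hu, add_zero,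
    smul_zero]

/-- The Schouten square of the difference of the brackets of two group-valued variables. -/
theorem schouten_sub_halfBracket (r : ι → ι → 𝕜) {l' ρ' m' : L →ₗ[𝕜] Derivation 𝕜 A A}
    {R' : ι → ι → A}
    (hll : ∀ X Y, ⁅l X, l' Y⁆ = 0) (hlr : ∀ X Y, ⁅l X, ρ' Y⁆ = 0) (hlm : ∀ X Y, ⁅l X, m' Y⁆ = 0)
    (hrl : ∀ X Y, ⁅ρ X, l' Y⁆ = 0) (hrr : ∀ X Y, ⁅ρ X, ρ' Y⁆ = 0) (hrm : ∀ X Y, ⁅ρ X, m' Y⁆ = 0)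
    (hml : ∀ X Y, ⁅m X, l' Y⁆ = 0) (hmr : ∀ X Y, ⁅m X, ρ' Y⁆ = 0) (hmm : ∀ X Y, ⁅m X, m' Y⁆ = 0)
    (hl : ∀ X i j, l X (R' i j) = 0) (hr : ∀ X i j, ρ X (R' i j) = 0)
    (hm : ∀ X i j, m X (R' i j) = 0) (hl' : ∀ X i j, l' X (R i j) = 0)
    (hr' : ∀ X i j, ρ' X (R i j) = 0) (hm' : ∀ X i j, m' X (R i j) = 0) :
    schouten (halfBracket T T' r l ρ m R - halfBracket T T' r l' ρ' m' R')
        (halfBracket T T' r l ρ m R - halfBracket T T' r l' ρ' m' R') =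
      schouten (halfBracket T T' r l ρ m R) (halfBracket T T' r l ρ m R) +
        schouten (halfBracket T T' r l' ρ' m' R') (halfBracket T T' r l' ρ' m' R') := by
  have h1 : schouten (halfBracket T T' r l ρ m R) (halfBracket T T' r l' ρ' m' R') = 0 :=
    schouten_halfBracket_eq_zero (isBiderivation_halfBracket r l' ρ' m' R') r
      (fun X => lieDeriv_halfBracket_of_commute r (hll X) (hlr X) (hlm X) (hl X))
      (fun X => lieDeriv_halfBracket_of_commute r (hrl X) (hrr X) (hrm X) (hr X))
      (fun X => lieDeriv_halfBracket_of_commute r (hml X) (hmr X) (hmm X) (hm X))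
      fun i j F => halfBracket_eq_zero r (fun X => hl' X i j) (fun X => hr' X i j)
        (fun X => hm' X i j) F
  exact schouten_sub h1

theorem jacobiator_eq (P : A →ₗ[𝕜] A →ₗ[𝕜] A) (F H K : A) :
    2 * (P (P F H) K + P (P H K) F + P (P K F) H) = schouten P P F H K := by
  rw [schouten_apply, two_mul]

namespace IsDynamicalFamily

theorem rl (h : IsDynamicalFamily T T' l ρ m R) (X Y : L) : ⁅ρ X, l Y⁆ = 0 := by
  rw [← lie_skew, h.lr, neg_zero]

theorem ml (h : IsDynamicalFamily T T' l ρ m R) (X Y : L) : ⁅m X, l Y⁆ = 0 := by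
  rw [← lie_skew, h.lm, neg_zero]

theorem mr (h : IsDynamicalFamily T T' l ρ m R) (X Y : L) : ⁅m X, ρ Y⁆ = 0 := by
  rw [← lie_skew, h.rm, neg_zero]

theorem lie_sum_l (h : IsDynamicalFamily T T' l ρ m R) (X Y : L) :
    ⁅(l - ρ + m) X, l Y⁆ = -l ⁅X, Y⁆ := by
  rw [LinearMap.add_apply, LinearMap.sub_apply, add_lie, sub_lie, h.ll, h.rl, h.ml, sub_zero,
    add_zero]

theorem lie_sum_r (h : IsDynamicalFamily T T' l ρ m R) (X Y : L) :
    ⁅(l - ρ + m) X, ρ Y⁆ = -ρ ⁅X, Y⁆ := by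
  rw [LinearMap.add_apply, LinearMap.sub_apply, add_lie, sub_lie, h.lr, h.rr, h.mr, zero_sub,
    add_zero]

theorem lie_sum_m (h : IsDynamicalFamily T T' l ρ m R) (X Y : L) :
    ⁅(l - ρ + m) X, m Y⁆ = -m ⁅X, Y⁆ := by
  rw [LinearMap.add_apply, LinearMap.sub_apply, add_lie, sub_lie, h.lm, h.rm, h.mm, sub_zero,
    zero_add]

theorem lie_sum_sum (h : IsDynamicalFamily T T' l ρ m R) (X Y : L) :
    ⁅(l - ρ + m) X, (l - ρ + m) Y⁆ = -(l - ρ + m) ⁅X, Y⁆ := by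
  conv_lhs => rw [LinearMap.add_apply (l - ρ) m Y, LinearMap.sub_apply l ρ Y]
  rw [lie_add, lie_sub, h.lie_sum_l, h.lie_sum_r, h.lie_sum_m, LinearMap.add_apply,
    LinearMap.sub_apply]
  abel

/-- `K = ∑ₐ ρ(Tₐ) ∧ l(Tᵃ) + (l + ρ)(Tₐ) ∧ m(Tᵃ)`. -/
theorem schouten_casimir_casimir (h : IsDynamicalFamily T T' l ρ m R) [CharZero 𝕜]
    (hT : IsCasimirPair 𝕜 T T') :
    schouten (casimirBracket T T' ρ l + casimirBracket T T' (l + ρ) m)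
      (casimirBracket T T' ρ l + casimirBracket T T' (l + ρ) m) =
      (1 / 3 : 𝕜) • (cartan T T' (l - ρ + m) (l - ρ + m) (l - ρ + m) - cartan T T' m m m) := by
  have e1 := schouten_casimirBracket hT (p := ρ) (q := 0) (m := 0) (n := -l) h.rr
    (fun X Y => h.rl X Y) (fun X Y => h.lr X Y) h.ll
  have e2 := schouten_casimirBracket hT (x := ρ) (y := l) (z := l + ρ) (t := m)
    (p := ρ) (q := 0) (m := -l) (n := 0)
    (fun X Y => by rw [LinearMap.add_apply, lie_add, h.rl, h.rr, zero_add]) (fun X Y => h.rm X Y)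
    (fun X Y => by
      rw [LinearMap.add_apply, lie_add, h.ll, h.lr, add_zero, LinearMap.neg_apply])
    (fun X Y => h.lm X Y)
  have e3 := schouten_casimirBracket hT (x := l + ρ) (y := m) (z := l + ρ) (t := m)
    (p := ρ + -l) (q := 0) (m := 0) (n := -m)
    (fun X Y => by
      simp only [LinearMap.add_apply, LinearMap.neg_apply, lie_add, add_lie, h.ll, h.lr, h.rl, h.rr]
      abel)
    (fun X Y => by rw [LinearMap.add_apply, add_lie, h.lm, h.rm, add_zero]; rfl)
    (fun X Y => by rw [LinearMap.add_apply, lie_add, h.ml, h.mr, add_zero]; rfl)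
    h.mm
  have hs := hT.cartan_swap₁₂ (A := A)
  have hs' := cartan_swap₂₃ (𝕜 := 𝕜) (T := T) (T' := T') (A := A)
  have hd (x y : L →ₗ[𝕜] Derivation 𝕜 A A) : cartan T T' y x x = cartan T T' x x y :=
    (hs x y x).trans (hs' x x y)
  simp only [map_add, LinearMap.add_apply]
  rw [schouten_comm (casimirBracket T T' (l + ρ) m) (casimirBracket T T' ρ l), e1, e2, e3,
    sub_eq_add_neg l ρ]
  -- All terms expand into `cartan` of triples among `l`, `ρ`, `m`. Total symmetry brings each
  -- triple to a normal form and `cartan_eq` identifies the cubes of `l` and `ρ`, so that only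
  -- coefficients remain to be compared.
  simp only [cartan_add₁, cartan_add₂, cartan_add₃, cartan_neg₁, cartan_neg₂, cartan_neg₃,
    cartan_zero₁]
  simp only [hs' l l ρ, hs' l l m, hs' ρ ρ l, hs' ρ ρ m, hs' m m l, hs' m m ρ, hd l ρ, hd l m,
    hd ρ l, hd ρ m, hd m l, hd m ρ, hs' l ρ m, hs l ρ m, (hs m ρ l).trans ((hs' m l ρ).trans ((hs l
      m ρ).trans (hs' l ρ m))),
    (hs l m ρ).trans (hs' l ρ m), (hs' m l ρ).trans ((hs l m ρ).trans (hs' l ρ m)),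
    h.cartan_eq]
  module

theorem sum_smul_alt (h : IsDynamicalFamily T T' l ρ m R) (X : L) (Z : Derivation 𝕜 A A) :
    ∑ i, ∑ j, (l X (R i j) - ρ X (R i j)) • alt (m (T i)) Z (m (T j)) =
      ∑ i, ∑ j, R i j • (alt (m ⁅X, T i⁆) Z (m (T j)) + alt (m (T i)) Z (m ⁅X, T j⁆)) := by
  funext F H K
  have := h.equivariant X (LinearMap.mk₂ 𝕜 (fun Y Y' => alt (m Y) Z (m Y') F H K)
    (by intros; simp only [map_add, alt_add₁, Pi.add_apply])
    (by intros; simp only [map_smul, alt_const_smul₁, Pi.smul_apply])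
    (by intros; simp only [map_add, alt_add₃, Pi.add_apply])
    (by intros; simp only [map_smul, alt_const_smul₃, Pi.smul_apply]))
  simpa only [Finset.sum_apply, Pi.smul_apply, Pi.add_apply, smul_eq_mul,
    LinearMap.mk₂_apply] using this

/-- Along `l - ρ + m` the coefficients rotate by equivariance while the derivations `m` rotate the
opposite way. -/
theorem lieDeriv_tensorBracket (h : IsDynamicalFamily T T' l ρ m R) (X : L) :
    lieDeriv ((l - ρ + m) X) (tensorBracket T R m) = 0 := by
  funext F H
  have := h.equivariant X (LinearMap.mk₂ 𝕜 (fun Y Y' => wedge (m Y) (m Y') F H)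
    (by intros; simp only [map_add, wedge_add_left, LinearMap.add_apply])
    (by intros; simp only [map_smul, wedge_smul_left, LinearMap.smul_apply])
    (by intros; simp only [map_add, wedge_add_right, LinearMap.add_apply])
    (by intros; simp only [map_smul, wedge_smul_right, LinearMap.smul_apply]))
  have hu (i j : ι) : (l - ρ + m) X (R i j) = l X (R i j) - ρ X (R i j) := by
    rw [LinearMap.add_apply, Derivation.add_apply, h.m_coeff, add_zero, LinearMap.sub_apply,
      Derivation.sub_apply]
  simp only [tensorBracket, map_sum, Finset.sum_apply, lieDeriv_wedge, commutator_smul, h.lie_sum_m,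
    hu, Pi.zero_apply]
  rw [← sub_eq_zero, ← Finset.sum_sub_distrib] at this
  rw [← this]
  refine Finset.sum_congr rfl fun i _ => ?_
  rw [← Finset.sum_sub_distrib]
  refine Finset.sum_congr rfl fun j _ => ?_
  simp only [LinearMap.mk₂_apply, wedge_apply, Derivation.add_apply, Derivation.smul_apply,
    Derivation.neg_apply, smul_eq_mul]
  ring

/-- Expanding the right-hand side gives two extra sums, of type `l l` and `ρ ρ`, which cancel
because the Casimir tensor is the same in left and right derivations. -/
theorem sum_smul_alt_casimir (h : IsDynamicalFamily T T' l ρ m R) (hT : IsCasimirPair 𝕜 T T')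
    (X Z : Derivation 𝕜 A A) (F : A) :
    ∑ a, (l (T' a) F • alt X (ρ (T a)) Z - ρ (T a) F • alt X (l (T' a)) Z) =
      ∑ a, (l (T' a) F - ρ (T' a) F) • alt X ((l + ρ) (T a)) Z := by
  have hs (x y : L →ₗ[𝕜] Derivation 𝕜 A A) :
      ∑ a, x (T' a) F • alt X (y (T a)) Z = ∑ a, x (T a) F • alt X (y (T' a)) Z :=
    hT.sum_swap (fun Y Y' => x Y F • alt X (y Y') Z)
      (by intros; simp only [map_add, Derivation.add_apply, add_smul])
      (by intros; simp only [map_smul, Derivation.smul_apply, smul_assoc])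
      (by intros; simp only [map_add, alt_add₂, smul_add])
      (by intros; simp only [map_smul, alt_const_smul₂]; rw [smul_comm])
  have hc : ∑ a, l (T a) F • alt X (l (T' a)) Z = ∑ a, ρ (T a) F • alt X (ρ (T' a)) Z := by
    simp only [← alt_smul₂, ← alt_sum₂, h.casimir_eq F]
  simp only [LinearMap.add_apply, alt_add₂, smul_add, sub_smul, Finset.sum_add_distrib,
    Finset.sum_sub_distrib, hs, hc]
  abel

/-- Trivectors containing a derivation of `Ω` arise twice: from `ρ ∧ l` acting on the coefficients,
and from the commutators of `m`. By equivariance they cancel, leaving the derivative of `R` along `l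
+ ρ` with three directions `m`. -/
theorem schouten_casimir_tensor (h : IsDynamicalFamily T T' l ρ m R)
    (hT : IsCasimirPair 𝕜 T T') :
    schouten (casimirBracket T T' ρ l + casimirBracket T T' (l + ρ) m) (tensorBracket T R m) =
      ∑ i, ∑ j, ∑ a, (l + ρ) (T a) (R i j) • alt (m (T i)) (m (T j)) (m (T' a)) := by
  have key (a i j : ι) :
      schouten (wedge (ρ (T a)) (l (T' a)) + wedge ((l + ρ) (T a)) (m (T' a)))
        (wedge (R i j • m (T i)) (m (T j))) =
      (l + ρ) (T a) (R i j) • alt (m (T i)) (m (T j)) (m (T' a)) +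
      (l (T' a) (R i j) • alt (m (T i)) (ρ (T a)) (m (T j)) -
        ρ (T a) (R i j) • alt (m (T i)) (l (T' a)) (m (T j))) -
      R i j • (alt (m ⁅T' a, T i⁆) ((l + ρ) (T a)) (m (T j)) +
        alt (m (T i)) ((l + ρ) (T a)) (m ⁅T' a, T j⁆)) := by
    have hD (X Y : L) : ⁅(l + ρ) X, m Y⁆ = 0 := by
      rw [LinearMap.add_apply, add_lie, h.lm, h.rm, add_zero]
    rw [map_add, LinearMap.add_apply, schouten_wedge, schouten_wedge]
    simp only [commutator_smul, hD, h.lm, h.rm, h.mm, h.m_coeff, smul_zero, add_zero, zero_smul,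
      zero_add, alt_zero₁, alt_smul₁, alt_smul₃, alt_neg₁, smul_neg]
    rw [alt_swap₂₃ (m (T i)) (m (T j)) (m (T' a)),
      alt_swap₁₃ (m (T i)) ((l + ρ) (T a)) (m ⁅T' a, T j⁆)]
    module
  have e (i j : ι) : ∑ a, (l (T' a) (R i j) • alt (m (T i)) (ρ (T a)) (m (T j)) -
      ρ (T a) (R i j) • alt (m (T i)) (l (T' a)) (m (T j))) = _ :=
    h.sum_smul_alt_casimir hT (m (T i)) (m (T j)) (R i j)
  have e' : ∑ i, ∑ j, ∑ a, R i j • (alt (m ⁅T' a, T i⁆) ((l + ρ) (T a)) (m (T j)) +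
        alt (m (T i)) ((l + ρ) (T a)) (m ⁅T' a, T j⁆)) =
      ∑ i, ∑ j, ∑ a, (l (T' a) (R i j) - ρ (T' a) (R i j)) •
        alt (m (T i)) ((l + ρ) (T a)) (m (T j)) := by
    -- The sum over `a` is moved outside so that equivariance can be applied for each fixed `T' a`.
    have hcomm (f : ι → ι → ι → A → A → A → A) :
        ∑ i, ∑ j, ∑ a, f a i j = ∑ a, ∑ i, ∑ j, f a i j := by
      simp only [Finset.sum_comm (γ := ι) (α := ι) (s := Finset.univ) (f := fun j a => f a _ j)]
      exact Finset.sum_comm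
    rw [hcomm fun a i j => R i j • (alt (m ⁅T' a, T i⁆) ((l + ρ) (T a)) (m (T j)) +
        alt (m (T i)) ((l + ρ) (T a)) (m ⁅T' a, T j⁆)),
      hcomm fun a i j => (l (T' a) (R i j) - ρ (T' a) (R i j)) •
        alt (m (T i)) ((l + ρ) (T a)) (m (T j))]
    exact Finset.sum_congr rfl fun a _ => (h.sum_smul_alt (T' a) _).symm
  have e0 : schouten (casimirBracket T T' ρ l + casimirBracket T T' (l + ρ) m)
      (tensorBracket T R m) = ∑ i, ∑ j, ∑ a,
        schouten (wedge (ρ (T a)) (l (T' a)) + wedge ((l + ρ) (T a)) (m (T' a)))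
          (wedge (R i j • m (T i)) (m (T j))) := by
    simp only [casimirBracket, tensorBracket, ← Finset.sum_add_distrib]
    simp only [map_sum, LinearMap.sum_apply]
  rw [e0]
  simp only [key, Finset.sum_add_distrib, Finset.sum_sub_distrib]
  rw [e']
  simp only [← Finset.sum_sub_distrib, e]
  simp only [add_sub_cancel_right]

theorem lieDeriv_sum_casimir (h : IsDynamicalFamily T T' l ρ m R) (hT : IsCasimirPair 𝕜 T T')
    (X : L) : lieDeriv ((l - ρ + m) X)
      (casimirBracket T T' ρ l + casimirBracket T T' (l + ρ) m) = 0 := by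
  rw [map_add, hT.lieDeriv_casimirBracket (h.lie_sum_r X) (h.lie_sum_l X),
    hT.lieDeriv_casimirBracket (fun Y => ?_) (h.lie_sum_m X), add_zero]
  rw [LinearMap.add_apply l ρ Y, LinearMap.add_apply l ρ, lie_add, h.lie_sum_r, h.lie_sum_l,
    neg_add]

/-- The Schouten square of the bracket. -/
theorem schouten_halfBracket (h : IsDynamicalFamily T T' l ρ m R) (hT : IsCasimirPair 𝕜 T T')
    [CharZero 𝕜] {r : ι → ι → 𝕜} (hr : ∀ i j, r i j = -r j i)
    (hyb : yangBaxter T (fun i j => algebraMap 𝕜 A (r i j)) (l - ρ + m) =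
      (-(1 / 12) : 𝕜) • cartan T T' (l - ρ + m) (l - ρ + m) (l - ρ + m)) :
    schouten (halfBracket T T' r l ρ m R) (halfBracket T T' r l ρ m R) =
      yangBaxter T R m +
        (1 / 2 : 𝕜) •
          ∑ i, ∑ j, ∑ a, (l + ρ) (T a) (R i j) • alt (m (T i)) (m (T j)) (m (T' a)) -
        (1 / 12 : 𝕜) • cartan T T' m m m := by
  have e1 := h.schouten_casimir_casimir hT
  have e2 := h.schouten_casimir_tensor hT
  have e3 := schouten_tensorBracket (T := T) h.skew h.mm h.m_coeff
  have e4 := schouten_tensorBracket (T := T) (c := fun i j => algebraMap 𝕜 A (r i j))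
    (fun i j => by rw [hr i j, map_neg]) h.lie_sum_sum
    fun X i j => Derivation.map_algebraMap _ (r i j)
  have e5 := schouten_tensorBracket_eq_zero (T := T) (c := fun i j => algebraMap 𝕜 A (r i j))
    ((isBiderivation_casimirBracket (T := T) (T' := T') ρ l).add
      (isBiderivation_casimirBracket (T := T) (T' := T') (l + ρ) m)) (h.lieDeriv_sum_casimir hT)
    fun i j F => IsBiderivation.apply_algebraMap ((isBiderivation_casimirBracket _ _).add
      (isBiderivation_casimirBracket _ _)) (r i j) F
  have e6 := schouten_tensorBracket_eq_zero (T := T) (c := fun i j => algebraMap 𝕜 A (r i j))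
    (isBiderivation_tensorBracket (T := T) R m) h.lieDeriv_tensorBracket
    fun i j F => (isBiderivation_tensorBracket _ _).apply_algebraMap (r i j) F
  rw [hyb] at e4
  simp only [halfBracket]
  generalize casimirBracket T T' ρ l + casimirBracket T T' (l + ρ) m = K at *
  generalize ∑ i, ∑ j, ∑ a, (l + ρ) (T a) (R i j) • alt (m (T i)) (m (T j)) (m (T' a)) = W at *
  have e2' := (schouten_comm _ _).trans e2
  have e5' := (schouten_comm _ _).trans e5
  have e6' := (schouten_comm _ _).trans e6
  simp only [map_smul, map_add, LinearMap.smul_apply, LinearMap.add_apply]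
  -- The result is a quarter of `4 YB(r) + 4 YB(R) + [K, K] + 2 [K, R]`. The terms cubic in `l - ρ +
  -- m` cancel since `4 * (-1/12) + 1/3 = 0`.
  rw [e1, e2, e2', e3, e4, e5, e5', e6, e6']
  module

end IsDynamicalFamily

end MainIdentity

/-! ### Evaluation of triple tensors on linear forms -/

section Evaluation

variable {𝕜 : Type*} [Field 𝕜] {L : Type*} [LieRing L] [LieAlgebra 𝕜 L]
  {A : Type*} [CommRing A] [Algebra 𝕜 A] {A' : Type*} [CommRing A'] [Algebra 𝕜 A']

/-- `x ⊗ y ⊗ z ↦ α x * (β y * γ z)`. -/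
def eval₃ (α β γ : L →ₗ[𝕜] A) : L ⊗[𝕜] (L ⊗[𝕜] L) →ₗ[𝕜] A :=
  TensorProduct.lift ((LinearMap.mul 𝕜 A).compl₁₂ α
    (TensorProduct.lift ((LinearMap.mul 𝕜 A).compl₁₂ β γ)))

theorem eval₃_tmul (α β γ : L →ₗ[𝕜] A) (x y z : L) :
    eval₃ α β γ (x ⊗ₜ (y ⊗ₜ z)) = α x * (β y * γ z) := rfl

/-- The sum of `eval₃` over the permutations of the three linear forms, with signs. -/
def altEval (α β γ : L →ₗ[𝕜] A) : L ⊗[𝕜] (L ⊗[𝕜] L) →ₗ[𝕜] A :=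
  eval₃ α β γ + eval₃ β γ α + eval₃ γ α β - eval₃ α γ β - eval₃ β α γ - eval₃ γ β α

theorem altEval_tmul (α β γ : L →ₗ[𝕜] A) (x y z : L) :
    altEval α β γ (x ⊗ₜ (y ⊗ₜ z)) =
      α x * β y * γ z + β x * γ y * α z + γ x * α y * β z -
        α x * γ y * β z - β x * α y * γ z - γ x * β y * α z := by
  simp only [altEval, LinearMap.add_apply, LinearMap.sub_apply, eval₃_tmul, mul_assoc]

theorem altEval_rotate (α β γ : L →ₗ[𝕜] A) (t : L ⊗[𝕜] (L ⊗[𝕜] L)) :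
    altEval α β γ (rotate t) = altEval α β γ t := by
  suffices h : altEval α β γ ∘ₗ rotate = altEval α β γ from LinearMap.congr_fun h t
  ext x y z
  change altEval α β γ (z ⊗ₜ (x ⊗ₜ y)) = altEval α β γ (x ⊗ₜ (y ⊗ₜ z))
  rw [altEval_tmul, altEval_tmul]
  ring

/-- Cyclic permutations are even, so alternating evaluation sees the three summands alike. -/
theorem altEval_cyclicSum (α β γ : L →ₗ[𝕜] A) (t : L ⊗[𝕜] (L ⊗[𝕜] L)) :
    altEval α β γ (cyclicSum t) = 3 * altEval α β γ t := by
  rw [cyclicSum, map_add, map_add, altEval_rotate, altEval_rotate, altEval_rotate]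
  ring

theorem altEval_map (α β γ : L →ₗ[𝕜] A) (φ : L →ₗ[𝕜] L) (t : L ⊗[𝕜] (L ⊗[𝕜] L)) :
    altEval α β γ (TensorProduct.map φ (TensorProduct.map φ φ) t) =
      altEval (α ∘ₗ φ) (β ∘ₗ φ) (γ ∘ₗ φ) t := by
  suffices h : altEval α β γ ∘ₗ TensorProduct.map φ (TensorProduct.map φ φ) =
    altEval (α ∘ₗ φ) (β ∘ₗ φ) (γ ∘ₗ φ) from LinearMap.congr_fun h t
  ext x y z
  change altEval α β γ (φ x ⊗ₜ (φ y ⊗ₜ φ z)) = altEval _ _ _ (x ⊗ₜ (y ⊗ₜ z))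
  rw [altEval_tmul, altEval_tmul]
  rfl

theorem altEval_algHom (ε : A →ₐ[𝕜] A') (α β γ : L →ₗ[𝕜] A) (t : L ⊗[𝕜] (L ⊗[𝕜] L)) :
    ε (altEval α β γ t) =
      altEval (ε.toLinearMap ∘ₗ α) (ε.toLinearMap ∘ₗ β) (ε.toLinearMap ∘ₗ γ) t := by
  suffices h : ε.toLinearMap ∘ₗ altEval α β γ =
    altEval (ε.toLinearMap ∘ₗ α) (ε.toLinearMap ∘ₗ β) (ε.toLinearMap ∘ₗ γ) from
      LinearMap.congr_fun h t
  ext x y z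
  change ε (altEval α β γ (x ⊗ₜ (y ⊗ₜ z))) = altEval _ _ _ (x ⊗ₜ (y ⊗ₜ z))
  rw [altEval_tmul, altEval_tmul]
  simp only [map_add, map_sub, map_mul, LinearMap.comp_apply, AlgHom.toLinearMap_apply]

theorem altEval_neg (α β γ : L →ₗ[𝕜] A) (t : L ⊗[𝕜] (L ⊗[𝕜] L)) :
    altEval (-α) (-β) (-γ) t = -altEval α β γ t := by
  suffices h : altEval (-α) (-β) (-γ) = -altEval α β γ from LinearMap.congr_fun h t
  ext x y z
  change altEval (-α) (-β) (-γ) (x ⊗ₜ (y ⊗ₜ z)) = -altEval α β γ (x ⊗ₜ (y ⊗ₜ z))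
  rw [altEval_tmul, altEval_tmul]
  simp only [LinearMap.neg_apply]
  ring

theorem eval₃_leftComm (α β γ : L →ₗ[𝕜] A) (t : L ⊗[𝕜] (L ⊗[𝕜] L)) :
    eval₃ α β γ (TensorProduct.leftComm 𝕜 L L L t) = eval₃ β α γ t := by
  suffices h : eval₃ α β γ ∘ₗ (TensorProduct.leftComm 𝕜 L L L).toLinearMap = eval₃ β α γ from
    LinearMap.congr_fun h t
  ext x y z
  change eval₃ α β γ (y ⊗ₜ (x ⊗ₜ z)) = eval₃ β α γ (x ⊗ₜ (y ⊗ₜ z))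
  rw [eval₃_tmul, eval₃_tmul]
  ring

theorem eval₃_lTensor_comm (α β γ : L →ₗ[𝕜] A) (t : L ⊗[𝕜] (L ⊗[𝕜] L)) :
    eval₃ α β γ (LinearMap.lTensor L (TensorProduct.comm 𝕜 L L).toLinearMap t) =
      eval₃ α γ β t := by
  suffices h : eval₃ α β γ ∘ₗ LinearMap.lTensor L (TensorProduct.comm 𝕜 L L).toLinearMap =
    eval₃ α γ β from LinearMap.congr_fun h t
  ext x y z
  change eval₃ α β γ (x ⊗ₜ (z ⊗ₜ y)) = eval₃ α γ β (x ⊗ₜ (y ⊗ₜ z))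
  rw [eval₃_tmul, eval₃_tmul]
  ring

/-- The two adjacent transpositions generate all six permutations, and each signed term equals the
first. -/
theorem IsAntisymm₃.altEval_eq {t : L ⊗[𝕜] (L ⊗[𝕜] L)} (ht : IsAntisymm₃ t)
    (α β γ : L →ₗ[𝕜] A) : altEval α β γ t = 6 * eval₃ α β γ t := by
  have h1 (α β γ : L →ₗ[𝕜] A) : eval₃ β α γ t = -eval₃ α β γ t := by
    rw [← eval₃_leftComm, ht.1, map_neg]
  have h2 (α β γ : L →ₗ[𝕜] A) : eval₃ α γ β t = -eval₃ α β γ t := by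
    rw [← eval₃_lTensor_comm, ht.2, map_neg]
  simp only [altEval, LinearMap.add_apply, LinearMap.sub_apply]
  linear_combination h2 β α γ - 2 * h1 α β γ - h2 γ α β + 2 * h1 α γ β - 3 * h2 α β γ

/-- Components are values on coordinate forms. Alternating evaluation sees only the antisymmetric
part, and in characteristic zero the factor 6 can be divided out. -/
theorem IsAntisymm₃.eq_zero [CharZero 𝕜] {ι : Type*} [Finite ι] (T : Module.Basis ι 𝕜 L)
    {t : L ⊗[𝕜] (L ⊗[𝕜] L)} (ht : IsAntisymm₃ t)
    (h : ∀ α β γ : L →ₗ[𝕜] 𝕜, altEval α β γ t = 0) : t = 0 := by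
  refine (T.tensorProduct (T.tensorProduct T)).ext_elem fun ⟨i, j, k⟩ => ?_
  have h1 : (T.tensorProduct (T.tensorProduct T)).coord (i, j, k) =
      eval₃ (T.coord i) (T.coord j) (T.coord k) := by
    ext x y z
    simp [eval₃_tmul, Module.Basis.tensorProduct_repr_tmul_apply, mul_comm]
  have h2 := h (T.coord i) (T.coord j) (T.coord k)
  rw [ht.altEval_eq, mul_eq_zero_iff_left (by norm_num), ← h1] at h2
  rw [map_zero]
  exact h2

theorem IsAntisymm₃.sub {t t' : L ⊗[𝕜] (L ⊗[𝕜] L)} (h : IsAntisymm₃ t) (h' : IsAntisymm₃ t') :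
    IsAntisymm₃ (t - t') :=
  ⟨by rw [map_sub, h.1, h'.1]; abel, by rw [map_sub, h.2, h'.2]; abel⟩

theorem isAntisymm₃_zero : IsAntisymm₃ (0 : L ⊗[𝕜] (L ⊗[𝕜] L)) := by
  simp [IsAntisymm₃]

theorem IsAntisymm₃.map {t : L ⊗[𝕜] (L ⊗[𝕜] L)} (h : IsAntisymm₃ t) (φ : L →ₗ[𝕜] L) :
    IsAntisymm₃ (TensorProduct.map φ (TensorProduct.map φ φ) t) := by
  have h1 : (TensorProduct.leftComm 𝕜 L L L).toLinearMap ∘ₗ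
      TensorProduct.map φ (TensorProduct.map φ φ) =
      TensorProduct.map φ (TensorProduct.map φ φ) ∘ₗ
        (TensorProduct.leftComm 𝕜 L L L).toLinearMap := by
    ext x y z
    rfl
  have h2 : LinearMap.lTensor L (TensorProduct.comm 𝕜 L L).toLinearMap ∘ₗ
      TensorProduct.map φ (TensorProduct.map φ φ) =
      TensorProduct.map φ (TensorProduct.map φ φ) ∘ₗ
        LinearMap.lTensor L (TensorProduct.comm 𝕜 L L).toLinearMap := by
    ext x y z
    rfl
  refine ⟨(LinearMap.congr_fun h1 t).trans ?_, (LinearMap.congr_fun h2 t).trans ?_⟩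
  · change TensorProduct.map φ (TensorProduct.map φ φ) (TensorProduct.leftComm 𝕜 L L L t) = _
    rw [h.1, map_neg]
  · change TensorProduct.map φ (TensorProduct.map φ φ) (LinearMap.lTensor L _ t) = _
    rw [h.2, map_neg]

theorem rotate_rotate_rotate (t : L ⊗[𝕜] (L ⊗[𝕜] L)) : rotate (rotate (rotate t)) = t := by
  suffices h : rotate ∘ₗ rotate ∘ₗ rotate (𝕜 := 𝕜) (L := L) = LinearMap.id from
    LinearMap.congr_fun h t
  ext x y z
  rfl

theorem cyclicSum_rotate (t : L ⊗[𝕜] (L ⊗[𝕜] L)) : cyclicSum (rotate t) = cyclicSum t := by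
  rw [cyclicSum, cyclicSum, rotate_rotate_rotate]
  abel

theorem cyclicSum_add (t t' : L ⊗[𝕜] (L ⊗[𝕜] L)) :
    cyclicSum (t + t') = cyclicSum t + cyclicSum t' := by
  simp only [cyclicSum, map_add]
  abel

/-- A transposition permutes the three rotations of `t`, up to the transposition of the last two
slots, under which `t` changes sign. -/
theorem isAntisymm₃_cyclicSum {t : L ⊗[𝕜] (L ⊗[𝕜] L)}
    (h : LinearMap.lTensor L (TensorProduct.comm 𝕜 L L).toLinearMap t = -t) :
    IsAntisymm₃ (cyclicSum t) := by
  set Q := LinearMap.lTensor L (TensorProduct.comm 𝕜 L L).toLinearMap with hQ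
  set P := (TensorProduct.leftComm 𝕜 L L L).toLinearMap with hP
  -- Relations of the symmetric group on three letters, moving `Q` next to `t`.
  have e1 : P = rotate ∘ₗ Q := by ext x y z; rfl
  have e2 : P ∘ₗ rotate = Q := by ext x y z; rfl
  have e3 : P ∘ₗ rotate ∘ₗ rotate = rotate ∘ₗ rotate ∘ₗ Q := by ext x y z; rfl
  have e4 : Q ∘ₗ rotate = rotate ∘ₗ rotate ∘ₗ Q := by ext x y z; rfl
  have e5 : Q ∘ₗ rotate ∘ₗ rotate = rotate ∘ₗ Q := by ext x y z; rfl
  have e1' := LinearMap.congr_fun e1 t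
  have e2' := LinearMap.congr_fun e2 t
  have e3' := LinearMap.congr_fun e3 t
  have e4' := LinearMap.congr_fun e4 t
  have e5' := LinearMap.congr_fun e5 t
  simp only [LinearMap.comp_apply, h, map_neg] at e1' e2' e3' e4' e5'
  constructor
  · change P (cyclicSum t) = _
    rw [cyclicSum, map_add, map_add, e1', e2', e3']
    abel
  · change Q (cyclicSum t) = _
    rw [cyclicSum, map_add, map_add, h, e4', e5']
    abel

theorem lTensor_comm_bracket1213 (s t : L ⊗[𝕜] L) :
    LinearMap.lTensor L (TensorProduct.comm 𝕜 L L).toLinearMap (bracket1213 s t) =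
      -bracket1213 t s := by
  suffices h : (bracket1213 (𝕜 := 𝕜) (L := L)).compr₂
      (LinearMap.lTensor L (TensorProduct.comm 𝕜 L L).toLinearMap) =
      -(bracket1213 (𝕜 := 𝕜) (L := L)).flip from
    LinearMap.congr_fun (LinearMap.congr_fun h s) t
  ext x y z w
  change ⁅x, z⁆ ⊗ₜ[𝕜] (w ⊗ₜ[𝕜] y) = -(⁅z, x⁆ ⊗ₜ[𝕜] (w ⊗ₜ[𝕜] y))
  rw [← lie_skew, TensorProduct.neg_tmul]

theorem lTensor_comm_rotate_assoc {t : L ⊗[𝕜] L} (ht : IsAntisymm₂ t) (z : L) :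
    LinearMap.lTensor L (TensorProduct.comm 𝕜 L L).toLinearMap
      (rotate (TensorProduct.assoc 𝕜 L L L (t ⊗ₜ z))) =
        -rotate (TensorProduct.assoc 𝕜 L L L (t ⊗ₜ z)) := by
  have h (t : L ⊗[𝕜] L) : rotate (TensorProduct.assoc 𝕜 L L L (t ⊗ₜ z)) = z ⊗ₜ t := by
    simp [rotate]
  rw [h, LinearMap.lTensor_tmul]
  change z ⊗ₜ (TensorProduct.comm 𝕜 L L t) = _
  rw [ht, TensorProduct.tmul_neg]

theorem IsAntisymm₂.repr {ι : Type*} (T : Module.Basis ι 𝕜 L) {t : L ⊗[𝕜] L} (ht : IsAntisymm₂ t)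
    (i j : ι) :
    (T.tensorProduct T).repr t (i, j) = -(T.tensorProduct T).repr t (j, i) := by
  have h : (T.tensorProduct T).coord (i, j) ∘ₗ (TensorProduct.comm 𝕜 L L).toLinearMap =
      (T.tensorProduct T).coord (j, i) := by
    ext x y
    simp [Module.Basis.tensorProduct_repr_tmul_apply, mul_comm]
  have h1 := LinearMap.congr_fun h t
  change (T.tensorProduct T).repr (TensorProduct.comm 𝕜 L L t) (i, j) = _ at h1
  rw [ht, map_neg, Finsupp.neg_apply] at h1
  change _ = (T.tensorProduct T).repr t (j, i) at h1
  rw [← h1, neg_neg]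

variable {ι : Type*} [Fintype ι]

theorem sum_repr_tensor (T : Module.Basis ι 𝕜 L) (t : L ⊗[𝕜] L) :
    ∑ i, ∑ j, (T.tensorProduct T).repr t (i, j) • (T i ⊗ₜ[𝕜] T j) = t := by
  conv_rhs => rw [← (T.tensorProduct T).sum_repr t, Fintype.sum_prod_type]
  simp only [Module.Basis.tensorProduct_apply]

theorem isAntisymm₃_cyclicSum_add (t : L ⊗[𝕜] L) {D : ι → L ⊗[𝕜] L} (hD : ∀ a, IsAntisymm₂ (D a))
    (T' : ι → L) (c : 𝕜) :
    IsAntisymm₃ (cyclicSum (bracket1213 t t +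
      c • ∑ a, TensorProduct.assoc 𝕜 L L L (D a ⊗ₜ[𝕜] T' a))) := by
  -- Inside a cyclic sum the derivative term may be rotated, so that its antisymmetric pair sits in
  -- the last two slots, as it does for `bracket1213 t t`.
  rw [cyclicSum_add, ← cyclicSum_rotate (c • _), ← cyclicSum_add]
  refine isAntisymm₃_cyclicSum ?_
  rw [map_add, lTensor_comm_bracket1213, map_smul, map_smul, map_sum, map_sum, neg_add, ← smul_neg,
    ← Finset.sum_neg_distrib]
  congr 2
  exact Finset.sum_congr rfl fun a _ => lTensor_comm_rotate_assoc (hD a) (T' a)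

variable {T T' : ι → L}

/-- The linear form `X ↦ x(X) F`. -/
def formAt (x : L →ₗ[𝕜] Derivation 𝕜 A A) (F : A) : L →ₗ[𝕜] A where
  toFun X := x X F
  map_add' X Y := by rw [map_add, Derivation.add_apply]
  map_smul' c X := by rw [map_smul, Derivation.smul_apply, RingHom.id_apply]

theorem formAt_apply (x : L →ₗ[𝕜] Derivation 𝕜 A A) (F : A) (X : L) : formAt x F X = x X F := rfl

theorem alt_apply (x : L →ₗ[𝕜] Derivation 𝕜 A A) (F H K : A) (X Y Z : L) :
    alt (x X) (x Y) (x Z) F H K =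
      altEval (formAt x F) (formAt x H) (formAt x K) (X ⊗ₜ (Y ⊗ₜ Z)) := by
  rw [altEval_tmul]
  rfl

/-- In `cartan` the bracket stands in the first slot, in `structureTensor` in the last; alternating
evaluation is invariant under rotation. -/
theorem cartan_apply (x : L →ₗ[𝕜] Derivation 𝕜 A A) (F H K : A) :
    cartan T T' x x x F H K =
      altEval (formAt x F) (formAt x H) (formAt x K) (structureTensor T T') := by
  simp only [cartan, structureTensor, map_sum, Finset.sum_apply, alt_apply]
  refine Finset.sum_congr rfl fun a _ => Finset.sum_congr rfl fun b _ => ?_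
  rw [← altEval_rotate, rotate_tmul, ← altEval_rotate, rotate_tmul,
    ← altEval_rotate _ _ _ (T' a ⊗ₜ[𝕜] (T' b ⊗ₜ[𝕜] ⁅T a, T b⁆)), rotate_tmul, ← altEval_rotate,
    rotate_tmul, ← altEval_rotate, rotate_tmul]

/-- Only the images of the coefficients under `ε` must be scalars. This covers constant `r` with the
identity for `ε` and the function `R` with evaluation at a point. -/
theorem yangBaxter_apply (ε : A →ₐ[𝕜] A') {c : ι → ι → A} {d : ι → ι → 𝕜}
    (hc : ∀ i j, ε (c i j) = algebraMap 𝕜 A' (d i j))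
    (x : L →ₗ[𝕜] Derivation 𝕜 A A) (F H K : A) :
    ε (yangBaxter T c x F H K) =
      altEval (ε.toLinearMap ∘ₗ formAt x F) (ε.toLinearMap ∘ₗ formAt x H)
        (ε.toLinearMap ∘ₗ formAt x K)
        (bracket1213 (∑ i, ∑ j, d i j • (T i ⊗ₜ[𝕜] T j)) (∑ i, ∑ j, d i j • (T i ⊗ₜ[𝕜] T j))) := by
  have h1 (t : L ⊗[𝕜] L) : bracket1213 (∑ i, ∑ j, d i j • (T i ⊗ₜ[𝕜] T j)) t =
      ∑ i, ∑ j, d i j • bracket1213 (T i ⊗ₜ[𝕜] T j) t := by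
    simp only [map_sum, map_smul, LinearMap.sum_apply, LinearMap.smul_apply]
  have h2 (t : L ⊗[𝕜] L) : bracket1213 t (∑ i, ∑ j, d i j • (T i ⊗ₜ[𝕜] T j)) =
      ∑ i, ∑ j, d i j • bracket1213 t (T i ⊗ₜ[𝕜] T j) := by
    simp only [map_sum, map_smul]
  rw [h1]
  simp only [h2]
  simp only [bracket1213_tmul, Finset.smul_sum, smul_smul, yangBaxter, Finset.sum_apply,
    Pi.smul_apply, alt_apply, map_sum, map_smul, smul_eq_mul, map_mul, hc, altEval_algHom]
  simp only [Algebra.smul_def, map_mul]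

theorem sum_smul_alt_apply (ε : A →ₐ[𝕜] A') {c : ι → ι → ι → A} {d : ι → ι → ι → 𝕜}
    (hc : ∀ a i j, ε (c a i j) = algebraMap 𝕜 A' (d a i j))
    (x : L →ₗ[𝕜] Derivation 𝕜 A A) (F H K : A) :
    ε ((∑ i, ∑ j, ∑ a, c a i j • alt (x (T i)) (x (T j)) (x (T' a))) F H K) =
      altEval (ε.toLinearMap ∘ₗ formAt x F) (ε.toLinearMap ∘ₗ formAt x H)
        (ε.toLinearMap ∘ₗ formAt x K)
        (∑ a, TensorProduct.assoc 𝕜 _ _ _ ((∑ i, ∑ j, d a i j • (T i ⊗ₜ[𝕜] T j)) ⊗ₜ[𝕜] T' a)) := by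
  have h1 (a : ι) : TensorProduct.assoc 𝕜 L L L
      ((∑ i, ∑ j, d a i j • (T i ⊗ₜ[𝕜] T j)) ⊗ₜ[𝕜] T' a) =
        ∑ i, ∑ j, d a i j • (T i ⊗ₜ[𝕜] (T j ⊗ₜ[𝕜] T' a)) := by
    simp only [TensorProduct.sum_tmul, map_sum, ← TensorProduct.smul_tmul', map_smul,
      TensorProduct.assoc_tmul]
  simp only [h1, Finset.sum_apply, Pi.smul_apply, alt_apply, map_sum, map_smul, smul_eq_mul,
    map_mul, hc, altEval_algHom]
  simp only [Algebra.smul_def]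
  exact (Finset.sum_congr rfl fun i _ => Finset.sum_comm).trans Finset.sum_comm

/-- The modified Yang-Baxter equation in terms of trivectors. -/
theorem ModifiedCYBE.yangBaxter_eq [CharZero 𝕜] (T T' : Module.Basis ι 𝕜 L) {r : L ⊗[𝕜] L}
    (h : ModifiedCYBE T T' r) (x : L →ₗ[𝕜] Derivation 𝕜 A A) :
    yangBaxter T (fun i j => algebraMap 𝕜 A ((T.tensorProduct T).repr r (i, j))) x =
      (-(1 / 12) : 𝕜) • cartan T T' x x x := by
  funext F H K
  have h1 := yangBaxter_apply (T := T) (AlgHom.id 𝕜 A) (d := fun i j =>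
    (T.tensorProduct T).repr r (i, j)) (fun i j => rfl) x F H K
  have h2 := congrArg (altEval (formAt x F) (formAt x H) (formAt x K)) h
  rw [altEval_cyclicSum, map_smul, ← cartan_apply] at h2
  rw [sum_repr_tensor] at h1
  refine h1.trans ?_
  change altEval (formAt x F) (formAt x H) (formAt x K) (bracket1213 r r) = _
  simp only [Pi.smul_apply]
  -- `A` is only an algebra, so the 3 from the cyclic sum is divided out through scalars; with
  -- `-1/4` this gives `-1/12`.
  have h3 : (3 : A) * altEval (formAt x F) (formAt x H) (formAt x K) (bracket1213 r r) =
      (3 : 𝕜) • altEval (formAt x F) (formAt x H) (formAt x K) (bracket1213 r r) := by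
    rw [Algebra.smul_def, map_ofNat]
  rw [h3] at h2
  rw [← inv_smul_smul₀ (three_ne_zero (α := 𝕜)) (altEval _ _ _ (bracket1213 r r)), h2, smul_smul]
  norm_num

end Evaluation

/-! ### Dual bases with respect to an invariant scalar product -/

section DualBases

variable {𝕜 : Type*} [Field 𝕜] {L : Type*} [LieRing L] [LieAlgebra 𝕜 L]
  {ι : Type*} [Fintype ι] [DecidableEq ι] {B : LinearMap.BilinForm 𝕜 L}
  {T T' : Module.Basis ι 𝕜 L}

theorem sum_bilin_smul_left (hd : ∀ a b, B (T a) (T' b) = if a = b then 1 else 0) (X : L) :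
    ∑ a, B X (T' a) • T a = X := by
  suffices h : ∑ a, (B.flip (T' a)).smulRight (T a) = LinearMap.id by
    have := LinearMap.congr_fun h X
    rwa [LinearMap.sum_apply] at this
  refine T.ext fun b => ?_
  simp [LinearMap.sum_apply, hd]

theorem sum_bilin_smul_right (hd : ∀ a b, B (T a) (T' b) = if a = b then 1 else 0) (X : L) :
    ∑ a, B (T a) X • T' a = X := by
  suffices h : ∑ a, (B (T a)).smulRight (T' a) = LinearMap.id by
    have := LinearMap.congr_fun h X
    rwa [LinearMap.sum_apply] at this
  refine T'.ext fun b => ?_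
  simp [LinearMap.sum_apply, hd]

/-- Expanding in dual bases turns symmetry of the tensor into symmetry of `B`, and its invariance
into that of `B`. -/
theorem isCasimirPair_of_dual (hs : B.IsSymm) (hi : ∀ X Y Z, B ⁅X, Y⁆ Z = B X ⁅Y, Z⁆)
    (hd : ∀ a b, B (T a) (T' b) = if a = b then 1 else 0) : IsCasimirPair 𝕜 T T' where
  symm := by
    have h1 : ∑ a, T a ⊗ₜ[𝕜] T' a = ∑ a, ∑ b, B (T b) (T a) • (T' b ⊗ₜ[𝕜] T' a) := by
      refine Finset.sum_congr rfl fun a _ => ?_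
      conv_lhs => rw [← sum_bilin_smul_right hd (T a)]
      simp only [TensorProduct.sum_tmul, TensorProduct.smul_tmul']
    have h2 : ∑ a, T' a ⊗ₜ[𝕜] T a = ∑ a, ∑ b, B (T b) (T a) • (T' a ⊗ₜ[𝕜] T' b) := by
      refine Finset.sum_congr rfl fun a _ => ?_
      conv_lhs => rw [← sum_bilin_smul_right hd (T a)]
      simp only [TensorProduct.tmul_sum, TensorProduct.tmul_smul]
    rw [h1, h2, Finset.sum_comm]
    refine Finset.sum_congr rfl fun a _ => Finset.sum_congr rfl fun b _ => ?_
    rw [hs.eq]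
  inv X := by
    have h1 : ∑ a, ⁅X, T a⁆ ⊗ₜ[𝕜] T' a = ∑ a, ∑ b, B ⁅X, T a⁆ (T' b) • (T b ⊗ₜ[𝕜] T' a) := by
      refine Finset.sum_congr rfl fun a _ => ?_
      conv_lhs => rw [← sum_bilin_smul_left hd ⁅X, T a⁆]
      simp only [TensorProduct.sum_tmul, TensorProduct.smul_tmul']
    have h2 : ∑ b, T b ⊗ₜ[𝕜] ⁅X, T' b⁆ = ∑ b, ∑ a, B (T a) ⁅X, T' b⁆ • (T b ⊗ₜ[𝕜] T' a) := by
      refine Finset.sum_congr rfl fun a _ => ?_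
      conv_lhs => rw [← sum_bilin_smul_right hd ⁅X, T' a⁆]
      simp only [TensorProduct.tmul_sum, TensorProduct.tmul_smul]
    rw [h1, h2, Finset.sum_comm, ← Finset.sum_add_distrib]
    refine Finset.sum_eq_zero fun a _ => ?_
    rw [← Finset.sum_add_distrib]
    refine Finset.sum_eq_zero fun b _ => ?_
    rw [← hi, ← lie_skew, map_neg, LinearMap.neg_apply, ← add_smul, neg_add_cancel, zero_smul]

/-- An isometry carries dual bases to dual bases, and the Casimir tensor does not depend on the
choice of such a pair. -/
theorem sum_map_tmul_map (hd : ∀ a b, B (T a) (T' b) = if a = b then 1 else 0) {φ : L →ₗ[𝕜] L}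
    (hφ : ∀ X Y, B (φ X) (φ Y) = B X Y) (hφ' : Function.Surjective φ) :
    ∑ a, φ (T a) ⊗ₜ[𝕜] φ (T' a) = ∑ a, T a ⊗ₜ[𝕜] T' a := by
  have h1 : ∑ a, φ (T a) ⊗ₜ[𝕜] φ (T' a) =
      ∑ a, ∑ b, B (φ (T a)) (T' b) • (T b ⊗ₜ[𝕜] φ (T' a)) := by
    refine Finset.sum_congr rfl fun a _ => ?_
    conv_lhs => rw [← sum_bilin_smul_left hd (φ (T a))]
    simp only [TensorProduct.sum_tmul, TensorProduct.smul_tmul']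
  rw [h1, Finset.sum_comm]
  refine Finset.sum_congr rfl fun b _ => ?_
  -- Surjectivity writes `T' b` as `φ Y`, so that the isometry property applies to the coefficients.
  obtain ⟨Y, hY⟩ := hφ' (T' b)
  simp only [← hY, hφ, ← TensorProduct.tmul_smul, ← TensorProduct.tmul_sum, ← map_smul, ← map_sum]
  rw [sum_bilin_smul_right hd]

theorem sum_map_map (hd : ∀ a b, B (T a) (T' b) = if a = b then 1 else 0) {φ : L →ₗ[𝕜] L}
    (hφ : ∀ X Y, B (φ X) (φ Y) = B X Y) (hφ' : Function.Surjective φ) {V : Type*} [AddCommGroup V]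
    [Module 𝕜 V] (β : L →ₗ[𝕜] L →ₗ[𝕜] V) : ∑ a, β (φ (T a)) (φ (T' a)) = ∑ a, β (T a) (T' a) := by
  have := congrArg (TensorProduct.lift β) (sum_map_tmul_map hd hφ hφ')
  simpa only [map_sum, TensorProduct.lift.tmul] using this

theorem map_structureTensor (hd : ∀ a b, B (T a) (T' b) = if a = b then 1 else 0)
    {φ : L →ₗ[𝕜] L} (hφ : ∀ X Y, B (φ X) (φ Y) = B X Y) (hφ' : Function.Surjective φ)
    (hl : ∀ X Y, φ ⁅X, Y⁆ = ⁅φ X, φ Y⁆) :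
    TensorProduct.map φ (TensorProduct.map φ φ) (structureTensor (𝕜 := 𝕜) T T') =
      structureTensor T T' := by
  have h1 (a : ι) : ∑ b, φ (T' a) ⊗ₜ[𝕜] (φ (T' b) ⊗ₜ[𝕜] ⁅φ (T a), φ (T b)⁆) =
      ∑ b, φ (T' a) ⊗ₜ[𝕜] (T' b ⊗ₜ[𝕜] ⁅φ (T a), T b⁆) :=
    sum_map_map hd hφ hφ' (LinearMap.mk₂ 𝕜
      (fun X Y => φ (T' a) ⊗ₜ[𝕜] (Y ⊗ₜ[𝕜] ⁅φ (T a), X⁆))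
      (by intros; simp only [lie_add, TensorProduct.tmul_add])
      (by intros; simp only [lie_smul, TensorProduct.tmul_smul])
      (by intros; simp only [TensorProduct.add_tmul, TensorProduct.tmul_add])
      (by intros; simp only [← TensorProduct.smul_tmul', TensorProduct.tmul_smul]))
  have h2 (b : ι) : ∑ a, φ (T' a) ⊗ₜ[𝕜] (T' b ⊗ₜ[𝕜] ⁅φ (T a), T b⁆) =
      ∑ a, T' a ⊗ₜ[𝕜] (T' b ⊗ₜ[𝕜] ⁅T a, T b⁆) :=
    sum_map_map hd hφ hφ' (LinearMap.mk₂ 𝕜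
      (fun X Y => Y ⊗ₜ[𝕜] (T' b ⊗ₜ[𝕜] ⁅X, T b⁆))
      (by intros; simp only [add_lie, TensorProduct.tmul_add])
      (by intros; simp only [smul_lie, TensorProduct.tmul_smul])
      (by intros; simp only [TensorProduct.add_tmul])
      (by intros; simp only [← TensorProduct.smul_tmul']))
  simp only [structureTensor, map_sum, TensorProduct.map_tmul, hl, h1]
  rw [Finset.sum_comm]
  simp only [h2]
  exact Finset.sum_comm

end DualBases

/-! ### Derivations generated by smooth group actions -/

section Flows

open Set Filter Topology

variable {𝕜 : Type*} [RCLike 𝕜] {E : Type*} [NormedAddCommGroup E] [NormedSpace 𝕜 E]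

/-! ### Rules of calculus for directional derivatives -/

section DirDeriv

variable {M : Type*} [TopologicalSpace M] [ChartedSpace E M] {f g : M → 𝕜} {x : M}

theorem dirDeriv_const (c : 𝕜) (x : M) (v : TangentSpace 𝓘(𝕜, E) x) :
    dirDeriv (fun _ : M => c) x v = 0 := by
  rw [dirDeriv, mfderiv_const]
  rfl

theorem dirDeriv_add (hf : MDifferentiableAt 𝓘(𝕜, E) 𝓘(𝕜, 𝕜) f x)
    (hg : MDifferentiableAt 𝓘(𝕜, E) 𝓘(𝕜, 𝕜) g x) (v : TangentSpace 𝓘(𝕜, E) x) :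
    dirDeriv (fun y => f y + g y) x v = dirDeriv f x v + dirDeriv g x v := by
  have := (hf.hasMFDerivAt.add hg.hasMFDerivAt).mfderiv
  exact congrArg (fun L : E →L[𝕜] 𝕜 => L v) this

theorem dirDeriv_const_mul (hf : MDifferentiableAt 𝓘(𝕜, E) 𝓘(𝕜, 𝕜) f x) (c : 𝕜)
    (v : TangentSpace 𝓘(𝕜, E) x) :
    dirDeriv (fun y => c * f y) x v = c * dirDeriv f x v := by
  have := (hf.hasMFDerivAt.const_smul c).mfderiv
  exact congrArg (fun L : E →L[𝕜] 𝕜 => L v) this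

theorem dirDeriv_add_right (f : M → 𝕜) (x : M) (v w : TangentSpace 𝓘(𝕜, E) x) :
    dirDeriv f x (v + w) = dirDeriv f x v + dirDeriv f x w :=
  map_add (mfderiv 𝓘(𝕜, E) 𝓘(𝕜, 𝕜) f x) v w

theorem dirDeriv_smul_right (f : M → 𝕜) (x : M) (c : 𝕜) (v : TangentSpace 𝓘(𝕜, E) x) :
    dirDeriv f x (c • v) = c * dirDeriv f x v :=
  map_smul (mfderiv 𝓘(𝕜, E) 𝓘(𝕜, 𝕜) f x) c v

theorem dirDeriv_neg (f : M → 𝕜) (v : TangentSpace 𝓘(𝕜, E) x) :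
    dirDeriv (fun y => -f y) x v = -dirDeriv f x v := by
  have : mfderiv 𝓘(𝕜, E) 𝓘(𝕜, 𝕜) (-f) x = -mfderiv 𝓘(𝕜, E) 𝓘(𝕜, 𝕜) f x := mfderiv_neg
  exact congrArg (fun L : E →L[𝕜] 𝕜 => L v) this

theorem dirDeriv_mul (hf : MDifferentiableAt 𝓘(𝕜, E) 𝓘(𝕜, 𝕜) f x)
    (hg : MDifferentiableAt 𝓘(𝕜, E) 𝓘(𝕜, 𝕜) g x) (v : TangentSpace 𝓘(𝕜, E) x) :
    dirDeriv (fun y => f y * g y) x v = f x * dirDeriv g x v + g x * dirDeriv f x v := by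
  have := (hf.hasMFDerivAt.mul hg.hasMFDerivAt).mfderiv
  exact congrArg (fun L : E →L[𝕜] 𝕜 => L v) this

theorem mdifferentiableAt_sum {κ : Type*} (s : Finset κ) {f : κ → M → 𝕜}
    (hf : ∀ i ∈ s, MDifferentiableAt 𝓘(𝕜, E) 𝓘(𝕜, 𝕜) (f i) x) :
    MDifferentiableAt 𝓘(𝕜, E) 𝓘(𝕜, 𝕜) (fun y => ∑ i ∈ s, f i y) x := by
  classical
  induction s using Finset.induction_on with
  | empty => simpa only [Finset.sum_empty] using mdifferentiableAt_const
  | insert a s ha ih =>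
    simp only [Finset.sum_insert ha]
    exact (hf a (Finset.mem_insert_self a s)).add
      (ih fun i hi => hf i (Finset.mem_insert_of_mem hi))

theorem dirDeriv_sum {κ : Type*} (s : Finset κ) {f : κ → M → 𝕜}
    (hf : ∀ i ∈ s, MDifferentiableAt 𝓘(𝕜, E) 𝓘(𝕜, 𝕜) (f i) x) (v : TangentSpace 𝓘(𝕜, E) x) :
    dirDeriv (fun y => ∑ i ∈ s, f i y) x v = ∑ i ∈ s, dirDeriv (f i) x v := by
  classical
  induction s using Finset.induction_on with
  | empty =>
    simp only [Finset.sum_empty]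
    exact dirDeriv_const 0 x v
  | insert a s ha ih =>
    have h1 := fun i hi => hf i (Finset.mem_insert_of_mem hi)
    simp only [Finset.sum_insert ha]
    rw [dirDeriv_add (hf a (Finset.mem_insert_self a s)) (mdifferentiableAt_sum s h1), ih h1]

end DirDeriv

variable {G : Type*} [TopologicalSpace G] [ChartedSpace E G] [Group G]
  {V : Type*} [NormedAddCommGroup V] [NormedSpace 𝕜 V] {H : Type*} [TopologicalSpace H]
  (J : ModelWithCorners 𝕜 V H) {P : Type*} [TopologicalSpace P] [ChartedSpace H P]

/-- The functions that are smooth (holomorphic) on `U`. -/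
def smoothFunctions (U : Set P) : Subalgebra 𝕜 (P → 𝕜) where
  carrier := {f | ContMDiffOn J 𝓘(𝕜, 𝕜) ∞ f U}
  mul_mem' hf hg := hf.mul hg
  add_mem' hf hg := hf.add hg
  algebraMap_mem' _ := contMDiffOn_const

/-- The algebra of the functions that are smooth (holomorphic) on `U`. -/
def SmoothFunctions (U : Set P) : Type _ := smoothFunctions (𝕜 := 𝕜) J U

instance (U : Set P) : CommRing (SmoothFunctions (𝕜 := 𝕜) J U) :=
  inferInstanceAs (CommRing (smoothFunctions (𝕜 := 𝕜) J U))

instance (U : Set P) : Algebra 𝕜 (SmoothFunctions (𝕜 := 𝕜) J U) :=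
  inferInstanceAs (Algebra 𝕜 (smoothFunctions (𝕜 := 𝕜) J U))

variable {J} {U : Set P}

/-- A function that is smooth on `U` as an element of the algebra. -/
def SmoothFunctions.mk (f : P → 𝕜) (hf : ContMDiffOn J 𝓘(𝕜, 𝕜) ∞ f U) :
    SmoothFunctions (𝕜 := 𝕜) J U :=
  (⟨f, hf⟩ : smoothFunctions (𝕜 := 𝕜) J U)

theorem SmoothFunctions.contMDiffOn (F : SmoothFunctions (𝕜 := 𝕜) J U) :
    ContMDiffOn J 𝓘(𝕜, 𝕜) ∞ F.1 U := F.2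

theorem SmoothFunctions.ext {F F' : SmoothFunctions (𝕜 := 𝕜) J U} (h : ∀ p, F.1 p = F'.1 p) :
    F = F' :=
  Subtype.ext (funext h)

theorem contMDiffOn_indicator {f : P → 𝕜} (hf : ContMDiffOn J 𝓘(𝕜, 𝕜) ∞ f U) :
    ContMDiffOn J 𝓘(𝕜, 𝕜) ∞ (U.indicator f) U :=
  ContMDiffOn.congr hf fun _ hx => indicator_of_mem hx f

theorem contMDiffAt_of_mem (hU : IsOpen U) (F : SmoothFunctions (𝕜 := 𝕜) J U) {p : P}
    (hp : p ∈ U) : ContMDiffAt J 𝓘(𝕜, 𝕜) ∞ F.1 p :=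
  F.contMDiffOn.contMDiffAt (hU.mem_nhds hp)

/-- Elements of the algebra are functions on all of `P`, so their values off `U` have to be compared
as well; there the flow derivations vanish by construction. -/
theorem derivation_ext_of_mem
    {D D' : Derivation 𝕜 (SmoothFunctions (𝕜 := 𝕜) J U) (SmoothFunctions (𝕜 := 𝕜) J U)}
    (h : ∀ F, ∀ p ∈ U, (D F).1 p = (D' F).1 p) (h' : ∀ F, ∀ p ∉ U, (D F).1 p = (D' F).1 p) :
    D = D' :=
  Derivation.ext fun F => SmoothFunctions.ext fun p => by
    by_cases hp : p ∈ U
    exacts [h F p hp, h' F p hp]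

variable (J) in
/-- A smooth family of maps parametrized by `G`, the identity for the neutral element. -/
structure IsFlow (Φ : G → P → P) : Prop where
  smooth : ContMDiff (J.prod 𝓘(𝕜, E)) J ∞ fun q : P × G => Φ q.2 q.1
  one : ∀ p, Φ 1 p = p

variable {Φ Ψ : G → P → P}

theorem IsFlow.contMDiffAt_comp (hΦ : IsFlow (𝕜 := 𝕜) (E := E) J Φ) {F : P → 𝕜} {p : P}
    (hF : ContMDiffAt J 𝓘(𝕜, 𝕜) ∞ F p) :
    ContMDiffAt (J.prod 𝓘(𝕜, E)) 𝓘(𝕜, 𝕜) ∞ (Function.uncurry fun q (h : G) => F (Φ h q))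
      (p, 1) :=
  ContMDiffAt.comp (I' := J) (g := F) (p, 1) (by simpa only [hΦ.one] using hF)
    hΦ.smooth.contMDiffAt

theorem IsFlow.contMDiff_orbit (hΦ : IsFlow (𝕜 := 𝕜) (E := E) J Φ) (p : P) :
    ContMDiff 𝓘(𝕜, E) J ∞ fun h : G => Φ h p :=
  hΦ.smooth.comp (contMDiff_const.prodMk contMDiff_id)

theorem IsFlow.contMDiffAt_orbit (hΦ : IsFlow (𝕜 := 𝕜) (E := E) J Φ) {F : P → 𝕜} {p : P}
    (hF : ContMDiffAt J 𝓘(𝕜, 𝕜) ∞ F p) :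
    ContMDiffAt 𝓘(𝕜, E) 𝓘(𝕜, 𝕜) ∞ (fun h : G => F (Φ h p)) 1 :=
  ContMDiffAt.comp (I' := J) (g := F) 1 (by simpa only [hΦ.one] using hF)
    (hΦ.contMDiff_orbit p).contMDiffAt

theorem IsFlow.eventually_mem (hΦ : IsFlow (𝕜 := 𝕜) (E := E) J Φ) (hU : IsOpen U) {p : P}
    (hp : p ∈ U) : ∀ᶠ h : G in 𝓝 1, Φ h p ∈ U :=
  (hΦ.contMDiff_orbit p).continuous.continuousAt.eventually_mem
    (hU.mem_nhds (by rwa [hΦ.one]))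

theorem IsFlow.dirDeriv_congr (hΦ : IsFlow (𝕜 := 𝕜) (E := E) J Φ) (hU : IsOpen U) {p : P}
    (hp : p ∈ U) {F F' : P → 𝕜} (h : EqOn F F' U) (X : GroupLieAlgebra 𝓘(𝕜, E) G) :
    dirDeriv (fun h : G => F (Φ h p)) 1 X = dirDeriv (fun h : G => F' (Φ h p)) 1 X :=
  PLCDYBE.dirDeriv_congr ((hΦ.eventually_mem hU hp).mono fun _ hk => h hk) X

variable [LieGroup 𝓘(𝕜, E) ∞ G]

theorem IsFlow.dirDeriv_conj (hΦ : IsFlow (𝕜 := 𝕜) (E := E) J Φ) {F : P → 𝕜} {p : P} {x : G}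
    (hF : ContMDiffAt J 𝓘(𝕜, 𝕜) ∞ F p) (hc : ∀ h, Ψ h p = Φ (x * h * x⁻¹) p)
    (X : GroupLieAlgebra 𝓘(𝕜, E) G) :
    dirDeriv (fun h : G => F (Ψ h p)) 1 X = dirDeriv (fun h : G => F (Φ h p)) 1 (Ad 𝕜 x X) := by
  simp only [hc]
  exact PLCDYBE.dirDeriv_conj (f := fun h => F (Φ h p))
    ((hΦ.contMDiffAt_orbit hF).mdifferentiableAt (by simp)) x X

variable [IsManifold J ∞ P]

theorem IsFlow.contMDiffAt_dirDeriv (hΦ : IsFlow (𝕜 := 𝕜) (E := E) J Φ) {F : P → 𝕜} {p : P}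
    (hF : ContMDiffAt J 𝓘(𝕜, 𝕜) ∞ F p) (X : GroupLieAlgebra 𝓘(𝕜, E) G) :
    ContMDiffAt J 𝓘(𝕜, 𝕜) ∞ (fun p => dirDeriv (fun h : G => F (Φ h p)) 1 X) p :=
  PLCDYBE.contMDiffAt_dirDeriv (θ := fun q (h : G) => F (Φ h q)) (hΦ.contMDiffAt_comp hF) X

/-- The derivative of a function on `U` along a flow, extended by zero outside `U`. -/
def flowFunction (hU : IsOpen U) (hΦ : IsFlow (𝕜 := 𝕜) (E := E) J Φ)
    (X : GroupLieAlgebra 𝓘(𝕜, E) G) (F : SmoothFunctions (𝕜 := 𝕜) J U) :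
    SmoothFunctions (𝕜 := 𝕜) J U :=
  SmoothFunctions.mk (U.indicator fun p => dirDeriv (fun h : G => F.1 (Φ h p)) 1 X)
    (contMDiffOn_indicator fun _ hp =>
      (hΦ.contMDiffAt_dirDeriv (contMDiffAt_of_mem hU F hp) X).contMDiffWithinAt)

theorem flowFunction_apply (hU : IsOpen U) (hΦ : IsFlow (𝕜 := 𝕜) (E := E) J Φ)
    (X : GroupLieAlgebra 𝓘(𝕜, E) G) (F : SmoothFunctions (𝕜 := 𝕜) J U) {p : P} (hp : p ∈ U) :
    (flowFunction hU hΦ X F).1 p = dirDeriv (fun h : G => F.1 (Φ h p)) 1 X :=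
  indicator_of_mem hp fun p => dirDeriv (fun h : G => F.1 (Φ h p)) 1 X

theorem flowFunction_apply_notMem (hU : IsOpen U) (hΦ : IsFlow (𝕜 := 𝕜) (E := E) J Φ)
    (X : GroupLieAlgebra 𝓘(𝕜, E) G) (F : SmoothFunctions (𝕜 := 𝕜) J U) {p : P} (hp : p ∉ U) :
    (flowFunction hU hΦ X F).1 p = 0 :=
  indicator_of_notMem hp fun p => dirDeriv (fun h : G => F.1 (Φ h p)) 1 X

/-- The derivations of the functions on `U` generated by a flow. -/
def flowDerivation (hU : IsOpen U) (hΦ : IsFlow (𝕜 := 𝕜) (E := E) J Φ) :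
    GroupLieAlgebra 𝓘(𝕜, E) G →ₗ[𝕜]
      Derivation 𝕜 (SmoothFunctions (𝕜 := 𝕜) J U) (SmoothFunctions (𝕜 := 𝕜) J U) where
  toFun X := Derivation.mk'
    { toFun := flowFunction hU hΦ X
      map_add' := fun F F' => by
        refine SmoothFunctions.ext fun p => ?_
        change _ = (flowFunction hU hΦ X F).1 p + (flowFunction hU hΦ X F').1 p
        by_cases hp : p ∈ U
        · simp only [flowFunction_apply hU hΦ X _ hp]
          exact dirDeriv_add
            ((hΦ.contMDiffAt_orbit (contMDiffAt_of_mem hU F hp)).mdifferentiableAt (by simp))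
            ((hΦ.contMDiffAt_orbit (contMDiffAt_of_mem hU F' hp)).mdifferentiableAt (by simp)) X
        · simp only [flowFunction_apply_notMem hU hΦ X _ hp, add_zero]
      map_smul' := fun c F => by
        refine SmoothFunctions.ext fun p => ?_
        change _ = c * (flowFunction hU hΦ X F).1 p
        by_cases hp : p ∈ U
        · simp only [flowFunction_apply hU hΦ X _ hp]
          exact dirDeriv_const_mul
            ((hΦ.contMDiffAt_orbit (contMDiffAt_of_mem hU F hp)).mdifferentiableAt (by simp)) c X
        · simp only [flowFunction_apply_notMem hU hΦ X _ hp, mul_zero] }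
    fun F F' => by
      refine SmoothFunctions.ext fun p => ?_
      change (flowFunction hU hΦ X (F * F')).1 p =
        F.1 p * (flowFunction hU hΦ X F').1 p + F'.1 p * (flowFunction hU hΦ X F).1 p
      by_cases hp : p ∈ U
      · have := dirDeriv_mul
          ((hΦ.contMDiffAt_orbit (contMDiffAt_of_mem hU F hp)).mdifferentiableAt (by simp))
          ((hΦ.contMDiffAt_orbit (contMDiffAt_of_mem hU F' hp)).mdifferentiableAt (by simp)) X
        simp only [hΦ.one] at this
        simp only [flowFunction_apply hU hΦ X _ hp]
        exact this
      · simp only [flowFunction_apply_notMem hU hΦ X _ hp, mul_zero, add_zero]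
  map_add' X Y := Derivation.ext fun F => SmoothFunctions.ext fun p => by
    change (flowFunction hU hΦ (X + Y) F).1 p =
      (flowFunction hU hΦ X F).1 p + (flowFunction hU hΦ Y F).1 p
    by_cases hp : p ∈ U
    · simp only [flowFunction_apply hU hΦ _ _ hp]
      exact dirDeriv_add_right _ _ X Y
    · simp only [flowFunction_apply_notMem hU hΦ _ _ hp, add_zero]
  map_smul' c X := Derivation.ext fun F => SmoothFunctions.ext fun p => by
    change (flowFunction hU hΦ (c • X) F).1 p = c * (flowFunction hU hΦ X F).1 p
    by_cases hp : p ∈ U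
    · simp only [flowFunction_apply hU hΦ _ _ hp]
      exact dirDeriv_smul_right _ _ c X
    · simp only [flowFunction_apply_notMem hU hΦ _ _ hp, mul_zero]

theorem flowDerivation_apply (hU : IsOpen U) (hΦ : IsFlow (𝕜 := 𝕜) (E := E) J Φ)
    (X : GroupLieAlgebra 𝓘(𝕜, E) G) (F : SmoothFunctions (𝕜 := 𝕜) J U) {p : P} (hp : p ∈ U) :
    (flowDerivation hU hΦ X F).1 p = dirDeriv (fun h : G => F.1 (Φ h p)) 1 X :=
  flowFunction_apply hU hΦ X F hp

theorem flowDerivation_apply_notMem (hU : IsOpen U) (hΦ : IsFlow (𝕜 := 𝕜) (E := E) J Φ)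
    (X : GroupLieAlgebra 𝓘(𝕜, E) G) (F : SmoothFunctions (𝕜 := 𝕜) J U) {p : P} (hp : p ∉ U) :
    (flowDerivation hU hΦ X F).1 p = 0 :=
  flowFunction_apply_notMem hU hΦ X F hp

theorem flowDerivation_flowDerivation (hU : IsOpen U) (hΦ : IsFlow (𝕜 := 𝕜) (E := E) J Φ)
    (hΨ : IsFlow (𝕜 := 𝕜) (E := E) J Ψ)
    (X Y : GroupLieAlgebra 𝓘(𝕜, E) G) (F : SmoothFunctions (𝕜 := 𝕜) J U) {p : P} (hp : p ∈ U) :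
    (flowDerivation hU hΦ X (flowDerivation hU hΨ Y F)).1 p =
      dirDeriv (fun h : G => dirDeriv (fun k : G => F.1 (Ψ k (Φ h p))) 1 Y) 1 X := by
  rw [flowDerivation_apply hU hΦ _ _ hp]
  exact PLCDYBE.dirDeriv_congr ((hΦ.eventually_mem hU hp).mono fun h hh =>
    flowDerivation_apply hU hΨ Y F hh) X

theorem flowDerivation_lie_apply_notMem (hU : IsOpen U) (hΦ : IsFlow (𝕜 := 𝕜) (E := E) J Φ)
    (hΨ : IsFlow (𝕜 := 𝕜) (E := E) J Ψ) (X Y : GroupLieAlgebra 𝓘(𝕜, E) G)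
    (F : SmoothFunctions (𝕜 := 𝕜) J U) {p : P} (hp : p ∉ U) :
    (⁅flowDerivation hU hΦ X, flowDerivation hU hΨ Y⁆ F).1 p = 0 := by
  rw [Derivation.commutator_apply]
  change (flowDerivation hU hΦ X _).1 p - (flowDerivation hU hΨ Y _).1 p = 0
  rw [flowDerivation_apply_notMem hU hΦ X _ hp, flowDerivation_apply_notMem hU hΨ Y _ hp, sub_zero]

/-- For commuting flows the commutator is the difference of the two mixed derivatives of one
function of two group variables. -/
theorem flowDerivation_lie_of_commute (hU : IsOpen U) (hΦ : IsFlow (𝕜 := 𝕜) (E := E) J Φ)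
    (hΨ : IsFlow (𝕜 := 𝕜) (E := E) J Ψ) (hc : ∀ h k p, Ψ k (Φ h p) = Φ h (Ψ k p))
    (X Y : GroupLieAlgebra 𝓘(𝕜, E) G) :
    ⁅flowDerivation hU hΦ X, flowDerivation hU hΨ Y⁆ = 0 := by
  refine derivation_ext_of_mem (fun F p hp => ?_) fun F p hp =>
    flowDerivation_lie_apply_notMem hU hΦ hΨ X Y F hp
  rw [Derivation.commutator_apply]
  change (flowDerivation hU hΦ X _).1 p - (flowDerivation hU hΨ Y _).1 p = 0
  rw [flowDerivation_flowDerivation hU hΦ hΨ X Y F hp,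
    flowDerivation_flowDerivation hU hΨ hΦ Y X F hp, sub_eq_zero]
  simp only [← hc]
  refine dirDeriv_comm (θ := fun h k : G => F.1 (Ψ k (Φ h p))) ?_ X Y
  refine ContMDiffAt.comp (I' := J) (g := F.1) (1, 1)
    (by simpa only [hΦ.one, hΨ.one] using contMDiffAt_of_mem hU F hp) ?_
  exact (hΨ.smooth.comp (((hΦ.contMDiff_orbit p).comp contMDiff_fst).prodMk
    contMDiff_snd)).contMDiffAt

theorem flowDerivation_eq_zero (hU : IsOpen U) (hΦ : IsFlow (𝕜 := 𝕜) (E := E) J Φ)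
    (X : GroupLieAlgebra 𝓘(𝕜, E) G) {F : SmoothFunctions (𝕜 := 𝕜) J U}
    (h : ∀ p ∈ U, ∀ k : G, Φ k p ∈ U → F.1 (Φ k p) = F.1 p) :
    flowDerivation hU hΦ X F = 0 := by
  refine SmoothFunctions.ext fun p => ?_
  by_cases hp : p ∈ U
  · rw [flowDerivation_apply hU hΦ X F hp, PLCDYBE.dirDeriv_congr
      ((hΦ.eventually_mem hU hp).mono fun k hk => h p hp k hk)]
    exact dirDeriv_const _ _ _
  · exact flowDerivation_apply_notMem hU hΦ X F hp

variable [CompleteSpace E]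

/-- The iterated derivative is that of the orbit function at `h * k`, with the first derivation in
`h`, so `dirDeriv_mul_sub` applies directly. -/
theorem flowDerivation_lie_of_right_action (hU : IsOpen U) (hΦ : IsFlow (𝕜 := 𝕜) (E := E) J Φ)
    (hm : ∀ h k p, Φ k (Φ h p) = Φ (h * k) p) (X Y : GroupLieAlgebra 𝓘(𝕜, E) G) :
    ⁅flowDerivation hU hΦ X, flowDerivation hU hΦ Y⁆ = flowDerivation hU hΦ ⁅X, Y⁆ := by
  refine derivation_ext_of_mem (fun F p hp => ?_) fun F p hp => ?_
  · rw [Derivation.commutator_apply]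
    change (flowDerivation hU hΦ X _).1 p - (flowDerivation hU hΦ Y _).1 p = _
    rw [flowDerivation_flowDerivation hU hΦ hΦ X Y F hp,
      flowDerivation_flowDerivation hU hΦ hΦ Y X F hp, flowDerivation_apply hU hΦ _ _ hp]
    simp only [hm]
    exact dirDeriv_mul_sub (f := fun h => F.1 (Φ h p))
      (hΦ.contMDiffAt_orbit (contMDiffAt_of_mem hU F hp)) X Y
  · rw [flowDerivation_lie_apply_notMem hU hΦ hΦ X Y F hp, flowDerivation_apply_notMem hU hΦ _ _ hp]

/-- For a left action the product is `k * h`; exchanging the order of differentiation reduces to the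
previous situation and produces the sign. -/
theorem flowDerivation_lie_of_left_action (hU : IsOpen U) (hΦ : IsFlow (𝕜 := 𝕜) (E := E) J Φ)
    (hm : ∀ h k p, Φ k (Φ h p) = Φ (k * h) p) (X Y : GroupLieAlgebra 𝓘(𝕜, E) G) :
    ⁅flowDerivation hU hΦ X, flowDerivation hU hΦ Y⁆ = -flowDerivation hU hΦ ⁅X, Y⁆ := by
  refine derivation_ext_of_mem (fun F p hp => ?_) fun F p hp => ?_
  · have hF := contMDiffAt_of_mem hU F hp
    have hcomm (X Y : GroupLieAlgebra 𝓘(𝕜, E) G) :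
        dirDeriv (fun h : G => dirDeriv (fun k : G => F.1 (Φ (k * h) p)) 1 Y) 1 X =
          dirDeriv (fun k : G => dirDeriv (fun h : G => F.1 (Φ (k * h) p)) 1 X) 1 Y := by
      refine dirDeriv_comm (θ := fun h k : G => F.1 (Φ (k * h) p)) ?_ X Y
      refine ContMDiffAt.comp (I' := J) (g := F.1) (1, 1)
        (by simpa only [mul_one, hΦ.one] using hF) ?_
      exact ((hΦ.contMDiff_orbit p).comp (contMDiff_snd.mul contMDiff_fst)).contMDiffAt
    rw [Derivation.commutator_apply]
    change (flowDerivation hU hΦ X _).1 p - (flowDerivation hU hΦ Y _).1 p =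
      -(flowDerivation hU hΦ ⁅X, Y⁆ F).1 p
    rw [flowDerivation_flowDerivation hU hΦ hΦ X Y F hp,
      flowDerivation_flowDerivation hU hΦ hΦ Y X F hp, flowDerivation_apply hU hΦ _ _ hp]
    simp only [hm]
    rw [hcomm X Y, hcomm Y X, ← dirDeriv_mul_sub (f := fun h => F.1 (Φ h p))
      (hΦ.contMDiffAt_orbit hF) X Y, neg_sub]
  · rw [flowDerivation_lie_apply_notMem hU hΦ hΦ X Y F hp]
    change 0 = -(flowDerivation hU hΦ ⁅X, Y⁆ F).1 p
    rw [flowDerivation_apply_notMem hU hΦ _ _ hp, neg_zero]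

end Flows

/-! ### The bracket at a point -/

section Pointwise

variable {𝕜 : Type*} [RCLike 𝕜] {L : Type*} [LieRing L] [LieAlgebra 𝕜 L]
  {ι : Type*} [Fintype ι]

theorem contract_add (t t' : L ⊗[𝕜] L) (α β : L →ₗ[𝕜] 𝕜) :
    contract (t + t') α β = contract t α β + contract t' α β :=
  map_add _ t t'

theorem contract_sub (t t' : L ⊗[𝕜] L) (α β : L →ₗ[𝕜] 𝕜) :
    contract (t - t') α β = contract t α β - contract t' α β :=
  map_sub _ t t'

theorem contract_smul (c : 𝕜) (t : L ⊗[𝕜] L) (α β : L →ₗ[𝕜] 𝕜) :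
    contract (c • t) α β = c * contract t α β :=
  map_smul _ c t

theorem contract_sum {κ : Type*} (s : Finset κ) (t : κ → L ⊗[𝕜] L) (α β : L →ₗ[𝕜] 𝕜) :
    contract (∑ i ∈ s, t i) α β = ∑ i ∈ s, contract (t i) α β :=
  map_sum (TensorProduct.lift ((LinearMap.mul 𝕜 𝕜).compl₁₂ α β)) t s

theorem contract_add_left (t : L ⊗[𝕜] L) (α α' β : L →ₗ[𝕜] 𝕜) :
    contract t (α + α') β = contract t α β + contract t α' β := by
  induction t with
  | zero => simp [contract]
  | tmul a b => simp only [contract_tmul, LinearMap.add_apply, add_mul]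
  | add t t' h h' => rw [contract_add, contract_add, contract_add, h, h']; ring

theorem contract_comm (t : L ⊗[𝕜] L) (α β : L →ₗ[𝕜] 𝕜) :
    contract (TensorProduct.comm 𝕜 L L t) α β = contract t β α := by
  induction t with
  | zero => simp [contract]
  | tmul a b => rw [TensorProduct.comm_tmul, contract_tmul, contract_tmul, mul_comm]
  | add t t' h h' => rw [map_add, contract_add, contract_add, h, h']

theorem contract_add_right (t : L ⊗[𝕜] L) (α β β' : L →ₗ[𝕜] 𝕜) :
    contract t α (β + β') = contract t α β + contract t α β' := by
  rw [← contract_comm, contract_add_left, contract_comm, contract_comm]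

theorem contract_neg_left (t : L ⊗[𝕜] L) (α β : L →ₗ[𝕜] 𝕜) :
    contract t (-α) β = -contract t α β := by
  have h1 := contract_add_left t (-α) α β
  have h2 := contract_add_left t 0 0 β
  rw [add_zero] at h2
  rw [neg_add_cancel] at h1
  linear_combination -h1 - h2

theorem contract_neg_right (t : L ⊗[𝕜] L) (α β : L →ₗ[𝕜] 𝕜) :
    contract t α (-β) = -contract t α β := by
  rw [← contract_comm, contract_neg_left, contract_comm]

theorem IsAntisymm₂.contract_swap {t : L ⊗[𝕜] L} (h : IsAntisymm₂ t) (α β : L →ₗ[𝕜] 𝕜) :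
    contract t β α = -contract t α β := by
  rw [← contract_comm, h]
  exact map_neg _ t

theorem contract_casimir (T T' : ι → L) (α β : L →ₗ[𝕜] 𝕜) :
    contract (casimir (𝕜 := 𝕜) T T') α β = ∑ a, α (T a) * β (T' a) := by
  simp only [casimir, contract_sum, contract_tmul]

theorem IsCasimirPair.contract_swap {T T' : ι → L} (h : IsCasimirPair 𝕜 T T')
    (α β : L →ₗ[𝕜] 𝕜) :
    contract (casimir (𝕜 := 𝕜) T T') β α = contract (casimir (𝕜 := 𝕜) T T') α β := by
  rw [← contract_comm]
  congr 1
  simp only [casimir, map_sum, TensorProduct.comm_tmul]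
  exact h.symm.symm

/-- The bracket of functions of `Ω` and the left half of the bracket of functions of `g`, in terms
of the differentials. -/
def halfPoisson (T T' : ι → L) (r t : L ⊗[𝕜] L) (lF ρF mF lH ρH mH : L →ₗ[𝕜] 𝕜) : 𝕜 :=
  contract (r + t) mF mH +
    stsTerm r (r + (1 / 2 : 𝕜) • casimir (𝕜 := 𝕜) T T') (r - (1 / 2 : 𝕜) • casimir (𝕜 := 𝕜) T T')
      lF ρF lH ρH +
    (contract (r + (1 / 2 : 𝕜) • casimir (𝕜 := 𝕜) T T') lF mH -
      contract (r - (1 / 2 : 𝕜) • casimir (𝕜 := 𝕜) T T') ρF mH) -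
    (contract (r + (1 / 2 : 𝕜) • casimir (𝕜 := 𝕜) T T') lH mF -
      contract (r - (1 / 2 : 𝕜) • casimir (𝕜 := 𝕜) T T') ρH mF)

variable {A : Type*} [CommRing A] [Algebra 𝕜 A]

theorem casimirBracket_apply (T T' : ι → L) (ε : A →ₐ[𝕜] 𝕜) (x y : L →ₗ[𝕜] Derivation 𝕜 A A)
    (F H : A) :
    ε (casimirBracket T T' x y F H) =
      contract (casimir (𝕜 := 𝕜) T T') (ε.toLinearMap ∘ₗ formAt x F) (ε.toLinearMap ∘ₗ formAt y H) -
      contract (casimir (𝕜 := 𝕜) T T') (ε.toLinearMap ∘ₗ formAt x H)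
        (ε.toLinearMap ∘ₗ formAt y F) := by
  simp only [casimirBracket, LinearMap.sum_apply, wedge_apply, map_sum, map_sub, map_mul,
    contract_casimir, ← Finset.sum_sub_distrib, LinearMap.comp_apply, formAt_apply,
    AlgHom.toLinearMap_apply]
  exact Finset.sum_congr rfl fun a _ => by ring

theorem tensorBracket_apply (T : Module.Basis ι 𝕜 L) (ε : A →ₐ[𝕜] 𝕜) {c : ι → ι → A} {t : L ⊗[𝕜] L}
    (ht : IsAntisymm₂ t) (hc : ∀ i j, ε (c i j) = (T.tensorProduct T).repr t (i, j))
    (x : L →ₗ[𝕜] Derivation 𝕜 A A) (F H : A) :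
    ε (tensorBracket T c x F H) =
      2 * contract t (ε.toLinearMap ∘ₗ formAt x F) (ε.toLinearMap ∘ₗ formAt x H) := by
  have h1 : ε (tensorBracket T c x F H) =
      contract t (ε.toLinearMap ∘ₗ formAt x F) (ε.toLinearMap ∘ₗ formAt x H) -
      contract t (ε.toLinearMap ∘ₗ formAt x H) (ε.toLinearMap ∘ₗ formAt x F) := by
    rw [← sum_repr_tensor T t]
    simp only [tensorBracket, LinearMap.sum_apply, wedge_apply, map_sum, map_sub, map_mul,
      contract_sum, contract_smul, contract_tmul, ← Finset.sum_sub_distrib, LinearMap.comp_apply,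
      formAt_apply, AlgHom.toLinearMap_apply, Derivation.smul_apply, smul_eq_mul, hc]
    exact Finset.sum_congr rfl fun a _ => Finset.sum_congr rfl fun b _ => by ring
  rw [h1, ht.contract_swap]
  ring

theorem halfBracket_apply {T T' : Module.Basis ι 𝕜 L} (hT : IsCasimirPair 𝕜 T T')
    (ε : A →ₐ[𝕜] 𝕜) {c : ι → ι → A} {r t : L ⊗[𝕜] L} (hr : IsAntisymm₂ r) (ht : IsAntisymm₂ t)
    (hc : ∀ i j, ε (c i j) = (T.tensorProduct T).repr t (i, j))
    (l ρ m : L →ₗ[𝕜] Derivation 𝕜 A A) (F H : A) :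
    ε (halfBracket T T' (fun i j => (T.tensorProduct T).repr r (i, j)) l ρ m c F H) =
      halfPoisson T T' r t (ε.toLinearMap ∘ₗ formAt l F) (ε.toLinearMap ∘ₗ formAt ρ F)
        (ε.toLinearMap ∘ₗ formAt m F) (ε.toLinearMap ∘ₗ formAt l H)
        (ε.toLinearMap ∘ₗ formAt ρ H) (ε.toLinearMap ∘ₗ formAt m H) := by
  have e1 (F : A) : ε.toLinearMap ∘ₗ formAt (l - ρ + m) F = ε.toLinearMap ∘ₗ formAt l F +
      -(ε.toLinearMap ∘ₗ formAt ρ F) + ε.toLinearMap ∘ₗ formAt m F := by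
    ext X
    simp [formAt_apply, sub_eq_add_neg]
  have e2 (F : A) : ε.toLinearMap ∘ₗ formAt (l + ρ) F = ε.toLinearMap ∘ₗ formAt l F +
      ε.toLinearMap ∘ₗ formAt ρ F := by
    ext X
    simp [formAt_apply]
  simp only [halfBracket, LinearMap.smul_apply, LinearMap.add_apply, map_smul, map_add,
    casimirBracket_apply, tensorBracket_apply T ε ht hc]
  rw [tensorBracket_apply T ε (c := fun i j => algebraMap 𝕜 A ((T.tensorProduct T).repr r (i, j)))
    hr
    fun i j => ε.commutes _]
  simp only [halfPoisson, stsTerm, e1, e2, contract_add, contract_sub, contract_smul,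
    contract_add_left, contract_add_right, contract_neg_left, contract_neg_right, smul_eq_mul]
  generalize ε.toLinearMap ∘ₗ formAt l F = a
  generalize ε.toLinearMap ∘ₗ formAt ρ F = b
  generalize ε.toLinearMap ∘ₗ formAt m F = d
  generalize ε.toLinearMap ∘ₗ formAt l H = a'
  generalize ε.toLinearMap ∘ₗ formAt ρ H = b'
  generalize ε.toLinearMap ∘ₗ formAt m H = d'
  -- The mixed terms differ by the order of arguments only: `r` is antisymmetric and the Casimir
  -- tensor symmetric.
  linear_combination hr.contract_swap a' d - hr.contract_swap b' d
    - (1 / 2 : 𝕜) * hT.contract_swap a b'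

/-- The Schouten square of the bracket at a point. -/
theorem schouten_halfBracket_apply {T T' : Module.Basis ι 𝕜 L}
    (hT : IsCasimirPair 𝕜 T T') (ε : A →ₐ[𝕜] 𝕜) {c : ι → ι → A} {r t : L ⊗[𝕜] L}
    {l ρ m : L →ₗ[𝕜] Derivation 𝕜 A A} (h : IsDynamicalFamily T T' l ρ m c)
    (hr : IsAntisymm₂ r) (hyb : ModifiedCYBE T T' r)
    (hc : ∀ i j, ε (c i j) = (T.tensorProduct T).repr t (i, j)) (F H K : A) :
    ε (schouten (halfBracket T T' (fun i j => (T.tensorProduct T).repr r (i, j)) l ρ m c)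
        (halfBracket T T' (fun i j => (T.tensorProduct T).repr r (i, j)) l ρ m c) F H K) =
      (1 / 3) * altEval (ε.toLinearMap ∘ₗ formAt m F) (ε.toLinearMap ∘ₗ formAt m H)
        (ε.toLinearMap ∘ₗ formAt m K) (cyclicSum (bracket1213 t t + (1 / 2 : 𝕜) • ∑ a,
          TensorProduct.assoc 𝕜 _ _ _
            ((∑ i, ∑ j, ε ((l + ρ) (T a) (c i j)) • (T i ⊗ₜ[𝕜] T j)) ⊗ₜ[𝕜] T' a))) -
      (1 / 12) * altEval (ε.toLinearMap ∘ₗ formAt m F) (ε.toLinearMap ∘ₗ formAt m H)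
        (ε.toLinearMap ∘ₗ formAt m K) (structureTensor T T') := by
  have h1 := yangBaxter_apply (T := T) ε (d := fun i j => (T.tensorProduct T).repr t (i, j)) hc m
    F H K
  have h2 := sum_smul_alt_apply (T := T) (T' := T') ε (c := fun a i j => (l + ρ) (T a) (c i j))
    (d := fun a i j => ε ((l + ρ) (T a) (c i j))) (fun a i j => rfl) m F H K
  have h3 := congrArg ε (cartan_apply (T := T) (T' := T') m F H K)
  rw [sum_repr_tensor] at h1
  rw [altEval_algHom] at h3
  rw [h.schouten_halfBracket hT (fun i j => hr.repr T i j) (hyb.yangBaxter_eq T T' _)]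
  simp only [Pi.add_apply, Pi.sub_apply, Pi.smul_apply, map_add, map_sub, map_smul, h1, h2, h3,
    altEval_cyclicSum, smul_eq_mul]
  ring

end Pointwise

/-! ### The derivations belonging to a group-valued variable -/

section GroupVariable

open Set Filter Topology

variable {𝕜 : Type*} [RCLike 𝕜] {E : Type*} [NormedAddCommGroup E] [NormedSpace 𝕜 E]
  {V : Type*} [NormedAddCommGroup V] [NormedSpace 𝕜 V] {H : Type*} [TopologicalSpace H]
  {J : ModelWithCorners 𝕜 V H} {P : Type*} [TopologicalSpace P] [ChartedSpace H P] {U : Set P}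

/-- Evaluation at a point. -/
def evalAt (J : ModelWithCorners 𝕜 V H) (U : Set P) (p : P) :
    SmoothFunctions (𝕜 := 𝕜) J U →ₐ[𝕜] 𝕜 :=
  (Pi.evalAlgHom 𝕜 (fun _ => 𝕜) p).comp (smoothFunctions (𝕜 := 𝕜) J U).val

variable {G : Type*} [TopologicalSpace G] [ChartedSpace E G] [Group G] [LieGroup 𝓘(𝕜, E) ∞ G]
  [IsManifold J ∞ P] {Φ Ψ : G → P → P}

theorem evalAt_flowDerivation (hU : IsOpen U) (hΦ : IsFlow (𝕜 := 𝕜) (E := E) J Φ)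
    (X : GroupLieAlgebra 𝓘(𝕜, E) G) (F : SmoothFunctions (𝕜 := 𝕜) J U) {p : P} (hp : p ∈ U) :
    evalAt J U p (flowDerivation hU hΦ X F) = dirDeriv (fun h : G => F.1 (Φ h p)) 1 X :=
  flowDerivation_apply hU hΦ X F hp

theorem evalAt_flowDerivation_notMem (hU : IsOpen U) (hΦ : IsFlow (𝕜 := 𝕜) (E := E) J Φ)
    (X : GroupLieAlgebra 𝓘(𝕜, E) G) (F : SmoothFunctions (𝕜 := 𝕜) J U) {p : P} (hp : p ∉ U) :
    evalAt J U p (flowDerivation hU hΦ X F) = 0 :=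
  flowDerivation_apply_notMem hU hΦ X F hp

theorem Ad_surjective [FiniteDimensional 𝕜 E] (q : G) :
    Function.Surjective (Ad (E := E) 𝕜 q) := fun X =>
  ⟨Ad 𝕜 q⁻¹ X, by rw [← Ad_mul, mul_inv_cancel, Ad_one]⟩

variable [CompleteSpace E]

theorem evalAt_formAt_notMem (hU : IsOpen U) (hΦ : IsFlow (𝕜 := 𝕜) (E := E) J Φ)
    (F : SmoothFunctions (𝕜 := 𝕜) J U) {p : P} (hp : p ∉ U) :
    (evalAt J U p).toLinearMap ∘ₗ formAt (flowDerivation hU hΦ) F = 0 :=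
  LinearMap.ext fun X => evalAt_flowDerivation_notMem hU hΦ X F hp

/-- Right multiplication of `x` by `h` is left multiplication by `x * h * x⁻¹`, so at one point the
two differentials differ by `Ad x`. This compares `ρ` with `l`, and the right with the left
derivatives in `g`. -/
theorem evalAt_formAt_conj (hU : IsOpen U) (hΦ : IsFlow (𝕜 := 𝕜) (E := E) J Φ)
    (hΨ : IsFlow (𝕜 := 𝕜) (E := E) J Ψ) (F : SmoothFunctions (𝕜 := 𝕜) J U) {p : P} (hp : p ∈ U)
    {x : G} (hx : ∀ h, Ψ h p = Φ (x * h * x⁻¹) p) :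
    (evalAt J U p).toLinearMap ∘ₗ formAt (flowDerivation hU hΨ) F =
      ((evalAt J U p).toLinearMap ∘ₗ formAt (flowDerivation hU hΦ) F) ∘ₗ Ad 𝕜 x :=
  LinearMap.ext fun X => by
    change evalAt J U p (flowDerivation hU hΨ X F) =
      evalAt J U p (flowDerivation hU hΦ (Ad 𝕜 x X) F)
    rw [evalAt_flowDerivation hU hΨ X F hp, evalAt_flowDerivation hU hΦ _ F hp]
    exact hΦ.dirDeriv_conj (contMDiffAt_of_mem hU F hp) hx X

variable [FiniteDimensional 𝕜 E]

variable {ι : Type*} [Fintype ι]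

theorem dirDeriv_bilin_Ad (T : Module.Basis ι 𝕜 (GroupLieAlgebra 𝓘(𝕜, E) G))
    (φ : LinearMap.BilinForm 𝕜 (GroupLieAlgebra 𝓘(𝕜, E) G))
    (X Y Z : GroupLieAlgebra 𝓘(𝕜, E) G) :
    MDifferentiableAt 𝓘(𝕜, E) 𝓘(𝕜, 𝕜) (fun h : G => φ (Ad 𝕜 h Y) (Ad 𝕜 h Z)) 1 ∧
    dirDeriv (fun h : G => φ (Ad 𝕜 h Y) (Ad 𝕜 h Z)) 1 X = φ ⁅X, Y⁆ Z + φ Y ⁅X, Z⁆ := by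
  have hexp (A C : GroupLieAlgebra 𝓘(𝕜, E) G) : φ A C = ∑ i, T.coord i A * φ (T i) C := by
    conv_lhs => rw [← T.sum_repr A]
    simp only [map_sum, map_smul, LinearMap.sum_apply, LinearMap.smul_apply, smul_eq_mul,
      Module.Basis.coord_apply]
  have h1 (ℓ : GroupLieAlgebra 𝓘(𝕜, E) G →ₗ[𝕜] 𝕜) (Y : GroupLieAlgebra 𝓘(𝕜, E) G) :
      MDifferentiableAt 𝓘(𝕜, E) 𝓘(𝕜, 𝕜) (fun h : G => ℓ (Ad 𝕜 h Y)) 1 :=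
    (contMDiff_Ad ℓ Y).mdifferentiableAt (by simp)
  have h2 (i : ι) : MDifferentiableAt 𝓘(𝕜, E) 𝓘(𝕜, 𝕜)
      (fun h : G => T.coord i (Ad 𝕜 h Y) * φ (T i) (Ad 𝕜 h Z)) 1 :=
    (h1 _ _).mul (h1 _ _)
  have h3 : (fun h : G => φ (Ad 𝕜 h Y) (Ad 𝕜 h Z)) =
      fun h => ∑ i, T.coord i (Ad 𝕜 h Y) * φ (T i) (Ad 𝕜 h Z) :=
    funext fun h => hexp _ _
  rw [h3]
  refine ⟨mdifferentiableAt_sum _ fun i _ => h2 i, ?_⟩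
  rw [dirDeriv_sum _ fun i _ => h2 i, hexp ⁅X, Y⁆, hexp Y, ← Finset.sum_add_distrib]
  refine Finset.sum_congr rfl fun i _ => ?_
  rw [dirDeriv_mul (h1 _ _) (h1 _ _), dirDeriv_Ad_one, dirDeriv_Ad_one, Ad_one, Ad_one]
  ring

/-- Contract `R (h * Ω * h⁻¹)` with `φ` and differentiate at `h = 1` in two ways: through the
argument, and through the adjoint action provided by equivariance. -/
theorem IsEquivariantOn.infinitesimal {T : Module.Basis ι 𝕜 (GroupLieAlgebra 𝓘(𝕜, E) G)}
    {R : G → GroupLieAlgebra 𝓘(𝕜, E) G ⊗[𝕜] GroupLieAlgebra 𝓘(𝕜, E) G} {s : Set G}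
    (hs : IsOpen s) (hR : IsEquivariantOn R s) (hR' : IsSmoothTensorOn T R s) {Ω : G} (hΩ : Ω ∈ s)
    (φ : LinearMap.BilinForm 𝕜 (GroupLieAlgebra 𝓘(𝕜, E) G)) (X : GroupLieAlgebra 𝓘(𝕜, E) G) :
    ∑ i, ∑ j, (dirDeriv (fun h : G => (T.tensorProduct T).repr (R (h * Ω)) (i, j)) 1 X -
        dirDeriv (fun h : G => (T.tensorProduct T).repr (R (Ω * h)) (i, j)) 1 X) * φ (T i) (T j) =
      ∑ i, ∑ j, (T.tensorProduct T).repr (R Ω) (i, j) *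
        (φ ⁅X, T i⁆ (T j) + φ (T i) ⁅X, T j⁆) := by
  have hexp (t : GroupLieAlgebra 𝓘(𝕜, E) G ⊗[𝕜] GroupLieAlgebra 𝓘(𝕜, E) G)
      (φ : LinearMap.BilinForm 𝕜 (GroupLieAlgebra 𝓘(𝕜, E) G)) :
      ∑ i, ∑ j, φ (T i) (T j) * (T.tensorProduct T).repr t (i, j) = TensorProduct.lift φ t := by
    conv_rhs => rw [← sum_repr_tensor T t]
    simp only [map_sum, map_smul, TensorProduct.lift.tmul, smul_eq_mul]
    exact Finset.sum_congr rfl fun i _ => Finset.sum_congr rfl fun j _ => mul_comm _ _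
  have hsm (i j : ι) : ContMDiffAt 𝓘(𝕜, E) 𝓘(𝕜, 𝕜) ∞
      (fun y => (T.tensorProduct T).repr (R y) (i, j)) Ω := (hR' i j).contMDiffAt (hs.mem_nhds hΩ)
  have hsm' (i j : ι) : MDifferentiableAt 𝓘(𝕜, E) 𝓘(𝕜, 𝕜)
      (fun h : G => φ (T i) (T j) * (T.tensorProduct T).repr (R (h * Ω * h⁻¹)) (i, j)) 1 := by
    refine ContMDiffAt.mdifferentiableAt (n := ∞) (contMDiffAt_const.mul ?_) (by simp)
    refine ContMDiffAt.comp (I' := 𝓘(𝕜, E))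
      (g := fun y => (T.tensorProduct T).repr (R y) (i, j)) 1 (by simpa using hsm i j) ?_
    exact (contMDiffAt_id.mul contMDiffAt_const).mul contMDiffAt_id.inv
  have hsm'' (i j : ι) : MDifferentiableAt 𝓘(𝕜, E) 𝓘(𝕜, 𝕜)
      (fun h : G => (T.tensorProduct T).repr (R (h * Ω * h⁻¹)) (i, j)) 1 := by
    refine ContMDiffAt.mdifferentiableAt (n := ∞) ?_ (by simp)
    refine ContMDiffAt.comp (I' := 𝓘(𝕜, E))
      (g := fun y => (T.tensorProduct T).repr (R y) (i, j)) 1 (by simpa using hsm i j) ?_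
    exact (contMDiffAt_id.mul contMDiffAt_const).mul contMDiffAt_id.inv
  have h1 : dirDeriv (fun h : G => ∑ i, ∑ j, φ (T i) (T j) *
      (T.tensorProduct T).repr (R (h * Ω * h⁻¹)) (i, j)) 1 X = ∑ i, ∑ j,
      (dirDeriv (fun h : G => (T.tensorProduct T).repr (R (h * Ω)) (i, j)) 1 X -
        dirDeriv (fun h : G => (T.tensorProduct T).repr (R (Ω * h)) (i, j)) 1 X) *
          φ (T i) (T j) := by
    rw [dirDeriv_sum _ fun i _ => mdifferentiableAt_sum _ fun j _ => hsm' i j]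
    refine Finset.sum_congr rfl fun i _ => ?_
    rw [dirDeriv_sum _ fun j _ => hsm' i j]
    refine Finset.sum_congr rfl fun j _ => ?_
    rw [dirDeriv_const_mul (hsm'' i j), mul_comm, ← dirDeriv_conj_left
      (f := fun y => (T.tensorProduct T).repr (R y) (i, j)) ((hsm i j).of_le two_le_infty)]
  have h2 (h : G) : ∑ i, ∑ j, φ (T i) (T j) *
      (T.tensorProduct T).repr (R (h * Ω * h⁻¹)) (i, j) =
      ∑ i, ∑ j, (T.tensorProduct T).repr (R Ω) (i, j) * φ (Ad 𝕜 h (T i)) (Ad 𝕜 h (T j)) := by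
    rw [hexp, hR h Ω hΩ]
    conv_lhs => rw [← sum_repr_tensor T (R Ω)]
    simp only [map_sum, map_smul, TensorProduct.map_tmul, TensorProduct.lift.tmul, smul_eq_mul]
  have h3 (i j : ι) := dirDeriv_bilin_Ad T φ X (T i) (T j)
  have h4 (i j : ι) : MDifferentiableAt 𝓘(𝕜, E) 𝓘(𝕜, 𝕜) (fun h : G =>
      (T.tensorProduct T).repr (R Ω) (i, j) * φ (Ad 𝕜 h (T i)) (Ad 𝕜 h (T j))) 1 :=
    mdifferentiableAt_const.mul (h3 i j).1
  rw [← h1]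
  simp only [h2]
  rw [dirDeriv_sum _ fun i _ => mdifferentiableAt_sum _ fun j _ => h4 i j]
  refine Finset.sum_congr rfl fun i _ => ?_
  rw [dirDeriv_sum _ fun j _ => h4 i j]
  refine Finset.sum_congr rfl fun j _ => ?_
  rw [dirDeriv_const_mul (h3 i j).1, (h3 i j).2]

/-- The components of an `L ⊗ L`-valued function of the variable `π`, extended by zero outside
`U`. -/
def tensorCoeff {T : Module.Basis ι 𝕜 (GroupLieAlgebra 𝓘(𝕜, E) G)}
    {R : G → GroupLieAlgebra 𝓘(𝕜, E) G ⊗[𝕜] GroupLieAlgebra 𝓘(𝕜, E) G} {s : Set G}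
    (hR : IsSmoothTensorOn T R s) {π : P → G} (hπ : ContMDiff J 𝓘(𝕜, E) ∞ π)
    (hπU : MapsTo π U s) (i j : ι) : SmoothFunctions (𝕜 := 𝕜) J U :=
  SmoothFunctions.mk (U.indicator fun p => (T.tensorProduct T).repr (R (π p)) (i, j))
    (contMDiffOn_indicator ((hR i j).comp hπ.contMDiffOn hπU))

/-! ### The component functions of `R` and the dynamical family of a group variable -/

section Coeff

variable {T T' : Module.Basis ι 𝕜 (GroupLieAlgebra 𝓘(𝕜, E) G)}
  {R : G → GroupLieAlgebra 𝓘(𝕜, E) G ⊗[𝕜] GroupLieAlgebra 𝓘(𝕜, E) G} {s : Set G}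
  (hR : IsSmoothTensorOn T R s) {π : P → G} (hπ : ContMDiff J 𝓘(𝕜, E) ∞ π)
  (hπU : MapsTo π U s)

theorem tensorCoeff_apply (i j : ι) {p : P} (hp : p ∈ U) :
    (tensorCoeff hR hπ hπU i j).1 p = (T.tensorProduct T).repr (R (π p)) (i, j) :=
  indicator_of_mem hp fun p => (T.tensorProduct T).repr (R (π p)) (i, j)

theorem tensorCoeff_apply_notMem (i j : ι) {p : P} (hp : p ∉ U) :
    (tensorCoeff hR hπ hπU i j).1 p = 0 :=
  indicator_of_notMem hp fun p => (T.tensorProduct T).repr (R (π p)) (i, j)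

theorem evalAt_flowDerivation_tensorCoeff (hU : IsOpen U) (hΦ : IsFlow (𝕜 := 𝕜) (E := E) J Φ)
    (X : GroupLieAlgebra 𝓘(𝕜, E) G) (i j : ι) {p : P} (hp : p ∈ U) :
    evalAt J U p (flowDerivation hU hΦ X (tensorCoeff hR hπ hπU i j)) =
      dirDeriv (fun h : G => (T.tensorProduct T).repr (R (π (Φ h p))) (i, j)) 1 X := by
  rw [evalAt_flowDerivation hU hΦ X _ hp]
  exact hΦ.dirDeriv_congr hU hp (F' := fun p => (T.tensorProduct T).repr (R (π p)) (i, j))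
    (fun q hq => tensorCoeff_apply hR hπ hπU i j hq) X

theorem flowDerivation_tensorCoeff_eq_zero (hU : IsOpen U) (hΦ : IsFlow (𝕜 := 𝕜) (E := E) J Φ)
    (h : ∀ k p, π (Φ k p) = π p) (X : GroupLieAlgebra 𝓘(𝕜, E) G) (i j : ι) :
    flowDerivation hU hΦ X (tensorCoeff hR hπ hπU i j) = 0 :=
  flowDerivation_eq_zero hU hΦ X fun p hp k hk => by
    rw [tensorCoeff_apply hR hπ hπU i j hp, tensorCoeff_apply hR hπ hπU i j hk, h]

/-- The derivations of a group-valued variable form a dynamical family. -/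
theorem isDynamicalFamily_flowDerivation [DecidableEq ι] [ConnectedSpace G]
    {B : LinearMap.BilinForm 𝕜 (GroupLieAlgebra 𝓘(𝕜, E) G)}
    (hi : ∀ X Y Z, B ⁅X, Y⁆ Z = B X ⁅Y, Z⁆)
    (hd : ∀ a b, B (T a) (T' b) = if a = b then 1 else 0)
    (hs : IsOpen s) (ha : ∀ Ω ∈ s, IsAntisymm₂ (R Ω)) (he : IsEquivariantOn R s)
    (hU : IsOpen U) (hΦ : IsFlow (𝕜 := 𝕜) (E := E) J Φ) (hΨ : IsFlow (𝕜 := 𝕜) (E := E) J Ψ)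
    (hΦΦ : ∀ h k p, Φ k (Φ h p) = Φ (k * h) p) (hΨΨ : ∀ h k p, Ψ k (Ψ h p) = Ψ (h * k) p)
    (hΦΨ : ∀ h k p, Ψ k (Φ h p) = Φ h (Ψ k p)) (hc : ∀ h p, Ψ h p = Φ (π p * h * (π p)⁻¹) p)
    (hπΦ : ∀ h p, π (Φ h p) = h * π p) (hπΨ : ∀ h p, π (Ψ h p) = π p * h)
    {m : GroupLieAlgebra 𝓘(𝕜, E) G →ₗ[𝕜]
      Derivation 𝕜 (SmoothFunctions (𝕜 := 𝕜) J U) (SmoothFunctions (𝕜 := 𝕜) J U)}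
    (hm : ∀ X Y, ⁅m X, m Y⁆ = -m ⁅X, Y⁆) (hΦm : ∀ X Y, ⁅flowDerivation hU hΦ X, m Y⁆ = 0)
    (hΨm : ∀ X Y, ⁅flowDerivation hU hΨ X, m Y⁆ = 0)
    (hmc : ∀ X i j, m X (tensorCoeff hR hπ hπU i j) = 0) :
    IsDynamicalFamily T T' (flowDerivation hU hΦ) (flowDerivation hU hΨ) m
      (tensorCoeff hR hπ hπU) where
  ll := flowDerivation_lie_of_left_action hU hΦ hΦΦ
  rr := flowDerivation_lie_of_right_action hU hΨ hΨΨ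
  lr := flowDerivation_lie_of_commute hU hΦ hΨ hΦΨ
  mm := hm
  lm := hΦm
  rm := hΨm
  casimir_eq F := by
    refine Derivation.ext fun F' => SmoothFunctions.ext fun p => ?_
    change evalAt J U p _ = evalAt J U p _
    simp only [derivation_sum_apply, Derivation.smul_apply, smul_eq_mul, map_sum, map_mul]
    by_cases hp : p ∈ U
    -- At `p`, right derivations are left ones composed with `Ad (π p)`, an isometry that fixes the
    -- Casimir tensor. The next field argues likewise with the structure tensor.
    · have h1 := sum_map_map hd (bilin_Ad_Ad B hi (π p)) (Ad_surjective (π p))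
        ((LinearMap.mul 𝕜 𝕜).compl₁₂
          ((evalAt J U p).toLinearMap ∘ₗ formAt (flowDerivation hU hΦ) F)
          ((evalAt J U p).toLinearMap ∘ₗ formAt (flowDerivation hU hΦ) F'))
      have h2 (F : SmoothFunctions (𝕜 := 𝕜) J U) (X : GroupLieAlgebra 𝓘(𝕜, E) G) :
          evalAt J U p (flowDerivation hU hΨ X F) =
            evalAt J U p (flowDerivation hU hΦ (Ad 𝕜 (π p) X) F) :=
        LinearMap.congr_fun (evalAt_formAt_conj hU hΦ hΨ F hp fun h => hc h p) X
      simp only [h2]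
      exact h1.symm
    · simp only [evalAt_flowDerivation_notMem hU _ _ _ hp]
  cartan_eq := by
    funext F F' F''
    refine SmoothFunctions.ext fun p => ?_
    change evalAt J U p _ = evalAt J U p _
    rw [cartan_apply, cartan_apply, altEval_algHom, altEval_algHom]
    by_cases hp : p ∈ U
    · rw [evalAt_formAt_conj hU hΦ hΨ F hp fun h => hc h p,
        evalAt_formAt_conj hU hΦ hΨ F' hp fun h => hc h p,
        evalAt_formAt_conj hU hΦ hΨ F'' hp fun h => hc h p, ← altEval_map,
        map_structureTensor hd (bilin_Ad_Ad B hi (π p)) (Ad_surjective (π p)) (Ad_lie (π p))]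
    · simp only [evalAt_formAt_notMem hU _ _ hp]
  m_coeff := hmc
  skew i j := SmoothFunctions.ext fun p => by
    change (tensorCoeff hR hπ hπU i j).1 p = -(tensorCoeff hR hπ hπU j i).1 p
    by_cases hp : p ∈ U
    · rw [tensorCoeff_apply hR hπ hπU i j hp, tensorCoeff_apply hR hπ hπU j i hp]
      exact (ha _ (hπU hp)).repr T i j
    · rw [tensorCoeff_apply_notMem hR hπ hπU i j hp, tensorCoeff_apply_notMem hR hπ hπU j i hp,
        neg_zero]
  equivariant X φ := SmoothFunctions.ext fun p => by
    have e1 : evalAt J U p (∑ i, ∑ j, (flowDerivation hU hΦ X (tensorCoeff hR hπ hπU i j) -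
        flowDerivation hU hΨ X (tensorCoeff hR hπ hπU i j)) * φ (T i) (T j)) =
        ∑ i, ∑ j, (evalAt J U p (flowDerivation hU hΦ X (tensorCoeff hR hπ hπU i j)) -
          evalAt J U p (flowDerivation hU hΨ X (tensorCoeff hR hπ hπU i j))) *
            evalAt J U p (φ (T i) (T j)) := by
      simp only [map_sum, map_mul, map_sub]
    have e2 : evalAt J U p (∑ i, ∑ j, tensorCoeff hR hπ hπU i j *
        (φ ⁅X, T i⁆ (T j) + φ (T i) ⁅X, T j⁆)) =
        ∑ i, ∑ j, (tensorCoeff hR hπ hπU i j).1 p *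
          (evalAt J U p (φ ⁅X, T i⁆ (T j)) + evalAt J U p (φ (T i) ⁅X, T j⁆)) := by
      simp only [map_sum, map_mul, map_add]
      rfl
    refine e1.trans (Eq.trans ?_ e2.symm)
    by_cases hp : p ∈ U
    · refine Eq.trans ?_ ((he.infinitesimal hs hR (hπU hp)
        (φ.compr₂ (evalAt J U p).toLinearMap) X).trans ?_)
      · refine Finset.sum_congr rfl fun i _ => Finset.sum_congr rfl fun j _ => ?_
        rw [evalAt_flowDerivation_tensorCoeff hR hπ hπU hU hΦ X i j hp,
          evalAt_flowDerivation_tensorCoeff hR hπ hπU hU hΨ X i j hp]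
        simp only [hπΦ, hπΨ]
        rfl
      · refine Finset.sum_congr rfl fun i _ => Finset.sum_congr rfl fun j _ => ?_
        rw [tensorCoeff_apply hR hπ hπU i j hp]
        rfl
    · refine Finset.sum_congr rfl fun i _ => Finset.sum_congr rfl fun j _ => ?_
      rw [evalAt_flowDerivation_notMem hU hΦ _ _ hp, evalAt_flowDerivation_notMem hU hΨ _ _ hp,
        tensorCoeff_apply_notMem hR hπ hπU i j hp, sub_zero, zero_mul, zero_mul]

/-- The Schouten square of the bracket of a group-valued variable. -/
theorem evalAt_schouten_halfBracket [DecidableEq ι]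
    (hT : IsCasimirPair 𝕜 T T') {r : GroupLieAlgebra 𝓘(𝕜, E) G ⊗[𝕜] GroupLieAlgebra 𝓘(𝕜, E) G}
    (hr : IsAntisymm₂ r) (hyb : ModifiedCYBE T T' r)
    (hU : IsOpen U) (hΦ : IsFlow (𝕜 := 𝕜) (E := E) J Φ) (hΨ : IsFlow (𝕜 := 𝕜) (E := E) J Ψ)
    (hπΦ : ∀ h p, π (Φ h p) = h * π p) (hπΨ : ∀ h p, π (Ψ h p) = π p * h)
    {m : GroupLieAlgebra 𝓘(𝕜, E) G →ₗ[𝕜]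
      Derivation 𝕜 (SmoothFunctions (𝕜 := 𝕜) J U) (SmoothFunctions (𝕜 := 𝕜) J U)}
    (h : IsDynamicalFamily T T' (flowDerivation hU hΦ) (flowDerivation hU hΨ) m
      (tensorCoeff hR hπ hπU)) {p : P} (hp : p ∈ U) (F F' F'' : SmoothFunctions (𝕜 := 𝕜) J U) :
    evalAt J U p (schouten
        (halfBracket T T' (fun i j => (T.tensorProduct T).repr r (i, j)) (flowDerivation hU hΦ)
          (flowDerivation hU hΨ) m (tensorCoeff hR hπ hπU))
        (halfBracket T T' (fun i j => (T.tensorProduct T).repr r (i, j)) (flowDerivation hU hΦ)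
          (flowDerivation hU hΨ) m (tensorCoeff hR hπ hπU)) F F' F'') =
      (1 / 3) * altEval ((evalAt J U p).toLinearMap ∘ₗ formAt m F)
        ((evalAt J U p).toLinearMap ∘ₗ formAt m F') ((evalAt J U p).toLinearMap ∘ₗ formAt m F'')
        (plcdybeLHS T T' R (π p)) -
      (1 / 12) * altEval ((evalAt J U p).toLinearMap ∘ₗ formAt m F)
        ((evalAt J U p).toLinearMap ∘ₗ formAt m F') ((evalAt J U p).toLinearMap ∘ₗ formAt m F'')
        (structureTensor T T') := by
  have h1 (a : ι) : ∑ i, ∑ j, evalAt J U p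
      ((flowDerivation hU hΦ + flowDerivation hU hΨ) (T a) (tensorCoeff hR hπ hπU i j)) •
        (T i ⊗ₜ[𝕜] T j) = derivPlus T R (T a) (π p) := by
    refine Finset.sum_congr rfl fun i _ => Finset.sum_congr rfl fun j _ => ?_
    congr 1
    rw [LinearMap.add_apply, Derivation.add_apply, map_add, add_comm,
      evalAt_flowDerivation_tensorCoeff hR hπ hπU hU hΦ _ _ _ hp,
      evalAt_flowDerivation_tensorCoeff hR hπ hπU hU hΨ _ _ _ hp]
    simp only [hπΦ, hπΨ]
    rfl
  rw [schouten_halfBracket_apply hT (evalAt J U p) h hr hyb (t := R (π p))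
    fun i j => tensorCoeff_apply hR hπ hπU i j hp]
  simp only [h1]
  rfl

end Coeff

end GroupVariable

/-! ### The Jacobi identity on `G × G × G` -/

section TripleProduct

open Set Filter Topology

variable {𝕜 : Type*} [RCLike 𝕜] {E : Type*} [NormedAddCommGroup E] [NormedSpace 𝕜 E]
  {G : Type*} [TopologicalSpace G] [ChartedSpace E G] [Group G]

/-- Left multiplication of `Ω^L`. -/
def actLeftL (h : G) (p : G × G × G) : G × G × G := (h * p.1, p.2.1, p.2.2)

/-- Right multiplication of `Ω^L`. -/
def actRightL (h : G) (p : G × G × G) : G × G × G := (p.1 * h, p.2.1, p.2.2)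

/-- Left multiplication of `g`. -/
def actLeftM (h : G) (p : G × G × G) : G × G × G := (p.1, h * p.2.1, p.2.2)

/-- Right multiplication of `g`. -/
def actRightM (h : G) (p : G × G × G) : G × G × G := (p.1, p.2.1 * h, p.2.2)

/-- Left multiplication of `Ω^R`. -/
def actLeftR (h : G) (p : G × G × G) : G × G × G := (p.1, p.2.1, h * p.2.2)

/-- Right multiplication of `Ω^R`. -/
def actRightR (h : G) (p : G × G × G) : G × G × G := (p.1, p.2.1, p.2.2 * h)

variable (𝕜 E) in
/-- The model with corners of `G × G × G`. -/
abbrev tripleModel : ModelWithCorners 𝕜 (E × E × E) (ModelProd E (ModelProd E E)) :=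
  𝓘(𝕜, E).prod (𝓘(𝕜, E).prod 𝓘(𝕜, E))

variable [LieGroup 𝓘(𝕜, E) ∞ G]

theorem isFlow_actLeftL : IsFlow (𝕜 := 𝕜) (E := E) (tripleModel 𝕜 E) (actLeftL (G := G)) where
  smooth := (contMDiff_snd.mul contMDiff_fst.fst).prodMk contMDiff_fst.snd
  one p := by simp [actLeftL]

theorem isFlow_actRightL : IsFlow (𝕜 := 𝕜) (E := E) (tripleModel 𝕜 E) (actRightL (G := G)) where
  smooth := (contMDiff_fst.fst.mul contMDiff_snd).prodMk contMDiff_fst.snd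
  one p := by simp [actRightL]

theorem isFlow_actLeftM : IsFlow (𝕜 := 𝕜) (E := E) (tripleModel 𝕜 E) (actLeftM (G := G)) where
  smooth := contMDiff_fst.fst.prodMk
    ((contMDiff_snd.mul contMDiff_fst.snd.fst).prodMk contMDiff_fst.snd.snd)
  one p := by simp [actLeftM]

theorem isFlow_actRightM : IsFlow (𝕜 := 𝕜) (E := E) (tripleModel 𝕜 E) (actRightM (G := G)) where
  smooth := contMDiff_fst.fst.prodMk
    ((contMDiff_fst.snd.fst.mul contMDiff_snd).prodMk contMDiff_fst.snd.snd)
  one p := by simp [actRightM]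

theorem isFlow_actLeftR : IsFlow (𝕜 := 𝕜) (E := E) (tripleModel 𝕜 E) (actLeftR (G := G)) where
  smooth := contMDiff_fst.fst.prodMk
    (contMDiff_fst.snd.fst.prodMk (contMDiff_snd.mul contMDiff_fst.snd.snd))
  one p := by simp [actLeftR]

theorem isFlow_actRightR : IsFlow (𝕜 := 𝕜) (E := E) (tripleModel 𝕜 E) (actRightR (G := G)) where
  smooth := contMDiff_fst.fst.prodMk
    (contMDiff_fst.snd.fst.prodMk (contMDiff_fst.snd.snd.mul contMDiff_snd))
  one p := by simp [actRightR]

variable [CompleteSpace E] {ι : Type*} [Fintype ι]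
  {T T' : Module.Basis ι 𝕜 (GroupLieAlgebra 𝓘(𝕜, E) G)}
  {r : GroupLieAlgebra 𝓘(𝕜, E) G ⊗[𝕜] GroupLieAlgebra 𝓘(𝕜, E) G}
  {R : G → GroupLieAlgebra 𝓘(𝕜, E) G ⊗[𝕜] GroupLieAlgebra 𝓘(𝕜, E) G} {s : Set G}
  {U : Set (G × G × G)}

/-- With minus the right derivatives in `g`, the terms quadratic in them are unchanged and the mixed
ones change sign, so all terms with `Ω^R` form the opposite of a half bracket. -/
theorem poissonBracket_eq (F H : G × G × G → 𝕜) (p : G × G × G) :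
    poissonBracket T T' r R F H p =
      halfPoisson T T' r (R p.1) (leftL F p) (rightL F p) (leftM F p) (leftL H p) (rightL H p)
        (leftM H p) -
      halfPoisson T T' r (R p.2.2) (leftR F p) (rightR F p) (-rightM F p) (leftR H p) (rightR H p)
        (-rightM H p) := by
  simp only [poissonBracket, halfPoisson, contract_neg_left, contract_neg_right, neg_neg]
  ring

theorem poissonBracket_congr (hU : IsOpen U) {F F' H H' : G × G × G → 𝕜} (hF : EqOn F F' U)
    (hH : EqOn H H' U) {p : G × G × G} (hp : p ∈ U) :
    poissonBracket T T' r R F H p = poissonBracket T T' r R F' H' p := by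
  have h1 {F F' : G × G × G → 𝕜} (hF : EqOn F F' U) :
      leftL (𝕜 := 𝕜) (E := E) F p = leftL F' p ∧ rightL (𝕜 := 𝕜) (E := E) F p = rightL F' p ∧
      leftM (𝕜 := 𝕜) (E := E) F p = leftM F' p ∧ rightM (𝕜 := 𝕜) (E := E) F p = rightM F' p ∧
      leftR (𝕜 := 𝕜) (E := E) F p = leftR F' p ∧ rightR (𝕜 := 𝕜) (E := E) F p = rightR F' p :=
    ⟨LinearMap.ext (isFlow_actLeftL.dirDeriv_congr hU hp hF),
      LinearMap.ext (isFlow_actRightL.dirDeriv_congr hU hp hF),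
      LinearMap.ext (isFlow_actLeftM.dirDeriv_congr hU hp hF),
      LinearMap.ext (isFlow_actRightM.dirDeriv_congr hU hp hF),
      LinearMap.ext (isFlow_actLeftR.dirDeriv_congr hU hp hF),
      LinearMap.ext (isFlow_actRightR.dirDeriv_congr hU hp hF)⟩
  obtain ⟨a1, a2, a3, a4, a5, a6⟩ := h1 hF
  obtain ⟨b1, b2, b3, b4, b5, b6⟩ := h1 hH
  simp only [poissonBracket, a1, a2, a3, a4, a5, a6, b1, b2, b3, b4, b5, b6]

/-- Antisymmetry holds on an open neighbourhood of `Ω`, hence passes to derivatives there. -/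
theorem isAntisymm₂_derivPlus (hs : IsOpen s) (ha : ∀ Ω ∈ s, IsAntisymm₂ (R Ω))
    (X : GroupLieAlgebra 𝓘(𝕜, E) G) {Ω : G} (hΩ : Ω ∈ s) : IsAntisymm₂ (derivPlus T R X Ω) := by
  have key (i j : ι) {f : G → G} (hf : ContinuousAt f 1) (hf' : f 1 = Ω) :
      dirDeriv (fun h : G => (T.tensorProduct T).repr (R (f h)) (i, j)) 1 X =
        -dirDeriv (fun h : G => (T.tensorProduct T).repr (R (f h)) (j, i)) 1 X := by
    rw [← dirDeriv_neg]
    refine dirDeriv_congr ?_ X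
    filter_upwards [hf.eventually_mem (hs.mem_nhds (by rwa [hf']))] with h hh
    exact (ha _ hh).repr T i j
  have h1 (i j : ι) : rightDeriv (fun y => (T.tensorProduct T).repr (R y) (i, j)) Ω X +
      leftDeriv (fun y => (T.tensorProduct T).repr (R y) (i, j)) Ω X =
      -(rightDeriv (fun y => (T.tensorProduct T).repr (R y) (j, i)) Ω X +
        leftDeriv (fun y => (T.tensorProduct T).repr (R y) (j, i)) Ω X) := by
    rw [neg_add]
    exact congrArg₂ (· + ·) (key i j (contMDiff_mul_left (I := 𝓘(𝕜, E)) (n :=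
      ∞)).continuous.continuousAt (mul_one Ω))
      (key i j (contMDiff_mul_right (I := 𝓘(𝕜, E)) (n := ∞)).continuous.continuousAt (one_mul Ω))
  simp only [IsAntisymm₂, derivPlus, derivTensor, map_sum, map_smul, TensorProduct.comm_tmul]
  rw [Finset.sum_comm]
  simp only [← Finset.sum_neg_distrib, ← neg_smul]
  refine Finset.sum_congr rfl fun i _ => Finset.sum_congr rfl fun j _ => ?_
  rw [h1]

theorem isAntisymm₃_plcdybeLHS (hs : IsOpen s) (ha : ∀ Ω ∈ s, IsAntisymm₂ (R Ω)) {Ω : G}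
    (hΩ : Ω ∈ s) : IsAntisymm₃ (𝕜 := 𝕜) (L := GroupLieAlgebra 𝓘(𝕜, E) G)
      (plcdybeLHS T T' R Ω) :=
  isAntisymm₃_cyclicSum_add (L := GroupLieAlgebra 𝓘(𝕜, E) G) (R Ω)
    (D := fun a => derivPlus T R (T a) Ω)
    (fun a => isAntisymm₂_derivPlus (T := T) hs ha (T a) hΩ) T' (1 / 2)

theorem mapsTo_first (hUs : U ⊆ domain s) : MapsTo (fun p : G × G × G => p.1) U s :=
  fun _ hp => (hUs hp).1

theorem mapsTo_third (hUs : U ⊆ domain s) : MapsTo (fun p : G × G × G => p.2.2) U s :=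
  fun _ hp => (hUs hp).2.2

theorem contMDiff_third :
    ContMDiff (tripleModel 𝕜 E) 𝓘(𝕜, E) ∞ fun p : G × G × G => p.2.2 :=
  contMDiff_snd.snd

/-- The components of `R(Ω^L)`. -/
abbrev coeffL (hR : IsSmoothTensorOn T R s) (hUs : U ⊆ domain s) :
    ι → ι → SmoothFunctions (𝕜 := 𝕜) (tripleModel 𝕜 E) U :=
  tensorCoeff hR (π := fun p : G × G × G => p.1) contMDiff_fst (mapsTo_first hUs)

/-- The components of `R(Ω^R)`. -/
abbrev coeffR (hR : IsSmoothTensorOn T R s) (hUs : U ⊆ domain s) :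
    ι → ι → SmoothFunctions (𝕜 := 𝕜) (tripleModel 𝕜 E) U :=
  tensorCoeff hR (π := fun p : G × G × G => p.2.2) contMDiff_third (mapsTo_third hUs)

/-- The part of the bracket that involves `Ω^L` and left multiplications of `g`. -/
def bracketL (T T' : Module.Basis ι 𝕜 (GroupLieAlgebra 𝓘(𝕜, E) G))
    (r : GroupLieAlgebra 𝓘(𝕜, E) G ⊗[𝕜] GroupLieAlgebra 𝓘(𝕜, E) G)
    (hR : IsSmoothTensorOn T R s) (hU : IsOpen U) (hUs : U ⊆ domain s) :
    SmoothFunctions (𝕜 := 𝕜) (tripleModel 𝕜 E) U →ₗ[𝕜]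
      SmoothFunctions (𝕜 := 𝕜) (tripleModel 𝕜 E) U →ₗ[𝕜]
        SmoothFunctions (𝕜 := 𝕜) (tripleModel 𝕜 E) U :=
  halfBracket T T' (fun i j => (T.tensorProduct T).repr r (i, j))
    (flowDerivation hU isFlow_actLeftL) (flowDerivation hU isFlow_actRightL)
    (flowDerivation hU isFlow_actLeftM) (coeffL hR hUs)

/-- The opposite of the part of the bracket that involves `Ω^R` and right multiplications of
`g`. -/
def bracketR (T T' : Module.Basis ι 𝕜 (GroupLieAlgebra 𝓘(𝕜, E) G))
    (r : GroupLieAlgebra 𝓘(𝕜, E) G ⊗[𝕜] GroupLieAlgebra 𝓘(𝕜, E) G)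
    (hR : IsSmoothTensorOn T R s) (hU : IsOpen U) (hUs : U ⊆ domain s) :
    SmoothFunctions (𝕜 := 𝕜) (tripleModel 𝕜 E) U →ₗ[𝕜]
      SmoothFunctions (𝕜 := 𝕜) (tripleModel 𝕜 E) U →ₗ[𝕜]
        SmoothFunctions (𝕜 := 𝕜) (tripleModel 𝕜 E) U :=
  halfBracket T T' (fun i j => (T.tensorProduct T).repr r (i, j))
    (flowDerivation hU isFlow_actLeftR) (flowDerivation hU isFlow_actRightR)
    (-flowDerivation hU isFlow_actRightM) (coeffR hR hUs)

/-- The bracket as a bilinear map on the functions on `U`. -/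
def bracketMap (T T' : Module.Basis ι 𝕜 (GroupLieAlgebra 𝓘(𝕜, E) G))
    (r : GroupLieAlgebra 𝓘(𝕜, E) G ⊗[𝕜] GroupLieAlgebra 𝓘(𝕜, E) G)
    (hR : IsSmoothTensorOn T R s) (hU : IsOpen U) (hUs : U ⊆ domain s) :
    SmoothFunctions (𝕜 := 𝕜) (tripleModel 𝕜 E) U →ₗ[𝕜]
      SmoothFunctions (𝕜 := 𝕜) (tripleModel 𝕜 E) U →ₗ[𝕜]
        SmoothFunctions (𝕜 := 𝕜) (tripleModel 𝕜 E) U :=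
  bracketL T T' r hR hU hUs - bracketR T T' r hR hU hUs

theorem evalAt_comp_formAt_neg (p : G × G × G)
    (x : GroupLieAlgebra 𝓘(𝕜, E) G →ₗ[𝕜] Derivation 𝕜
      (SmoothFunctions (𝕜 := 𝕜) (tripleModel 𝕜 E) U) (SmoothFunctions (𝕜 := 𝕜) (tripleModel 𝕜 E) U))
    (F : SmoothFunctions (𝕜 := 𝕜) (tripleModel 𝕜 E) U) :
    (evalAt (tripleModel 𝕜 E) U p).toLinearMap ∘ₗ formAt (-x) F =
      -((evalAt (tripleModel 𝕜 E) U p).toLinearMap ∘ₗ formAt x F) :=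
  LinearMap.ext fun X => map_neg (evalAt (tripleModel 𝕜 E) U p) (x X F)

/-! ### The flow derivations at a point as the differentials in the bracket -/

section Forms

variable (hU : IsOpen U) (F : SmoothFunctions (𝕜 := 𝕜) (tripleModel 𝕜 E) U) {p : G × G × G}

theorem evalAt_formAt_actLeftL (hp : p ∈ U) :
    (evalAt (tripleModel 𝕜 E) U p).toLinearMap ∘ₗ
    formAt (flowDerivation hU isFlow_actLeftL) F = leftL (𝕜 := 𝕜) (E := E) F.1 p :=
  LinearMap.ext fun X => evalAt_flowDerivation hU isFlow_actLeftL X F hp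

theorem evalAt_formAt_actRightL (hp : p ∈ U) :
    (evalAt (tripleModel 𝕜 E) U p).toLinearMap ∘ₗ
    formAt (flowDerivation hU isFlow_actRightL) F = rightL (𝕜 := 𝕜) (E := E) F.1 p :=
  LinearMap.ext fun X => evalAt_flowDerivation hU isFlow_actRightL X F hp

theorem evalAt_formAt_actLeftM (hp : p ∈ U) :
    (evalAt (tripleModel 𝕜 E) U p).toLinearMap ∘ₗ
    formAt (flowDerivation hU isFlow_actLeftM) F = leftM (𝕜 := 𝕜) (E := E) F.1 p :=
  LinearMap.ext fun X => evalAt_flowDerivation hU isFlow_actLeftM X F hp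

theorem evalAt_formAt_actRightM (hp : p ∈ U) :
    (evalAt (tripleModel 𝕜 E) U p).toLinearMap ∘ₗ
    formAt (flowDerivation hU isFlow_actRightM) F = rightM (𝕜 := 𝕜) (E := E) F.1 p :=
  LinearMap.ext fun X => evalAt_flowDerivation hU isFlow_actRightM X F hp

theorem evalAt_formAt_actLeftR (hp : p ∈ U) :
    (evalAt (tripleModel 𝕜 E) U p).toLinearMap ∘ₗ
    formAt (flowDerivation hU isFlow_actLeftR) F = leftR (𝕜 := 𝕜) (E := E) F.1 p :=
  LinearMap.ext fun X => evalAt_flowDerivation hU isFlow_actLeftR X F hp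

theorem evalAt_formAt_actRightR (hp : p ∈ U) :
    (evalAt (tripleModel 𝕜 E) U p).toLinearMap ∘ₗ
    formAt (flowDerivation hU isFlow_actRightR) F = rightR (𝕜 := 𝕜) (E := E) F.1 p :=
  LinearMap.ext fun X => evalAt_flowDerivation hU isFlow_actRightR X F hp

end Forms

variable [FiniteDimensional 𝕜 E] (hR : IsSmoothTensorOn T R s) (hU : IsOpen U)
  (hUs : U ⊆ domain s)

theorem bracketMap_apply (hT : IsCasimirPair 𝕜 T T') (hr : IsAntisymm₂ r)
    (ha : ∀ Ω ∈ s, IsAntisymm₂ (R Ω)) (F H : SmoothFunctions (𝕜 := 𝕜) (tripleModel 𝕜 E) U)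
    {p : G × G × G} (hp : p ∈ U) :
    (bracketMap T T' r hR hU hUs F H).1 p = poissonBracket T T' r R F.1 H.1 p := by
  have h1 := halfBracket_apply hT (evalAt (tripleModel 𝕜 E) U p) (c := coeffL hR hUs) hr
    (ha _ (hUs hp).1)
    (fun i j => tensorCoeff_apply hR (J := tripleModel 𝕜 E) (π := fun p : G × G × G => p.1)
      contMDiff_fst (mapsTo_first hUs) i j hp)
    (flowDerivation hU isFlow_actLeftL) (flowDerivation hU isFlow_actRightL)
    (flowDerivation hU isFlow_actLeftM) F H
  have h2 := halfBracket_apply hT (evalAt (tripleModel 𝕜 E) U p) (c := coeffR hR hUs) hr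
    (ha _ (hUs hp).2.2)
    (fun i j => tensorCoeff_apply hR (J := tripleModel 𝕜 E) (π := fun p : G × G × G => p.2.2)
      contMDiff_third (mapsTo_third hUs) i j hp)
    (flowDerivation hU isFlow_actLeftR) (flowDerivation hU isFlow_actRightR)
    (-flowDerivation hU isFlow_actRightM) F H
  simp only [evalAt_comp_formAt_neg, evalAt_formAt_actLeftL hU _ hp,
    evalAt_formAt_actRightL hU _ hp, evalAt_formAt_actLeftM hU _ hp,
    evalAt_formAt_actRightM hU _ hp, evalAt_formAt_actLeftR hU _ hp,
    evalAt_formAt_actRightR hU _ hp] at h1 h2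
  rw [poissonBracket_eq, ← h1, ← h2]
  exact map_sub (evalAt (tripleModel 𝕜 E) U p) _ _

end TripleProduct

/-! ### The Jacobi identity -/

section Jacobi

open Set Filter Topology

variable {𝕜 : Type*} [RCLike 𝕜] {E : Type*} [NormedAddCommGroup E] [NormedSpace 𝕜 E]
  {G : Type*} [TopologicalSpace G] [ChartedSpace E G] [Group G] [LieGroup 𝓘(𝕜, E) ∞ G]
  [CompleteSpace E] [FiniteDimensional 𝕜 E] {ι : Type*} [Fintype ι]
  {T T' : Module.Basis ι 𝕜 (GroupLieAlgebra 𝓘(𝕜, E) G)}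
  {r : GroupLieAlgebra 𝓘(𝕜, E) G ⊗[𝕜] GroupLieAlgebra 𝓘(𝕜, E) G}
  {R : G → GroupLieAlgebra 𝓘(𝕜, E) G ⊗[𝕜] GroupLieAlgebra 𝓘(𝕜, E) G} {s : Set G}
  {U : Set (G × G × G)}
  (hR : IsSmoothTensorOn T R s) (hU : IsOpen U) (hUs : U ⊆ domain s)

theorem isBiderivation_bracketMap (r : GroupLieAlgebra 𝓘(𝕜, E) G ⊗[𝕜] GroupLieAlgebra 𝓘(𝕜, E) G) :
    IsBiderivation (bracketMap T T' r hR hU hUs) :=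
  (isBiderivation_halfBracket _ _ _ _ _).sub (isBiderivation_halfBracket _ _ _ _ _)

/-- The two halves act on different variables, except for `g`, where left and right multiplications
commute. -/
theorem schouten_bracketMap :
    schouten (bracketMap T T' r hR hU hUs) (bracketMap T T' r hR hU hUs) =
      schouten (bracketL T T' r hR hU hUs) (bracketL T T' r hR hU hUs) +
        schouten (bracketR T T' r hR hU hUs) (bracketR T T' r hR hU hUs) := by
  have hneg {Φ : G → G × G × G → G × G × G}
      (hΦ : IsFlow (𝕜 := 𝕜) (E := E) (tripleModel 𝕜 E) Φ)
      (hc : ∀ h k p, actRightM k (Φ h p) = Φ h (actRightM k p))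
      (X Y : GroupLieAlgebra 𝓘(𝕜, E) G) :
      ⁅flowDerivation hU hΦ X, (-flowDerivation hU isFlow_actRightM) Y⁆ = 0 := by
    rw [LinearMap.neg_apply, lie_neg, flowDerivation_lie_of_commute hU hΦ isFlow_actRightM hc,
      neg_zero]
  exact schouten_sub_halfBracket _
    (flowDerivation_lie_of_commute hU isFlow_actLeftL isFlow_actLeftR fun _ _ _ => rfl)
    (flowDerivation_lie_of_commute hU isFlow_actLeftL isFlow_actRightR fun _ _ _ => rfl)
    (hneg isFlow_actLeftL fun _ _ _ => rfl)
    (flowDerivation_lie_of_commute hU isFlow_actRightL isFlow_actLeftR fun _ _ _ => rfl)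
    (flowDerivation_lie_of_commute hU isFlow_actRightL isFlow_actRightR fun _ _ _ => rfl)
    (hneg isFlow_actRightL fun _ _ _ => rfl)
    (flowDerivation_lie_of_commute hU isFlow_actLeftM isFlow_actLeftR fun _ _ _ => rfl)
    (flowDerivation_lie_of_commute hU isFlow_actLeftM isFlow_actRightR fun _ _ _ => rfl)
    (hneg isFlow_actLeftM fun _ _ _ => by simp only [actLeftM, actRightM, mul_assoc])
    (flowDerivation_tensorCoeff_eq_zero hR contMDiff_third (mapsTo_third hUs) hU isFlow_actLeftL
      fun _ _ => rfl)
    (flowDerivation_tensorCoeff_eq_zero hR contMDiff_third (mapsTo_third hUs) hU isFlow_actRightL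
      fun _ _ => rfl)
    (flowDerivation_tensorCoeff_eq_zero hR contMDiff_third (mapsTo_third hUs) hU isFlow_actLeftM
      fun _ _ => rfl)
    (flowDerivation_tensorCoeff_eq_zero hR contMDiff_fst (mapsTo_first hUs) hU isFlow_actLeftR fun
      _ _ => rfl)
    (flowDerivation_tensorCoeff_eq_zero hR contMDiff_fst (mapsTo_first hUs) hU isFlow_actRightR fun
      _ _ => rfl)
    (fun X i j => by
      rw [LinearMap.neg_apply, Derivation.neg_apply,
        flowDerivation_tensorCoeff_eq_zero hR contMDiff_fst (mapsTo_first hUs) hU isFlow_actRightM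
          fun _ _ => rfl,
        neg_zero])

variable [DecidableEq ι] [ConnectedSpace G] {B : LinearMap.BilinForm 𝕜 (GroupLieAlgebra 𝓘(𝕜, E) G)}

theorem isDynamicalFamily_left (hi : ∀ X Y Z, B ⁅X, Y⁆ Z = B X ⁅Y, Z⁆)
    (hd : ∀ a b, B (T a) (T' b) = if a = b then 1 else 0)
    (hs : IsOpen s) (ha : ∀ Ω ∈ s, IsAntisymm₂ (R Ω)) (he : IsEquivariantOn R s) :
    IsDynamicalFamily T T' (flowDerivation hU isFlow_actLeftL)
      (flowDerivation hU isFlow_actRightL) (flowDerivation hU isFlow_actLeftM) (coeffL hR hUs) := by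
  refine isDynamicalFamily_flowDerivation hR contMDiff_fst (mapsTo_first hUs) hi hd hs ha he hU
    isFlow_actLeftL
    isFlow_actRightL ?_ ?_ ?_ ?_ (fun _ _ => rfl) (fun _ _ => rfl)
    (flowDerivation_lie_of_left_action hU isFlow_actLeftM ?_)
    (flowDerivation_lie_of_commute hU isFlow_actLeftL isFlow_actLeftM fun _ _ _ => rfl)
    (flowDerivation_lie_of_commute hU isFlow_actRightL isFlow_actLeftM fun _ _ _ => rfl)
    (flowDerivation_tensorCoeff_eq_zero hR contMDiff_fst (mapsTo_first hUs) hU isFlow_actLeftM fun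
      _ _ => rfl)
  all_goals intros; simp [actLeftL, actRightL, actLeftM, mul_assoc]

/-- Right multiplications satisfy the commutation relations with the opposite sign; negating the
family restores those required of `m`. -/
theorem isDynamicalFamily_right (hi : ∀ X Y Z, B ⁅X, Y⁆ Z = B X ⁅Y, Z⁆)
    (hd : ∀ a b, B (T a) (T' b) = if a = b then 1 else 0)
    (hs : IsOpen s) (ha : ∀ Ω ∈ s, IsAntisymm₂ (R Ω)) (he : IsEquivariantOn R s) :
    IsDynamicalFamily T T' (flowDerivation hU isFlow_actLeftR)
      (flowDerivation hU isFlow_actRightR) (-flowDerivation hU isFlow_actRightM)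
      (coeffR hR hUs) := by
  refine isDynamicalFamily_flowDerivation hR contMDiff_third (mapsTo_third hUs) hi hd hs ha he hU
    isFlow_actLeftR
    isFlow_actRightR ?_ ?_ ?_ ?_ (fun _ _ => rfl) (fun _ _ => rfl) (fun X Y => ?_) (fun X Y => ?_)
    (fun X Y => ?_) (fun X i j => ?_)
  iterate 4 intros; simp [actLeftR, actRightR, mul_assoc]
  · rw [LinearMap.neg_apply, LinearMap.neg_apply, LinearMap.neg_apply, neg_lie, lie_neg, neg_neg,
      neg_neg]
    exact flowDerivation_lie_of_right_action hU isFlow_actRightM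
      (fun _ _ _ => by simp only [actRightM, mul_assoc]) X Y
  · rw [LinearMap.neg_apply, lie_neg, flowDerivation_lie_of_commute hU isFlow_actLeftR
      isFlow_actRightM fun _ _ _ => rfl, neg_zero]
  · rw [LinearMap.neg_apply, lie_neg, flowDerivation_lie_of_commute hU isFlow_actRightR
      isFlow_actRightM fun _ _ _ => rfl, neg_zero]
  · rw [LinearMap.neg_apply, Derivation.neg_apply,
      flowDerivation_tensorCoeff_eq_zero hR contMDiff_third (mapsTo_third hUs) hU isFlow_actRightM
        fun _ _ => rfl,
      neg_zero]

/-- The failure of the Jacobi identity. -/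
theorem evalAt_jacobiator (hB : B.IsSymm) (hi : ∀ X Y Z, B ⁅X, Y⁆ Z = B X ⁅Y, Z⁆)
    (hd : ∀ a b, B (T a) (T' b) = if a = b then 1 else 0) (hr : IsAntisymm₂ r)
    (hyb : ModifiedCYBE T T' r) (hs : IsOpen s) (ha : ∀ Ω ∈ s, IsAntisymm₂ (R Ω))
    (he : IsEquivariantOn R s) (F F' F'' : SmoothFunctions (𝕜 := 𝕜) (tripleModel 𝕜 E) U)
    {p : G × G × G} (hp : p ∈ U) :
    evalAt (tripleModel 𝕜 E) U p
        (bracketMap T T' r hR hU hUs (bracketMap T T' r hR hU hUs F F') F'' +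
          bracketMap T T' r hR hU hUs (bracketMap T T' r hR hU hUs F' F'') F +
          bracketMap T T' r hR hU hUs (bracketMap T T' r hR hU hUs F'' F) F') =
      (1 / 6) * altEval (leftM (𝕜 := 𝕜) (E := E) F.1 p) (leftM (𝕜 := 𝕜) (E := E) F'.1 p)
        (leftM (𝕜 := 𝕜) (E := E) F''.1 p) (plcdybeLHS T T' R p.1 -
          TensorProduct.map (Ad 𝕜 p.2.1) (TensorProduct.map (Ad 𝕜 p.2.1) (Ad 𝕜 p.2.1))
            (plcdybeLHS T T' R p.2.2)) := by
  have hT := isCasimirPair_of_dual hB hi hd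
  have h0 := congrArg (evalAt (tripleModel 𝕜 E) U p)
    ((jacobiator_eq (bracketMap T T' r hR hU hUs) F F' F'').trans
      (congrFun (congrFun (congrFun (schouten_bracketMap hR hU hUs) F) F') F''))
  have hL := evalAt_schouten_halfBracket hR (J := tripleModel 𝕜 E) (π := fun p : G × G × G => p.1)
    contMDiff_fst (mapsTo_first hUs) hT hr hyb hU isFlow_actLeftL isFlow_actRightL
    (fun _ _ => rfl) (fun _ _ => rfl) (isDynamicalFamily_left hR hU hUs hi hd hs ha he) hp F F' F''
  have hR' := evalAt_schouten_halfBracket hR (J := tripleModel 𝕜 E)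
    (π := fun p : G × G × G => p.2.2)
    contMDiff_third (mapsTo_third hUs) hT hr hyb hU isFlow_actLeftR isFlow_actRightR
    (fun _ _ => rfl) (fun _ _ => rfl) (isDynamicalFamily_right hR hU hUs hi hd hs ha he) hp F F' F''
  -- Both halves are expressed by the left differentials in `g`; for the right half this costs `Ad`
  -- of `g` and a sign.
  have hm (F : SmoothFunctions (𝕜 := 𝕜) (tripleModel 𝕜 E) U) :
      (evalAt (tripleModel 𝕜 E) U p).toLinearMap ∘ₗ
        formAt (-flowDerivation hU isFlow_actRightM) F =
      -(leftM (𝕜 := 𝕜) (E := E) F.1 p ∘ₗ Ad 𝕜 p.2.1) := by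
    rw [evalAt_comp_formAt_neg, ← evalAt_formAt_actLeftM hU F hp,
      evalAt_formAt_conj hU isFlow_actLeftM isFlow_actRightM F hp (x := p.2.1)
        fun h => by simp [actLeftM, actRightM]]
  rw [evalAt_formAt_actLeftM hU F hp, evalAt_formAt_actLeftM hU F' hp,
    evalAt_formAt_actLeftM hU F'' hp] at hL
  -- Three signs make the right contribution odd, and the structure tensor is Ad-invariant, so its
  -- two occurrences cancel in the sum.
  rw [hm, hm, hm, altEval_neg, altEval_neg, ← altEval_map, ← altEval_map,
    map_structureTensor hd (bilin_Ad_Ad B hi p.2.1) (Ad_surjective p.2.1) (Ad_lie p.2.1)] at hR'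
  rw [map_mul, map_ofNat] at h0
  rw [map_sub]
  have h1 := h0.trans ((map_add (evalAt (tripleModel 𝕜 E) U p) _ _).trans
    (congrArg₂ (· + ·) hL hR'))
  linear_combination (1 / 2 : 𝕜) * h1

end Jacobi

/-! ### The Poisson property and the dynamical Yang-Baxter equation -/

/-- `br` acts on arbitrary functions, `P` on elements of the algebra. Agreement on `U` transfers
every axiom except the Jacobi identity, which is supplied. -/
theorem IsBiderivation.isPoissonBracketOn {𝕜 : Type*} [RCLike 𝕜] {V : Type*}
    [NormedAddCommGroup V] [NormedSpace 𝕜 V] {H : Type*} [TopologicalSpace H]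
    {J : ModelWithCorners 𝕜 V H} {M : Type*} [TopologicalSpace M] [ChartedSpace H M] {U : Set M}
    {P : SmoothFunctions (𝕜 := 𝕜) J U →ₗ[𝕜] SmoothFunctions (𝕜 := 𝕜) J U →ₗ[𝕜]
      SmoothFunctions (𝕜 := 𝕜) J U} (hP : IsBiderivation P) {br : (M → 𝕜) → (M → 𝕜) → M → 𝕜}
    (key : ∀ F F' : SmoothFunctions (𝕜 := 𝕜) J U, ∀ p ∈ U, (P F F').1 p = br F.1 F'.1 p)
    (hc : ∀ f f' h h' : M → 𝕜, Set.EqOn f f' U → Set.EqOn h h' U →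
      ∀ p ∈ U, br f h p = br f' h' p)
    (hJ : ∀ F F' F'' : SmoothFunctions (𝕜 := 𝕜) J U, ∀ p ∈ U, br (br F.1 F'.1) F''.1 p +
      br (br F'.1 F''.1) F.1 p + br (br F''.1 F.1) F'.1 p = 0) :
    IsPoissonBracketOn J U br where
  congr f f' h h' _ _ hf hh p hp := hc f f' h h' hf hh p hp
  smooth f h hf hh := (P (.mk f hf) (.mk h hh)).contMDiffOn.congr
    fun p hp => (key (.mk f hf) (.mk h hh) p hp).symm
  add_left f f' h hf hf' hh p hp := by
    have h1 : P (.mk f hf + .mk f' hf') (.mk h hh) =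
        P (.mk f hf) (.mk h hh) + P (.mk f' hf') (.mk h hh) := by
      rw [map_add, LinearMap.add_apply]
    exact (key (.mk f hf + .mk f' hf') (.mk h hh) p hp).symm.trans
      ((congrArg (evalAt J U p) h1).trans
        (congrArg₂ (· + ·) (key (.mk f hf) (.mk h hh) p hp) (key (.mk f' hf') (.mk h hh) p hp)))
  smul_left c f h hf hh p hp := by
    have h1 : P (c • .mk f hf) (.mk h hh) = c • P (.mk f hf) (.mk h hh) := by
      rw [map_smul, LinearMap.smul_apply]
    exact (key (c • .mk f hf) (.mk h hh) p hp).symm.trans ((congrArg (evalAt J U p) h1).trans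
      (congrArg (c • ·) (key (.mk f hf) (.mk h hh) p hp)))
  skew f h hf hh p hp :=
    (key (.mk f hf) (.mk h hh) p hp).symm.trans
      ((congrArg (evalAt J U p) (hP.skew (.mk f hf) (.mk h hh))).trans
        (congrArg Neg.neg (key (.mk h hh) (.mk f hf) p hp)))
  leibniz f f' h hf hf' hh p hp :=
    (key (.mk f hf * .mk f' hf') (.mk h hh) p hp).symm.trans
      ((congrArg (evalAt J U p) (hP.leibniz (.mk f hf) (.mk f' hf') (.mk h hh))).trans
        (congrArg₂ (fun a b => f p * a + f' p * b) (key (.mk f' hf') (.mk h hh) p hp)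
          (key (.mk f hf) (.mk h hh) p hp)))
  jacobi f h k hf hh hk p hp := hJ (.mk f hf) (.mk h hh) (.mk k hk) p hp

section Main

open Set Filter Topology

variable {𝕜 : Type*} [RCLike 𝕜] {E : Type*} [NormedAddCommGroup E] [NormedSpace 𝕜 E]
  {G : Type*} [TopologicalSpace G] [ChartedSpace E G] [Group G] [LieGroup 𝓘(𝕜, E) ∞ G]

/-- Every linear form is the differential of a local function of `g`. -/
theorem exists_leftM_eq [FiniteDimensional 𝕜 E] {W : Set G}
    (hW : ∀ ℓ : GroupLieAlgebra 𝓘(𝕜, E) G →ₗ[𝕜] 𝕜, ∃ f : G → 𝕜,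
      ContMDiffOn 𝓘(𝕜, E) 𝓘(𝕜, 𝕜) ∞ f W ∧ ∀ X : GroupLieAlgebra 𝓘(𝕜, E) G, dirDeriv f 1 X = ℓ X)
    {U : Set (G × G × G)} {p : G × G × G} (hU : ∀ q ∈ U, q.2.1 * p.2.1⁻¹ ∈ W)
    (ℓ : GroupLieAlgebra 𝓘(𝕜, E) G →ₗ[𝕜] 𝕜) :
    ∃ f : G × G × G → 𝕜, ContMDiffOn (tripleModel 𝕜 E) 𝓘(𝕜, 𝕜) ∞ f U ∧
      leftM (𝕜 := 𝕜) (E := E) f p = ℓ := by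
  obtain ⟨f, hf, hℓ⟩ := hW ℓ
  refine ⟨fun q => f (q.2.1 * p.2.1⁻¹), ?_, LinearMap.ext fun X => ?_⟩
  · exact hf.comp (contMDiff_snd.fst.mul contMDiff_const).contMDiffOn hU
  · rw [← hℓ]
    change dirDeriv (fun h : G => f (h * p.2.1 * p.2.1⁻¹)) 1 X = _
    simp only [mul_inv_cancel_right]

theorem isOpen_domain {s : Set G} (hs : IsOpen s) : IsOpen (domain s) :=
  hs.prod (isOpen_univ.prod hs)

variable [CompleteSpace E] [FiniteDimensional 𝕜 E] {ι : Type*} [Fintype ι]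
  {T T' : Module.Basis ι 𝕜 (GroupLieAlgebra 𝓘(𝕜, E) G)}
  {r : GroupLieAlgebra 𝓘(𝕜, E) G ⊗[𝕜] GroupLieAlgebra 𝓘(𝕜, E) G}
  {R : G → GroupLieAlgebra 𝓘(𝕜, E) G ⊗[𝕜] GroupLieAlgebra 𝓘(𝕜, E) G} {s : Set G}
  {U : Set (G × G × G)}

/-! ### From the algebraic bracket to the Poisson axioms -/

section Bracket

variable (hR : IsSmoothTensorOn T R s) (hU : IsOpen U) (hUs : U ⊆ domain s)

theorem evalAt_cyclic_bracketMap (hT : IsCasimirPair 𝕜 T T') (hr : IsAntisymm₂ r)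
    (ha : ∀ Ω ∈ s, IsAntisymm₂ (R Ω)) (F H K : SmoothFunctions (𝕜 := 𝕜) (tripleModel 𝕜 E) U)
    {p : G × G × G} (hp : p ∈ U) :
    evalAt (tripleModel 𝕜 E) U p
        (bracketMap T T' r hR hU hUs (bracketMap T T' r hR hU hUs F H) K +
          bracketMap T T' r hR hU hUs (bracketMap T T' r hR hU hUs H K) F +
          bracketMap T T' r hR hU hUs (bracketMap T T' r hR hU hUs K F) H) =
      poissonBracket T T' r R (poissonBracket T T' r R F.1 H.1) K.1 p +
        poissonBracket T T' r R (poissonBracket T T' r R H.1 K.1) F.1 p +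
        poissonBracket T T' r R (poissonBracket T T' r R K.1 F.1) H.1 p := by
  have h1 (F H K : SmoothFunctions (𝕜 := 𝕜) (tripleModel 𝕜 E) U) :
      (bracketMap T T' r hR hU hUs (bracketMap T T' r hR hU hUs F H) K).1 p =
        poissonBracket T T' r R (poissonBracket T T' r R F.1 H.1) K.1 p := by
    rw [bracketMap_apply hR hU hUs hT hr ha _ _ hp]
    -- The inner brackets agree only on `U`; since `U` is open, this is enough for the outer one.
    exact poissonBracket_congr hU (fun q hq => bracketMap_apply hR hU hUs hT hr ha F H hq)
      (fun _ _ => rfl) hp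
  rw [← h1, ← h1, ← h1]
  rfl

theorem isPoissonBracketOn_of_jacobi (hT : IsCasimirPair 𝕜 T T') (hr : IsAntisymm₂ r)
    (ha : ∀ Ω ∈ s, IsAntisymm₂ (R Ω))
    (hJ : ∀ F H K : SmoothFunctions (𝕜 := 𝕜) (tripleModel 𝕜 E) U, ∀ p ∈ U,
      evalAt (tripleModel 𝕜 E) U p
        (bracketMap T T' r hR hU hUs (bracketMap T T' r hR hU hUs F H) K +
          bracketMap T T' r hR hU hUs (bracketMap T T' r hR hU hUs H K) F +
          bracketMap T T' r hR hU hUs (bracketMap T T' r hR hU hUs K F) H) = 0) :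
    IsPoissonBracketOn (tripleModel 𝕜 E) U (poissonBracket T T' r R) :=
  (isBiderivation_bracketMap hR hU hUs r).isPoissonBracketOn
    (fun F H _ hp => bracketMap_apply hR hU hUs hT hr ha F H hp)
    (fun _ _ _ _ hf hh _ hp => poissonBracket_congr hU hf hh hp)
    fun F H K p hp => (evalAt_cyclic_bracketMap hR hU hUs hT hr ha F H K hp).symm.trans
      (hJ F H K p hp)

end Bracket

variable [DecidableEq ι] [ConnectedSpace G] {B : LinearMap.BilinForm 𝕜 (GroupLieAlgebra 𝓘(𝕜, E) G)}

theorem isPoissonBracketOn_of_satisfiesPLCDYBE (hB : B.IsSymm)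
    (hi : ∀ X Y Z, B ⁅X, Y⁆ Z = B X ⁅Y, Z⁆)
    (hd : ∀ a b, B (T a) (T' b) = if a = b then 1 else 0) (hr : IsAntisymm₂ r)
    (hyb : ModifiedCYBE T T' r) (hs : IsOpen s) (ha : ∀ Ω ∈ s, IsAntisymm₂ (R Ω))
    (hR : IsSmoothTensorOn T R s) (he : IsEquivariantOn R s) (h : SatisfiesPLCDYBE T T' R s)
    (hU : IsOpen U) (hUs : U ⊆ domain s) :
    IsPoissonBracketOn (tripleModel 𝕜 E) U (poissonBracket T T' r R) := by
  obtain ⟨c, -, hc, h⟩ := h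
  refine isPoissonBracketOn_of_jacobi hR hU hUs (isCasimirPair_of_dual hB hi hd) hr ha
    fun F H K p hp => ?_
  rw [evalAt_jacobiator hR hU hUs hB hi hd hr hyb hs ha he F H K hp, h _ (hUs hp).1,
    h _ (hUs hp).2.2, hc, sub_self, map_zero, mul_zero]

/-- The Jacobiator is an alternating evaluation on differentials in `g`. By `hf` these are
arbitrary, so the antisymmetric difference of the two sides vanishes. -/
theorem plcdybeLHS_eq_map_of_isPoissonBracketOn (hB : B.IsSymm)
    (hi : ∀ X Y Z, B ⁅X, Y⁆ Z = B X ⁅Y, Z⁆)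
    (hd : ∀ a b, B (T a) (T' b) = if a = b then 1 else 0) (hr : IsAntisymm₂ r)
    (hyb : ModifiedCYBE T T' r) (hs : IsOpen s) (ha : ∀ Ω ∈ s, IsAntisymm₂ (R Ω))
    (hR : IsSmoothTensorOn T R s) (he : IsEquivariantOn R s)
    (hU : IsOpen U) (hUs : U ⊆ domain s)
    (h : IsPoissonBracketOn (tripleModel 𝕜 E) U (poissonBracket T T' r R))
    {p : G × G × G} (hp : p ∈ U)
    (hf : ∀ ℓ : GroupLieAlgebra 𝓘(𝕜, E) G →ₗ[𝕜] 𝕜, ∃ f : G × G × G → 𝕜,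
      ContMDiffOn (tripleModel 𝕜 E) 𝓘(𝕜, 𝕜) ∞ f U ∧ leftM (𝕜 := 𝕜) (E := E) f p = ℓ) :
    plcdybeLHS T T' R p.1 =
      TensorProduct.map (Ad 𝕜 p.2.1) (TensorProduct.map (Ad 𝕜 p.2.1) (Ad 𝕜 p.2.1))
        (plcdybeLHS T T' R p.2.2) := by
  have h1 := isAntisymm₃_plcdybeLHS (T := T) (T' := T') hs ha (hUs hp).1
  have h2 := (isAntisymm₃_plcdybeLHS (T := T) (T' := T') hs ha (hUs hp).2.2).map (Ad 𝕜 p.2.1)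
  refine sub_eq_zero.1 ((h1.sub h2).eq_zero T fun α β γ => ?_)
  obtain ⟨f, hf1, rfl⟩ := hf α
  obtain ⟨f', hf1', rfl⟩ := hf β
  obtain ⟨f'', hf1'', rfl⟩ := hf γ
  have h3 := evalAt_jacobiator hR hU hUs hB hi hd hr hyb hs ha he (.mk f hf1) (.mk f' hf1')
    (.mk f'' hf1'') hp
  rw [evalAt_cyclic_bracketMap hR hU hUs (isCasimirPair_of_dual hB hi hd) hr ha _ _ _ hp] at h3
  exact (mul_eq_zero_iff_left (by norm_num)).1 (h3.symm.trans (h.jacobi f f' f'' hf1 hf1' hf1'' p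
    hp))

theorem satisfiesPLCDYBE_of_eq_map (hs : IsOpen s) (ha : ∀ Ω ∈ s, IsAntisymm₂ (R Ω))
    (h : ∀ p ∈ domain s, plcdybeLHS T T' R p.1 =
      TensorProduct.map (Ad 𝕜 p.2.1) (TensorProduct.map (Ad 𝕜 p.2.1) (Ad 𝕜 p.2.1))
        (plcdybeLHS T T' R p.2.2)) : SatisfiesPLCDYBE T T' R s := by
  obtain rfl | ⟨Ω, hΩ⟩ := s.eq_empty_or_nonempty
  -- Over the empty set any invariant tensor serves.
  · exact ⟨0, isAntisymm₃_zero, fun q => map_zero _, fun _ h => h.elim⟩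
  -- Equal arguments `Ω^L = Ω^R` give invariance of the value at `Ω`; then `g = 1` compares every
  -- other value with it.
  · have h1 (q : G) : TensorProduct.map (Ad 𝕜 q) (TensorProduct.map (Ad 𝕜 q) (Ad 𝕜 q))
        (plcdybeLHS T T' R Ω) = plcdybeLHS T T' R Ω := (h (Ω, q, Ω) ⟨hΩ, mem_univ _, hΩ⟩).symm
    exact ⟨plcdybeLHS T T' R Ω, isAntisymm₃_plcdybeLHS hs ha hΩ, h1,
      fun Ω' hΩ' => (h (Ω', 1, Ω) ⟨hΩ', mem_univ _, hΩ⟩).trans (h1 1)⟩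

/-- A bump function equal to one near `1` extends the chart function to the whole group without
changing its differential there. -/
theorem exists_contMDiff_dirDeriv_one_eq {E : Type*} [NormedAddCommGroup E] [NormedSpace ℝ E]
    [FiniteDimensional ℝ E] {G : Type*} [TopologicalSpace G] [T2Space G] [ChartedSpace E G]
    [Group G] [LieGroup 𝓘(ℝ, E) ∞ G] (ℓ : GroupLieAlgebra 𝓘(ℝ, E) G →ₗ[ℝ] ℝ) :
    ∃ f : G → ℝ, ContMDiffOn 𝓘(ℝ, E) 𝓘(ℝ, ℝ) ∞ f univ ∧
      ∀ X : GroupLieAlgebra 𝓘(ℝ, E) G, dirDeriv f 1 X = ℓ X := by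
  obtain ⟨f, hf, hℓ⟩ := exists_dirDeriv_one_eq ℓ
  let χ : SmoothBumpFunction 𝓘(ℝ, E) (1 : G) := Classical.arbitrary _
  refine ⟨fun y => χ y • f y, (χ.contMDiff_smul hf).contMDiffOn, fun X => ?_⟩
  rw [← hℓ]
  refine dirDeriv_congr ?_ X
  filter_upwards [χ.eventuallyEq_one] with y hy
  rw [hy, Pi.one_apply, one_smul]

end Main

end PLCDYBE

end

theorem proposition1 :
    -- the real, smooth case
    (∀ (E : Type*) [NormedAddCommGroup E] [NormedSpace ℝ E] [FiniteDimensional ℝ E]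
      (G : Type*) [TopologicalSpace G] [T2Space G] [ConnectedSpace G] [ChartedSpace E G] [Group G]
      [LieGroup 𝓘(ℝ, E) ∞ G]
      -- the invariant scalar product and a pair of dual bases
      (B : LinearMap.BilinForm ℝ (GroupLieAlgebra 𝓘(ℝ, E) G))
      (_ : B.IsSymm) (_ : B.Nondegenerate) (_ : ∀ X Y Z, B ⁅X, Y⁆ Z = B X ⁅Y, Z⁆)
      (ι : Type*) [Fintype ι] [DecidableEq ι]
      (T T' : Module.Basis ι ℝ (GroupLieAlgebra 𝓘(ℝ, E) G))
      (_ : ∀ a b, B (T a) (T' b) = if a = b then 1 else 0)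
      -- the constant `r`-matrix
      (r : GroupLieAlgebra 𝓘(ℝ, E) G ⊗[ℝ] GroupLieAlgebra 𝓘(ℝ, E) G)
      (_ : PLCDYBE.IsAntisymm₂ r) (_ : PLCDYBE.ModifiedCYBE T T' r)
      -- the conjugation-stable open set and the dynamical `r`-matrix on it
      (s : Set G) (_ : IsOpen s) (_ : ∀ q : G, ∀ Ω ∈ s, q * Ω * q⁻¹ ∈ s)
      (R : G → GroupLieAlgebra 𝓘(ℝ, E) G ⊗[ℝ] GroupLieAlgebra 𝓘(ℝ, E) G)
      (_ : ∀ Ω ∈ s, PLCDYBE.IsAntisymm₂ (R Ω)) (_ : PLCDYBE.IsSmoothTensorOn T R s)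
      (_ : PLCDYBE.IsEquivariantOn R s),
      PLCDYBE.IsPoissonBracketOn (𝓘(ℝ, E).prod (𝓘(ℝ, E).prod 𝓘(ℝ, E)))
          (PLCDYBE.domain s) (PLCDYBE.poissonBracket T T' r R) ↔
        PLCDYBE.SatisfiesPLCDYBE T T' R s) ∧
    -- the complex, holomorphic case (with locally defined holomorphic functions)
    (∀ (E : Type*) [NormedAddCommGroup E] [NormedSpace ℂ E] [FiniteDimensional ℂ E]
      (G : Type*) [TopologicalSpace G] [T2Space G] [ConnectedSpace G] [ChartedSpace E G] [Group G]
      [LieGroup 𝓘(ℂ, E) ∞ G]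
      -- the invariant scalar product and a pair of dual bases
      (B : LinearMap.BilinForm ℂ (GroupLieAlgebra 𝓘(ℂ, E) G))
      (_ : B.IsSymm) (_ : B.Nondegenerate) (_ : ∀ X Y Z, B ⁅X, Y⁆ Z = B X ⁅Y, Z⁆)
      (ι : Type*) [Fintype ι] [DecidableEq ι]
      (T T' : Module.Basis ι ℂ (GroupLieAlgebra 𝓘(ℂ, E) G))
      (_ : ∀ a b, B (T a) (T' b) = if a = b then 1 else 0)
      -- the constant `r`-matrix
      (r : GroupLieAlgebra 𝓘(ℂ, E) G ⊗[ℂ] GroupLieAlgebra 𝓘(ℂ, E) G)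
      (_ : PLCDYBE.IsAntisymm₂ r) (_ : PLCDYBE.ModifiedCYBE T T' r)
      -- the conjugation-stable open set and the dynamical `r`-matrix on it
      (s : Set G) (_ : IsOpen s) (_ : ∀ q : G, ∀ Ω ∈ s, q * Ω * q⁻¹ ∈ s)
      (R : G → GroupLieAlgebra 𝓘(ℂ, E) G ⊗[ℂ] GroupLieAlgebra 𝓘(ℂ, E) G)
      (_ : ∀ Ω ∈ s, PLCDYBE.IsAntisymm₂ (R Ω)) (_ : PLCDYBE.IsSmoothTensorOn T R s)
      (_ : PLCDYBE.IsEquivariantOn R s),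
      (∀ U : Set (G × G × G), IsOpen U → U ⊆ PLCDYBE.domain s →
          PLCDYBE.IsPoissonBracketOn (𝓘(ℂ, E).prod (𝓘(ℂ, E).prod 𝓘(ℂ, E)))
            U (PLCDYBE.poissonBracket T T' r R)) ↔
        PLCDYBE.SatisfiesPLCDYBE T T' R s) := by
  refine ⟨?_, ?_⟩
  · intro E _ _ _ G _ _ _ _ _ _ B hB _ hi ι _ _ T T' hd r hr hyb s hs _ R ha hR he
    have : CompleteSpace E := FiniteDimensional.complete ℝ E
    have hD := PLCDYBE.isOpen_domain hs
    refine ⟨fun h => PLCDYBE.satisfiesPLCDYBE_of_eq_map hs ha fun p hp => ?_, fun h =>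
      PLCDYBE.isPoissonBracketOn_of_satisfiesPLCDYBE hB hi hd hr hyb hs ha hR he h hD subset_rfl⟩
    exact PLCDYBE.plcdybeLHS_eq_map_of_isPoissonBracketOn hB hi hd hr hyb hs ha hR he hD subset_rfl
      h hp (PLCDYBE.exists_leftM_eq PLCDYBE.exists_contMDiff_dirDeriv_one_eq
        fun _ _ => Set.mem_univ _)
  · intro E _ _ _ G _ _ _ _ _ _ B hB _ hi ι _ _ T T' hd r hr hyb s hs _ R ha hR he
    have : CompleteSpace E := FiniteDimensional.complete ℂ E
    refine ⟨fun h => PLCDYBE.satisfiesPLCDYBE_of_eq_map hs ha fun p hp => ?_, fun h U hU hUs =>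
      PLCDYBE.isPoissonBracketOn_of_satisfiesPLCDYBE hB hi hd hr hyb hs ha hR he h hU hUs⟩
    have hm : Continuous fun q : G × G × G => q.2.1 * p.2.1⁻¹ :=
      (contMDiff_mul_right (I := 𝓘(ℂ, E)) (n := ∞)).continuous.comp
        (continuous_fst.comp continuous_snd)
    have hU : IsOpen (PLCDYBE.domain s ∩ {q | q.2.1 * p.2.1⁻¹ ∈ (chartAt E (1 : G)).source}) :=
      (PLCDYBE.isOpen_domain hs).inter ((chartAt E (1 : G)).open_source.preimage hm)
    refine PLCDYBE.plcdybeLHS_eq_map_of_isPoissonBracketOn hB hi hd hr hyb hs ha hR he hU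
      Set.inter_subset_left (h _ hU Set.inter_subset_left) ⟨hp, ?_⟩
      (PLCDYBE.exists_leftM_eq PLCDYBE.exists_dirDeriv_one_eq fun _ hq => hq.2)
    simp
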